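/- Let $P>0$, let $V:\mathbb R\to\mathbb R$, and let $\mu_V$ be the equilibrium measure, that is, the minimizer over probability measures $\mu$ on $\mathbb R$ of $$\mathcal E(\mu)=\int_{\mathbb R}\Big(V+\ln\frac{d\mu}{dx}\Big)d\mu-P\iint_{\mathbb R^2}\ln|x-y|\,d\mu(x)\,d\mu(y)\quad\text{if }\mu\ll dx,\qquad \mathcal E(\mu)=+\infty\ \text{otherwise};$$ write $\rho_V$ for its density. Assume: (i) $V\in C^3(\mathbb R)$, $V(x)\to+\infty$ and $|V'(x)|\to+\infty$ as $|x|\to\infty$, and $\mu_V$ satisfies a Poincaré inequality: for some $C>0$, $\int\big(g-\int g\,d\mu_V\big)^2d\mu_V\le C\int (g')^2d\mu_V$ for all $g\in C^1_c(\mathbb R)$; (ii) for every real polynomial $Q$ and every $\alpha>0$, $Q(V'(x))e^{-V(x)}=o(|x|^{-\alpha})$ as $|x|\to\infty$; (iii) for every real sequence $(x_N)$ with $|x_N|\to\infty$ and all $a<b$, $V'(x_N)^{-2}\sup_{a\le x\le b}|V''(x_N+x)|\to0$; (iv) $V'(x)^{-2}$ is integrable at infinity (in a neighbourhood of $\pm\infty$),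 and $V''/V'=O(1)$, $V'''/V'=O(1)$ as $|x|\to\infty$. Let $\mathcal H[\phi](x)=\mathrm{p.v.}\!\int_{\mathbb R}\frac{\phi(t)}{t-x}\,dt$ and let $\mathcal L[u]=\Xi[u']$, where $$\Xi[\phi](x)=2P\int_{\mathbb R}\frac{\phi(x)-\phi(y)}{x-y}\,d\mu_V(y)+\phi'(x)-V'(x)\phi(x)-2P\int_{\mathbb R}\mathcal H[\phi\rho_V](y)\,d\mu_V(y).$$ Let $f\in C^2(\mathbb R)$ with $f,f',f''$ bounded and $\int f\,d\mu_V=0$. Then there is a unique $u\in C^3(\mathbb R)$ such that $u'\in H^2(\mathbb R)$, $u'''$ is bounded, $u\in L^2(\mu_V)$, $u'\in L^2(\mu_V)$, $\int u\,d\mu_V=0$, and $f=\mathcal L[u]$ on $\mathbb R$. For this $u$, all integrals and principal values in $\mathcal L[u]$ converge, and, as $|x|\to\infty$, $$u'(x)=O\big(V'(x)^{-1}\big),\qquad u''(x)=O\big(V'(x)^{-1}\big),\qquad u'''(x)=O\big(V'(x)^{-1}\big).$$ Moreover $\phi=u'$ belongs to $H^2(\mathbb R)\cap C^2(\mathbb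 R)$, and the functions $\phi''$, $V'''\phi^2$, $V''\phi\phi'$, $V''\phi^2$ and $V'\phi$ are bounded. -/

import Mathlib

open Real Set Filter Topology MeasureTheory Asymptotics Polynomial

noncomputable section

namespace HighTempBeta

/-- `g` is bounded on the whole real line. -/
def BoundedFun (g : ℝ → ℝ) : Prop := ∃ C : ℝ, ∀ x : ℝ, |g x| ≤ C

/-- The Lebesgue density of a measure `μ` on the line. Below it occurs only under integral signs,
so the choice of a version is immaterial. -/
def density (μ : Measure ℝ) (x : ℝ) : ℝ := (μ.rnDeriv volume x).toReal

/-- `μ` has finite energy: it is absolutely continuous and the confinement, the entropy and the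
logarithmic interaction are all finite. -/
structure FiniteEnergy (V : ℝ → ℝ) (μ : Measure ℝ) : Prop where
  ac : μ ≪ volume
  potential : Integrable V μ
  entropy : Integrable (fun x => log (density μ x)) μ
  interaction : Integrable (fun p : ℝ × ℝ => log |p.1 - p.2|) (μ.prod μ)

/-- The energy functional
`∫ (V + log (dμ/dx)) dμ - P ∬ log |x - y| dμ(x) dμ(y)`, used for measures of finite energy. -/
def energy (V : ℝ → ℝ) (P : ℝ) (μ : Measure ℝ) : ℝ :=
  (∫ x, (V x + log (density μ x)) ∂μ) - P * ∫ p : ℝ × ℝ, log |p.1 - p.2| ∂(μ.prod μ)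

/-- `μ` is the equilibrium measure: it minimizes the energy over all probability measures. The
energy of a probability measure that is not of finite energy is `+∞`, so that it suffices to
compare with those of finite energy (for `V` growing faster than linearly, the sum of the three
terms is finite if and only if each term is). -/
structure IsEquilibriumMeasure (V : ℝ → ℝ) (P : ℝ) (μ : Measure ℝ) : Prop where
  isProb : IsProbabilityMeasure μ
  finite : FiniteEnergy V μ
  minimal : ∀ ν : Measure ℝ, IsProbabilityMeasure ν → FiniteEnergy V ν →
    energy V P μ ≤ energy V P ν

/-- The Poincaré inequality for `μ`, on `C¹` functions with compact support. -/
def Poincare (μ : Measure ℝ) : Prop :=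
  ∃ C : ℝ, 0 < C ∧ ∀ f : ℝ → ℝ, ContDiff ℝ 1 f → HasCompactSupport f →
    ∫ x, (f x - ∫ y, f y ∂μ) ^ 2 ∂μ ≤ C * ∫ x, (deriv f x) ^ 2 ∂μ

/-- The standing assumptions on the potential `V` and on its equilibrium measure `μ`. The filter
`cocompact ℝ` expresses `|x| → ∞`. -/
structure PotentialAssumptions (V : ℝ → ℝ) (μ : Measure ℝ) : Prop where
  smooth : ContDiff ℝ 3 V
  tendsto : Tendsto V (cocompact ℝ) atTop
  tendsto_deriv : Tendsto (fun x => |deriv V x|) (cocompact ℝ) atTop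
  poincare : Poincare μ
  decay : ∀ (Q : ℝ[X]) (α : ℝ), 0 < α →
    (fun x => Q.eval (deriv V x) * exp (-V x)) =o[cocompact ℝ] (fun x => |x| ^ (-α))
  local_growth : ∀ (s : ℕ → ℝ), Tendsto (fun N => |s N|) atTop atTop → ∀ a b : ℝ, a < b →
    Tendsto (fun N => 1 / (deriv V (s N)) ^ 2 *
      sSup ((fun x => |iteratedDeriv 2 V (s N + x)|) '' Icc a b)) atTop (𝓝 0)
  integrable_at_infinity :
    IntegrableAtFilter (fun x => ((deriv V x) ^ 2)⁻¹) (cocompact ℝ) volume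
  second_deriv : (fun x => iteratedDeriv 2 V x / deriv V x) =O[cocompact ℝ] (fun _ => (1 : ℝ))
  third_deriv : (fun x => iteratedDeriv 3 V x / deriv V x) =O[cocompact ℝ] (fun _ => (1 : ℝ))

/-- The truncated integral `∫_{|t - x| > ε} φ(t) / (t - x) dt`. -/
def truncatedHilbert (φ : ℝ → ℝ) (x ε : ℝ) : ℝ :=
  ∫ t in {t : ℝ | ε < |t - x|}, φ t / (t - x)

/-- The Hilbert transform (no factor `1/π`): the principal value of `∫ φ(t) / (t - x) dt`. -/
def hilbertTransform (φ : ℝ → ℝ) (x : ℝ) : ℝ :=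
  limUnder (𝓝[>] (0 : ℝ)) (truncatedHilbert φ x)

/-- The master operator
`Ξ[φ](x) = 2P ∫ (φ(x) - φ(y)) / (x - y) dμ(y) + φ'(x) - V'(x) φ(x) - 2P ∫ H[φ ρ] dμ`,
where `ρ` is the density of `μ` and `H` the Hilbert transform. -/
def masterOperator (V : ℝ → ℝ) (P : ℝ) (μ : Measure ℝ) (φ : ℝ → ℝ) (x : ℝ) : ℝ :=
  2 * P * (∫ y, (φ x - φ y) / (x - y) ∂μ) + deriv φ x - deriv V x * φ x
    - 2 * P * ∫ y, hilbertTransform (fun t => φ t * density μ t) y ∂μ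

/-- All integrals and principal values in the definition of `Ξ[φ]` converge. -/
structure MasterOperatorConverges (μ : Measure ℝ) (φ : ℝ → ℝ) : Prop where
  quotient : ∀ x : ℝ, Integrable (fun y => (φ x - φ y) / (x - y)) μ
  truncated : ∀ x ε : ℝ, 0 < ε →
    IntegrableOn (fun t => φ t * density μ t / (t - x)) {t : ℝ | ε < |t - x|} volume
  principal_value : ∀ x : ℝ, ∃ l : ℝ,
    Tendsto (truncatedHilbert (fun t => φ t * density μ t) x) (𝓝[>] (0 : ℝ)) (𝓝 l)
  mean : Integrable (hilbertTransform (fun t => φ t * density μ t)) μ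

/-- The operator `L[u] = Ξ[u']`. -/
def operatorL (V : ℝ → ℝ) (P : ℝ) (μ : Measure ℝ) (u : ℝ → ℝ) : ℝ → ℝ :=
  masterOperator V P μ (deriv u)

/-- The class `T` of test functions: `C²`, bounded with bounded first and second derivatives, and
of mean zero with respect to `μ`. -/
structure MemT (μ : Measure ℝ) (f : ℝ → ℝ) : Prop where
  smooth : ContDiff ℝ 2 f
  bounded : BoundedFun f
  bounded_deriv : BoundedFun (deriv f)
  bounded_deriv2 : BoundedFun (iteratedDeriv 2 f)
  mean_zero : ∫ x, f x ∂μ = 0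

/-- Membership of a `C¹` function in the Hilbert space `{u ∈ L²(μ) : u' ∈ L²(μ), ∫ u dμ = 0}`. -/
structure MemH (μ : Measure ℝ) (u : ℝ → ℝ) : Prop where
  memLp : MemLp u 2 μ
  memLp_deriv : MemLp (deriv u) 2 μ
  mean_zero : ∫ x, u x ∂μ = 0

/-- Membership of `φ` in `C²(ℝ) ∩ H²(ℝ)`. For a `C²` function the weak derivatives of order at most
two are the classical ones. -/
structure MemC2H2 (φ : ℝ → ℝ) : Prop where
  smooth : ContDiff ℝ 2 φ
  memLp : ∀ i : ℕ, i ≤ 2 → MemLp (iteratedDeriv i φ) 2 volume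

/-- `u` is a regular solution of `L[u] = f`: it is `C³`, `u' ∈ H²(ℝ)`, `u'''` is bounded, `u` is
in the Hilbert space of mean-zero functions, and `f = L[u]` at every point. -/
structure IsRegularSolution (V : ℝ → ℝ) (P : ℝ) (μ : Measure ℝ) (f u : ℝ → ℝ) : Prop where
  smooth : ContDiff ℝ 3 u
  deriv_sobolev : MemC2H2 (deriv u)
  bounded_deriv3 : BoundedFun (iteratedDeriv 3 u)
  memH : MemH μ u
  equation : ∀ x : ℝ, f x = operatorL V P μ u x

/-- The conditions on `φ` under which the central limit theorem for the linear statistic of `Ξ[φ]`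
is established. -/
structure CLTAdmissible (V : ℝ → ℝ) (φ : ℝ → ℝ) : Prop where
  sobolev : MemC2H2 φ
  bounded_deriv2 : BoundedFun (iteratedDeriv 2 φ)
  bounded_V3 : BoundedFun (fun x => iteratedDeriv 3 V x * φ x ^ 2)
  bounded_V2' : BoundedFun (fun x => iteratedDeriv 2 V x * φ x * deriv φ x)
  bounded_V2 : BoundedFun (fun x => iteratedDeriv 2 V x * φ x ^ 2)
  bounded_V1 : BoundedFun (fun x => deriv V x * φ x)

end HighTempBeta

end

open HighTempBeta

noncomputable section

namespace HighTempBeta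

/-! ### Bounds on the logarithm -/

lemma abs_log_le_sqrt (s : ℝ) : |log s| ≤ 2 * (√|s| + (√|s|)⁻¹) := by
  rcases eq_or_ne s 0 with rfl | hs
  · simp
  have h0 : 0 < √|s| := Real.sqrt_pos.2 (abs_pos.2 hs)
  have h1 : log s = 2 * log √|s| := by rw [Real.log_sqrt (abs_nonneg _), Real.log_abs]; ring
  have h2 := Real.log_le_sub_one_of_pos h0
  have h3 := Real.log_le_sub_one_of_pos (inv_pos.2 h0)
  rw [Real.log_inv] at h3
  have h4 := inv_pos.2 h0
  rw [h1, abs_le]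
  constructor <;> linarith

lemma log_sq_le_sqrt (s : ℝ) : (log s) ^ 2 ≤ 16 * (√|s| + (√|s|)⁻¹) := by
  rcases eq_or_ne s 0 with rfl | hs
  · simp
  have h0 : 0 < √|s| := Real.sqrt_pos.2 (abs_pos.2 hs)
  have hr : 0 < √(√|s|) := Real.sqrt_pos.2 h0
  have h1 : log s = 4 * log √(√|s|) := by
    rw [Real.log_sqrt h0.le, Real.log_sqrt (abs_nonneg _), Real.log_abs]; ring
  have h2 := Real.log_le_sub_one_of_pos hr
  have h3 := Real.log_le_sub_one_of_pos (inv_pos.2 hr)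
  rw [Real.log_inv] at h3
  have h5 : √|s| = √(√|s|) ^ 2 := (Real.sq_sqrt h0.le).symm
  have h4 := inv_pos.2 hr
  rw [h1]
  have h6 : (√|s|)⁻¹ = ((√(√|s|))⁻¹) ^ 2 := by rw [inv_pow, ← h5]
  rw [h6]
  nth_rewrite 2 [h5]
  rcases le_total 0 (log √(√|s|)) with h | h
  · nlinarith [sq_nonneg (√(√|s|))⁻¹, mul_self_le_mul_self h (show log √(√|s|) ≤ √(√|s|) by linarith)]
  · nlinarith [sq_nonneg (√(√|s|)), mul_self_le_mul_self (neg_nonneg.2 h)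
      (show -log √(√|s|) ≤ (√(√|s|))⁻¹ by linarith)]

lemma sqrt_add_le_add_sqrt {x y : ℝ} (hx : 0 ≤ x) (hy : 0 ≤ y) : √(x + y) ≤ √x + √y :=
  Real.sqrt_le_iff.2 ⟨by positivity, by
    nlinarith [Real.sq_sqrt hx, Real.sq_sqrt hy, mul_nonneg (Real.sqrt_nonneg x) (Real.sqrt_nonneg y)]⟩

lemma abs_log_sub_log_le {s t : ℝ} (hs : s ≠ 0) (ht : t ≠ 0) :
    |log s - log t| ≤ 2 * √|s - t| * ((√|s|)⁻¹ + (√|t|)⁻¹) := by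
  have key : ∀ {s t : ℝ}, s ≠ 0 → t ≠ 0 → log s - log t ≤ 2 * √|s - t| * (√|t|)⁻¹ := by
    intro s t hs ht
    have h0 : 0 < √|s| := Real.sqrt_pos.2 (abs_pos.2 hs)
    have h1 : 0 < √|t| := Real.sqrt_pos.2 (abs_pos.2 ht)
    have e1 : log s = 2 * log √|s| := by rw [Real.log_sqrt (abs_nonneg _), Real.log_abs]; ring
    have e2 : log t = 2 * log √|t| := by rw [Real.log_sqrt (abs_nonneg _), Real.log_abs]; ring
    have h2 := Real.log_le_sub_one_of_pos (div_pos h0 h1)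
    rw [Real.log_div h0.ne' h1.ne'] at h2
    have h3 : √|s| ≤ √|s - t| + √|t| := by
      refine (Real.sqrt_le_sqrt ?_).trans (sqrt_add_le_add_sqrt (abs_nonneg _) (abs_nonneg _))
      simpa using abs_add_le (s - t) t
    have h4 : √|s| / √|t| - 1 ≤ √|s - t| * (√|t|)⁻¹ := by
      rw [div_eq_mul_inv]
      have : √|t| * (√|t|)⁻¹ = 1 := mul_inv_cancel₀ h1.ne'
      nlinarith [inv_pos.2 h1]
    rw [e1, e2]; linarith
  have a := key hs ht
  have b := key ht hs
  rw [abs_sub_comm t s] at b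
  have p1 : 0 ≤ 2 * √|s - t| * (√|s|)⁻¹ := by positivity
  have p2 : 0 ≤ 2 * √|s - t| * (√|t|)⁻¹ := by positivity
  rw [abs_le]
  constructor <;> nlinarith

/-! ### Functions with quadratic decay -/

/-- Measurable functions dominated by a multiple of `1 / (1 + x²)`. -/
structure QuadDecay (h : ℝ → ℝ) : Prop where
  aesm : AEStronglyMeasurable h volume
  bound : ∃ C : ℝ, ∀ x, |h x| ≤ C * (1 + x ^ 2)⁻¹

lemma QuadDecay.exists_bound {h : ℝ → ℝ} (hh : QuadDecay h) :
    ∃ C : ℝ, 0 ≤ C ∧ ∀ x, |h x| ≤ C * (1 + x ^ 2)⁻¹ := by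
  obtain ⟨C, hC⟩ := hh.bound
  exact ⟨C, by simpa using (abs_nonneg _).trans (hC 0), hC⟩

lemma inv_one_add_sq_le_one (x : ℝ) : (1 + x ^ 2)⁻¹ ≤ 1 :=
  inv_le_one_of_one_le₀ (by nlinarith [sq_nonneg x])

lemma inv_one_add_sq_pos (x : ℝ) : 0 < (1 + x ^ 2)⁻¹ := by positivity

lemma QuadDecay.exists_bound_const {h : ℝ → ℝ} (hh : QuadDecay h) :
    ∃ C : ℝ, 0 ≤ C ∧ ∀ x, |h x| ≤ C := by
  obtain ⟨C, hC0, hC⟩ := hh.exists_bound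
  exact ⟨C, hC0, fun x => (hC x).trans (mul_le_of_le_one_right hC0 (inv_one_add_sq_le_one x))⟩

lemma QuadDecay.integrable {h : ℝ → ℝ} (hh : QuadDecay h) : Integrable h := by
  obtain ⟨C, hC⟩ := hh.bound
  exact (integrable_inv_one_add_sq.const_mul C).mono' hh.aesm (.of_forall hC)

lemma QuadDecay.const_mul {h : ℝ → ℝ} (hh : QuadDecay h) (c : ℝ) :
    QuadDecay (fun x => c * h x) := by
  obtain ⟨C, hC⟩ := hh.bound
  refine ⟨hh.aesm.const_mul c, |c| * C, fun x => ?_⟩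
  rw [abs_mul, mul_assoc]
  exact mul_le_mul_of_nonneg_left (hC x) (abs_nonneg _)

lemma integrable_sqrt_div_one_add_sq :
    Integrable (fun x : ℝ => √(1 + |x|) * (1 + x ^ 2)⁻¹) := by
  have h := (integrable_one_add_norm (E := ℝ) (μ := volume) (r := 3 / 2)
    (by simp; norm_num)).const_mul 2
  refine h.mono' ?_ (.of_forall fun x => ?_)
  · exact (by fun_prop : Measurable _).aestronglyMeasurable
  · have h1 : 0 < 1 + |x| := by positivity
    have e : (1 + |x|) ^ (-(3 / 2) : ℝ) = √(1 + |x|) * ((1 + |x|) ^ 2)⁻¹ := by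
      rw [Real.sqrt_eq_rpow, ← Real.rpow_natCast, ← Real.rpow_neg h1.le, ← Real.rpow_add h1]
      norm_num
    rw [Real.norm_of_nonneg (by positivity), Real.norm_eq_abs, e]
    have : (1 + x ^ 2)⁻¹ ≤ 2 * ((1 + |x|) ^ 2)⁻¹ := by
      rw [← div_eq_mul_inv, inv_eq_one_div, div_le_div_iff₀ (by positivity) (by positivity)]
      nlinarith [sq_abs x, sq_nonneg (1 - |x|)]
    nlinarith [Real.sqrt_nonneg (1 + |x|), mul_le_mul_of_nonneg_left this (Real.sqrt_nonneg (1 + |x|))]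

lemma integrable_indicator_inv_sqrt :
    Integrable ((Icc (-1 : ℝ) 1).indicator fun s => (√|s|)⁻¹) := by
  have h1 : IntegrableOn (fun s : ℝ => s ^ (-(1 / 2) : ℝ)) (Ioc 0 1) := by
    have := intervalIntegral.intervalIntegrable_rpow' (a := 0) (b := 1) (r := -(1 / 2)) (by norm_num)
    rwa [intervalIntegrable_iff_integrableOn_Ioc_of_le zero_le_one] at this
  have h2 : IntegrableOn (fun s : ℝ => (√|s|)⁻¹) (Ioc 0 1) := by
    refine h1.congr_fun (fun s hs => ?_) measurableSet_Ioc
    simp only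
    rw [abs_of_pos hs.1, Real.rpow_neg hs.1.le, Real.sqrt_eq_rpow]
  have h3 : IntegrableOn (fun s : ℝ => (√|s|)⁻¹) (Icc 0 1) :=
    (integrableOn_Icc_iff_integrableOn_Ioc).2 h2
  have h4 : IntegrableOn (fun s : ℝ => (√|s|)⁻¹) (Icc (-1) 0) := by
    have := h3.comp_neg
    simpa using this
  have h5 : IntegrableOn (fun s : ℝ => (√|s|)⁻¹) (Icc (-1) 1) := by
    rw [← Icc_union_Icc_eq_Icc (b := (0 : ℝ)) (by norm_num) (by norm_num)]
    exact h4.union h3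
  exact h5.integrable_indicator measurableSet_Icc

lemma inv_sqrt_le_indicator (s : ℝ) :
    (√|s|)⁻¹ ≤ 1 + (Icc (-1 : ℝ) 1).indicator (fun s => (√|s|)⁻¹) s := by
  by_cases hs : s ∈ Icc (-1 : ℝ) 1
  · rw [indicator_of_mem hs]; linarith
  · rw [indicator_of_notMem hs, add_zero]
    refine inv_le_one_of_one_le₀ (Real.one_le_sqrt.2 ?_)
    by_contra! h
    exact hs (abs_le.1 h.le)

/-- The function `t ↦ (√|x - t|)⁻¹ |h t|` has an integral bounded uniformly in `x`. -/
lemma QuadDecay.integral_inv_sqrt {h : ℝ → ℝ} (hh : QuadDecay h) :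
    ∃ C : ℝ, 0 ≤ C ∧ ∀ x, Integrable (fun t => (√|x - t|)⁻¹ * |h t|) ∧
      ∫ t, (√|x - t|)⁻¹ * |h t| ≤ C := by
  obtain ⟨C, hC0, hC⟩ := hh.exists_bound
  set k := (Icc (-1 : ℝ) 1).indicator fun s => (√|s|)⁻¹ with hk
  have hk0 : ∀ s, 0 ≤ k s := fun s => indicator_nonneg (fun _ _ => by positivity) s
  have hki : Integrable k := integrable_indicator_inv_sqrt
  have hdom : ∀ x, Integrable (fun t => C * (1 + t ^ 2)⁻¹ + C * k (x - t)) := fun x =>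
    (integrable_inv_one_add_sq.const_mul C).add ((hki.comp_sub_left x).const_mul C)
  have hle : ∀ x t, (√|x - t|)⁻¹ * |h t| ≤ C * (1 + t ^ 2)⁻¹ + C * k (x - t) := by
    intro x t
    have h1 := inv_sqrt_le_indicator (x - t)
    have h2 := hC t
    have h3 := inv_one_add_sq_le_one t
    have h4 := inv_one_add_sq_pos t
    calc (√|x - t|)⁻¹ * |h t| ≤ (1 + k (x - t)) * (C * (1 + t ^ 2)⁻¹) :=
          mul_le_mul h1 h2 (abs_nonneg _) (by linarith [hk0 (x - t)])
      _ ≤ _ := by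
          have : k (x - t) * C * (1 + t ^ 2)⁻¹ ≤ k (x - t) * C :=
            mul_le_of_le_one_right (mul_nonneg (hk0 _) hC0) h3
          nlinarith
  have hint : ∀ x, Integrable (fun t => (√|x - t|)⁻¹ * |h t|) := by
    intro x
    refine (hdom x).mono' ?_ (.of_forall fun t => ?_)
    · exact ((by fun_prop : Measurable fun t : ℝ => (√|x - t|)⁻¹).aestronglyMeasurable).mul
        hh.aesm.norm
    · rw [Real.norm_of_nonneg (by positivity)]; exact hle x t
  have i1 : 0 ≤ ∫ t : ℝ, (1 + t ^ 2)⁻¹ := integral_nonneg fun t => (inv_one_add_sq_pos t).le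
  have i2 : 0 ≤ ∫ t, k t := integral_nonneg fun t => hk0 t
  refine ⟨C * (∫ t : ℝ, (1 + t ^ 2)⁻¹) + C * ∫ t, k t, by positivity, fun x => ⟨hint x, ?_⟩⟩
  refine (integral_mono (hint x) (hdom x) (hle x)).trans (le_of_eq ?_)
  rw [integral_add (integrable_inv_one_add_sq.const_mul C) ((hki.comp_sub_left x).const_mul C),
    integral_const_mul, integral_const_mul, integral_sub_left_eq_self k volume x]

/-- The function `t ↦ √|x - t| |h t|` has an integral of order at most `√(1 + |x|)`. -/
lemma QuadDecay.integral_sqrt {h : ℝ → ℝ} (hh : QuadDecay h) :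
    ∃ C : ℝ, 0 ≤ C ∧ ∀ x, Integrable (fun t => √|x - t| * |h t|) ∧
      ∫ t, √|x - t| * |h t| ≤ C * √(1 + |x|) := by
  obtain ⟨C, hC0, hC⟩ := hh.exists_bound
  have hle : ∀ x t, √|x - t| * |h t| ≤ √(1 + |x|) * C * (√(1 + |t|) * (1 + t ^ 2)⁻¹) := by
    intro x t
    have h1 : √|x - t| ≤ √(1 + |x|) * √(1 + |t|) := by
      rw [← Real.sqrt_mul (by positivity)]
      refine Real.sqrt_le_sqrt ?_
      nlinarith [abs_sub x t, abs_nonneg x, abs_nonneg t, mul_nonneg (abs_nonneg x) (abs_nonneg t)]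
    calc √|x - t| * |h t| ≤ (√(1 + |x|) * √(1 + |t|)) * (C * (1 + t ^ 2)⁻¹) :=
          mul_le_mul h1 (hC t) (abs_nonneg _) (by positivity)
      _ = _ := by ring
  have hdom := fun x : ℝ => integrable_sqrt_div_one_add_sq.const_mul (√(1 + |x|) * C)
  have hint : ∀ x, Integrable (fun t => √|x - t| * |h t|) := by
    intro x
    refine (hdom x).mono' ?_ (.of_forall fun t => ?_)
    · exact ((by fun_prop : Measurable fun t : ℝ => √|x - t|).aestronglyMeasurable).mul hh.aesm.norm
    · rw [Real.norm_of_nonneg (by positivity)]; exact hle x t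
  have i1 : 0 ≤ ∫ t : ℝ, √(1 + |t|) * (1 + t ^ 2)⁻¹ := integral_nonneg fun t => by positivity
  refine ⟨C * ∫ t : ℝ, √(1 + |t|) * (1 + t ^ 2)⁻¹, by positivity, fun x => ⟨hint x, ?_⟩⟩
  refine (integral_mono (hint x) (hdom x) (hle x)).trans (le_of_eq ?_)
  rw [integral_const_mul]; ring

/-! ### The logarithmic potential -/

/-- The logarithmic potential `∫ log |x - y| h(y) dy`. -/
def logPot (h : ℝ → ℝ) (x : ℝ) : ℝ := ∫ y, log (x - y) * h y

lemma QuadDecay.integral_abs_log {h : ℝ → ℝ} (hh : QuadDecay h) :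
    ∃ C : ℝ, 0 ≤ C ∧ ∀ x, Integrable (fun t => |log (x - t)| * |h t|) ∧
      ∫ t, |log (x - t)| * |h t| ≤ C * √(1 + |x|) := by
  obtain ⟨A, hA0, hA⟩ := hh.integral_sqrt
  obtain ⟨B, hB0, hB⟩ := hh.integral_inv_sqrt
  have hle : ∀ x t, |log (x - t)| * |h t| ≤ 2 * (√|x - t| * |h t| + (√|x - t|)⁻¹ * |h t|) := by
    intro x t
    have := mul_le_mul_of_nonneg_right (abs_log_le_sqrt (x - t)) (abs_nonneg (h t))
    linarith
  have hdom := fun x => ((hA x).1.add (hB x).1).const_mul 2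
  have hint : ∀ x, Integrable (fun t => |log (x - t)| * |h t|) := by
    intro x
    refine (hdom x).mono' ?_ (.of_forall fun t => ?_)
    · exact ((by fun_prop : Measurable fun t : ℝ => |log (x - t)|).aestronglyMeasurable).mul
        hh.aesm.norm
    · rw [Real.norm_of_nonneg (by positivity)]; exact hle x t
  refine ⟨2 * (A + B), by positivity, fun x => ⟨hint x, ?_⟩⟩
  refine (integral_mono (hint x) (hdom x) (hle x)).trans ?_
  simp only [Pi.add_apply]
  rw [integral_const_mul, integral_add (hA x).1 (hB x).1]
  have h1 : 1 ≤ √(1 + |x|) := Real.one_le_sqrt.2 (by linarith [abs_nonneg x])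
  nlinarith [(hA x).2, (hB x).2, mul_le_mul_of_nonneg_left h1 hB0]

lemma QuadDecay.integrable_log_mul {h : ℝ → ℝ} (hh : QuadDecay h) (x : ℝ) :
    Integrable (fun t => log (x - t) * h t) := by
  obtain ⟨C, -, hC⟩ := hh.integral_abs_log
  refine (hC x).1.mono' ?_ (.of_forall fun t => ?_)
  · exact ((by fun_prop : Measurable fun t : ℝ => log (x - t)).aestronglyMeasurable).mul hh.aesm
  · rw [Real.norm_eq_abs, abs_mul]

/-- Functions that are Hölder continuous of exponent `1/2` on the whole line. -/
def HolderHalf (h : ℝ → ℝ) : Prop := ∃ C : ℝ, ∀ x y, |h x - h y| ≤ C * √|x - y|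

lemma QuadDecay.holderHalf_logPot {h : ℝ → ℝ} (hh : QuadDecay h) : HolderHalf (logPot h) := by
  obtain ⟨B, hB0, hB⟩ := hh.integral_inv_sqrt
  refine ⟨4 * B, fun x y => ?_⟩
  have hdom : Integrable (fun t => 2 * √|x - y| * ((√|x - t|)⁻¹ * |h t| + (√|y - t|)⁻¹ * |h t|)) :=
    ((hB x).1.add (hB y).1).const_mul _
  rw [logPot, logPot, ← integral_sub (hh.integrable_log_mul x) (hh.integrable_log_mul y),
    ← Real.norm_eq_abs]
  refine (norm_integral_le_of_norm_le hdom ?_).trans ?_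
  · filter_upwards [compl_mem_ae_iff.2 (measure_singleton x), compl_mem_ae_iff.2 (measure_singleton y)]
      with t hx hy
    have h1 := abs_log_sub_log_le (s := x - t) (t := y - t) (sub_ne_zero.2 (Ne.symm hx))
      (sub_ne_zero.2 (Ne.symm hy))
    rw [← sub_mul, Real.norm_eq_abs, abs_mul]
    refine (mul_le_mul_of_nonneg_right h1 (abs_nonneg _)).trans (le_of_eq ?_)
    rw [sub_sub_sub_cancel_right]; ring
  · rw [integral_const_mul, integral_add (hB x).1 (hB y).1]
    nlinarith [(hB x).2, (hB y).2, Real.sqrt_nonneg |x - y|]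

lemma HolderHalf.continuous {h : ℝ → ℝ} (hh : HolderHalf h) : Continuous h := by
  obtain ⟨C, hC⟩ := hh
  rw [continuous_iff_continuousAt]
  intro x
  rw [ContinuousAt, tendsto_iff_norm_sub_tendsto_zero]
  refine squeeze_zero (fun _ => norm_nonneg _) (fun y => hC y x) ?_
  have : Tendsto (fun y => C * √|y - x|) (𝓝 x) (𝓝 (C * √|x - x|)) :=
    (by fun_prop : Continuous fun y => C * √|y - x|).tendsto x
  simpa using this

lemma QuadDecay.continuous_logPot {h : ℝ → ℝ} (hh : QuadDecay h) : Continuous (logPot h) :=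
  hh.holderHalf_logPot.continuous

lemma logPot_eq_integral_shift (h : ℝ → ℝ) (x : ℝ) : logPot h x = ∫ s, log s * h (x - s) := by
  rw [logPot, ← integral_sub_left_eq_self (fun y => log (x - y) * h y) volume x]
  simp

lemma QuadDecay.logPot_sub {h h' : ℝ → ℝ} (hh : QuadDecay h) (hh' : QuadDecay h')
    (hd : ∀ x, HasDerivAt h (h' x) x) (hc : Continuous h') (a b : ℝ) :
    logPot h b - logPot h a = ∫ x in a..b, logPot h' x := by
  have hs : ∀ {k : ℝ → ℝ}, QuadDecay k → ∀ x, Integrable fun s => log s * k (x - s) := by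
    intro k hk x
    have := (hk.integrable_log_mul x).comp_sub_left x
    simpa using this
  rw [logPot_eq_integral_shift, logPot_eq_integral_shift, ← integral_sub (hs hh b) (hs hh a)]
  have e1 : ∀ s, log s * h (b - s) - log s * h (a - s) = ∫ z in a..b, log s * h' (z - s) := by
    intro s
    rw [intervalIntegral.integral_const_mul, ← mul_sub]
    congr 1
    exact (intervalIntegral.integral_eq_sub_of_hasDerivAt (f := fun z => h (z - s))
      (f' := fun z => h' (z - s)) (fun z _ => (hd (z - s)).comp_sub_const z s)
      ((hc.comp (continuous_sub_right s)).intervalIntegrable _ _)).symm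
  simp_rw [e1]
  rw [← MeasureTheory.intervalIntegral_integral_swap]
  · simp_rw [logPot_eq_integral_shift]
  · obtain ⟨C, hC0, hC⟩ := hh'.integral_abs_log
    have hm : Measurable (Function.uncurry fun z s : ℝ => log s * h' (z - s)) := by
      have := hc.measurable
      unfold Function.uncurry; fun_prop
    rw [integrable_prod_iff hm.aestronglyMeasurable]
    refine ⟨.of_forall fun z => hs hh' z, ?_⟩
    have e2 : ∀ z, ∫ s, ‖Function.uncurry (fun z s : ℝ => log s * h' (z - s)) (z, s)‖
        = ∫ t, |log (z - t)| * |h' t| := by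
      intro z
      rw [← integral_sub_left_eq_self (fun y => |log (z - y)| * |h' y|) volume z]
      simp [Function.uncurry]
    have hdom : IntegrableOn (fun z : ℝ => C * √(1 + |z|)) (uIoc a b) :=
      ((by fun_prop : Continuous fun z : ℝ => C * √(1 + |z|)).integrableOn_uIcc).mono_set
        uIoc_subset_uIcc
    refine hdom.mono' hm.norm.stronglyMeasurable.integral_prod_right.aestronglyMeasurable
      (.of_forall fun z => ?_)
    rw [e2 z, Real.norm_of_nonneg (integral_nonneg fun _ => by positivity)]
    exact (hC z).2

lemma QuadDecay.hasDerivAt_logPot {h h' : ℝ → ℝ} (hh : QuadDecay h) (hh' : QuadDecay h')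
    (hd : ∀ x, HasDerivAt h (h' x) x) (hc : Continuous h') (x : ℝ) :
    HasDerivAt (logPot h) (logPot h' x) x := by
  have e : logPot h = fun b => logPot h 0 + ∫ x in (0 : ℝ)..b, logPot h' x := by
    ext b; rw [← hh.logPot_sub hh' hd hc]; ring
  rw [e]
  exact ((hh'.continuous_logPot.integral_hasStrictDerivAt 0 x).hasDerivAt).const_add _

/-! ### The Hilbert transform of Hölder functions with quadratic decay -/

/-- The symmetrized form `∫_{t > 0} (h(x + t) - h(x - t)) / t dt` of the Hilbert transform. -/
def pvHilbert (h : ℝ → ℝ) (x : ℝ) : ℝ := ∫ t in Ioi (0 : ℝ), (h (x + t) - h (x - t)) / t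

/-- The integrable weight that dominates symmetric difference quotients. -/
def quotWeight (t : ℝ) : ℝ := (Icc (-1 : ℝ) 1).indicator (fun s => (√|s|)⁻¹) t + (1 + t ^ 2)⁻¹

lemma integrable_quotWeight : Integrable quotWeight :=
  integrable_indicator_inv_sqrt.add integrable_inv_one_add_sq

lemma quotWeight_nonneg (t : ℝ) : 0 ≤ quotWeight t :=
  add_nonneg (indicator_nonneg (fun _ _ => by positivity) t) (by positivity)

lemma inv_one_add_sq_shift_le (x t : ℝ) :
    (1 + (x + t) ^ 2)⁻¹ ≤ 2 * (1 + x ^ 2) * (1 + t ^ 2)⁻¹ := by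
  rw [← div_eq_mul_inv, inv_eq_one_div, div_le_div_iff₀ (by positivity) (by positivity)]
  nlinarith [sq_nonneg (2 * x + t), mul_nonneg (sq_nonneg x) (sq_nonneg (x + t))]

lemma QuadDecay.abs_sub_symm_le {h : ℝ → ℝ} (hh : QuadDecay h) :
    ∃ C : ℝ, 0 ≤ C ∧ ∀ x t, |h (x + t) - h (x - t)| ≤ C * (1 + x ^ 2) * (1 + t ^ 2)⁻¹ := by
  obtain ⟨C, hC0, hC⟩ := hh.exists_bound
  refine ⟨4 * C, by positivity, fun x t => (abs_sub _ _).trans ?_⟩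
  have h1 := inv_one_add_sq_shift_le x t
  have h2 := inv_one_add_sq_shift_le x (-t)
  rw [neg_sq, ← sub_eq_add_neg] at h2
  nlinarith [hC (x + t), hC (x - t), mul_le_mul_of_nonneg_left h1 hC0,
    mul_le_mul_of_nonneg_left h2 hC0]

lemma HolderHalf.quot_le {h : ℝ → ℝ} (hH : HolderHalf h) :
    ∃ C : ℝ, 0 ≤ C ∧ ∀ x t, 0 < t → |(h (x + t) - h (x - t)) / t| ≤ C * (√|t|)⁻¹ := by
  obtain ⟨C, hC⟩ := hH
  have hC0 : 0 ≤ C := by simpa using (abs_nonneg _).trans (hC 1 0)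
  refine ⟨2 * C, by positivity, fun x t ht => ?_⟩
  have h1 := hC (x + t) (x - t)
  have e : x + t - (x - t) = 2 * t := by ring
  rw [e, abs_of_pos (by positivity : 0 < 2 * t)] at h1
  have h2 : √(2 * t) ≤ 2 * √t := by
    rw [Real.sqrt_mul (by norm_num)]
    exact mul_le_mul_of_nonneg_right (Real.sqrt_le_iff.2 (by norm_num)) (Real.sqrt_nonneg _)
  have h3 : 0 < √t := Real.sqrt_pos.2 ht
  rw [abs_div, abs_of_pos ht, div_le_iff₀ ht]
  have h4 : 2 * C * (√t)⁻¹ * t = C * (2 * √t) := by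
    nth_rewrite 2 [← Real.sq_sqrt ht.le]
    field_simp
  rw [h4]
  exact h1.trans (mul_le_mul_of_nonneg_left h2 hC0)

lemma QuadDecay.quot_le {h : ℝ → ℝ} (hh : QuadDecay h) (hH : HolderHalf h) :
    ∃ C : ℝ, 0 ≤ C ∧ ∀ x t, 0 < t →
      |(h (x + t) - h (x - t)) / t| ≤ C * (1 + x ^ 2) * quotWeight t := by
  obtain ⟨A, hA0, hA⟩ := hh.abs_sub_symm_le
  obtain ⟨B, hB0, hB⟩ := hH.quot_le
  refine ⟨A + B, by positivity, fun x t ht => ?_⟩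
  have hx : 1 ≤ 1 + x ^ 2 := by nlinarith [sq_nonneg x]
  rcases le_or_gt t 1 with h1 | h1
  · refine (hB x t ht).trans ?_
    have e : (√|t|)⁻¹ ≤ quotWeight t := by
      rw [quotWeight, indicator_of_mem (show t ∈ Icc (-1 : ℝ) 1 from ⟨by linarith, h1⟩)]
      linarith [inv_one_add_sq_pos t]
    refine mul_le_mul (by nlinarith) e (by positivity) (by positivity)
  · have e : (1 + t ^ 2)⁻¹ ≤ quotWeight t := by
      rw [quotWeight]
      linarith [indicator_nonneg (s := Icc (-1 : ℝ) 1) (f := fun s => (√|s|)⁻¹)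
        (fun _ _ => by positivity) t]
    rw [abs_div, abs_of_pos ht]
    refine (div_le_self (abs_nonneg _) h1.le).trans ((hA x t).trans ?_)
    refine mul_le_mul (by nlinarith) e (by positivity) (by positivity)

lemma measurable_quot {h : ℝ → ℝ} (hc : Continuous h) (x : ℝ) :
    Measurable fun t => (h (x + t) - h (x - t)) / t := by
  have := hc.measurable
  fun_prop

lemma QuadDecay.integrableOn_quot {h : ℝ → ℝ} (hh : QuadDecay h) (hH : HolderHalf h) (x : ℝ) :
    IntegrableOn (fun t => (h (x + t) - h (x - t)) / t) (Ioi 0) := by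
  obtain ⟨C, hC0, hC⟩ := hh.quot_le hH
  refine ((integrable_quotWeight.const_mul (C * (1 + x ^ 2))).integrableOn).mono'
    (measurable_quot hH.continuous x).aestronglyMeasurable ?_
  filter_upwards [ae_restrict_mem measurableSet_Ioi] with t ht using hC x t ht

lemma QuadDecay.continuous_pvHilbert {h : ℝ → ℝ} (hh : QuadDecay h) (hH : HolderHalf h) :
    Continuous (pvHilbert h) := by
  obtain ⟨C, hC0, hC⟩ := hh.quot_le hH
  have hcont := hH.continuous
  rw [continuous_iff_continuousAt]
  intro x
  refine continuousAt_of_dominated (bound := fun t => C * (1 + (|x| + 1) ^ 2) * quotWeight t)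
    (.of_forall fun y => (measurable_quot hcont y).aestronglyMeasurable) ?_
    (integrable_quotWeight.const_mul _).integrableOn (.of_forall fun t => by fun_prop)
  filter_upwards [Metric.ball_mem_nhds x one_pos] with y hy
  filter_upwards [ae_restrict_mem measurableSet_Ioi] with t ht
  refine (hC y t ht).trans ?_
  refine mul_le_mul_of_nonneg_right (mul_le_mul_of_nonneg_left ?_ hC0) (quotWeight_nonneg t)
  have h1 : |y| ≤ |x| + 1 := by
    have := abs_sub_abs_le_abs_sub y x
    rw [Metric.mem_ball, Real.dist_eq] at hy
    linarith
  nlinarith [sq_abs y, abs_nonneg y]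

lemma QuadDecay.boundedFun_pvHilbert {h : ℝ → ℝ} (hh : QuadDecay h) (hH : HolderHalf h) :
    BoundedFun (pvHilbert h) := by
  obtain ⟨C, hC0, hC⟩ := hH.quot_le
  set k := (Icc (-1 : ℝ) 1).indicator fun s => (√|s|)⁻¹ with hk
  have hk0 : ∀ s, 0 ≤ k s := fun s => indicator_nonneg (fun _ _ => by positivity) s
  have hki : Integrable k := integrable_indicator_inv_sqrt
  have habs := hh.integrable.abs
  refine ⟨C * (∫ t, k t) + ((∫ t, |h t|) + ∫ t, |h t|), fun x => ?_⟩
  have hsum : Integrable fun t => |h (x + t)| + |h (x - t)| :=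
    (habs.comp_add_left x).add (habs.comp_sub_left x)
  have hdom : Integrable fun t => C * k t + (|h (x + t)| + |h (x - t)|) :=
    (hki.const_mul C).add hsum
  calc |pvHilbert h x| ≤ ∫ t in Ioi 0, (C * k t + (|h (x + t)| + |h (x - t)|)) := by
        rw [pvHilbert, ← Real.norm_eq_abs]
        refine norm_integral_le_of_norm_le hdom.integrableOn ?_
        filter_upwards [ae_restrict_mem measurableSet_Ioi] with t ht
        rw [Real.norm_eq_abs]
        rcases le_or_gt t 1 with h1 | h1
        · refine (hC x t ht).trans ?_
          rw [hk, indicator_of_mem (show t ∈ Icc (-1 : ℝ) 1 from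
            ⟨by linarith [mem_Ioi.1 ht], h1⟩)]
          linarith [abs_nonneg (h (x + t)), abs_nonneg (h (x - t))]
        · rw [abs_div, abs_of_pos (mem_Ioi.1 ht)]
          refine (div_le_self (abs_nonneg _) h1.le).trans ((abs_sub _ _).trans ?_)
          linarith [mul_nonneg hC0 (hk0 t)]
    _ ≤ ∫ t, (C * k t + (|h (x + t)| + |h (x - t)|)) :=
        setIntegral_le_integral hdom (.of_forall fun t => by
          have := hk0 t
          simp only [Pi.zero_apply]; positivity)
    _ = _ := by
        rw [integral_add (hki.const_mul C) hsum,
          integral_add (habs.comp_add_left x) (habs.comp_sub_left x), integral_const_mul,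
          integral_add_left_eq_self (fun t => |h t|) x,
          integral_sub_left_eq_self (fun t => |h t|) volume x]

lemma integral_eq_integral_Ioi_symm {F : ℝ → ℝ} (hF : Integrable F) :
    ∫ s, F s = ∫ t in Ioi (0 : ℝ), (F t + F (-t)) := by
  rw [integral_add hF.integrableOn hF.comp_neg.integrableOn, integral_comp_neg_Ioi, neg_zero,
    add_comm, ← intervalIntegral.integral_Iic_add_Ioi hF.integrableOn hF.integrableOn]

/-- The truncated Hilbert transform in symmetrized form. -/
lemma truncatedHilbert_eq {h : ℝ → ℝ} (hh : QuadDecay h) (x : ℝ) {ε : ℝ} (hε : 0 < ε) :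
    IntegrableOn (fun t => h t / (t - x)) {t : ℝ | ε < |t - x|} ∧
      truncatedHilbert h x ε = ∫ t in Ioi ε, (h (x + t) - h (x - t)) / t := by
  have hS : MeasurableSet {t : ℝ | ε < |t - x|} := measurableSet_lt (by fun_prop) (by fun_prop)
  have hI : IntegrableOn (fun t => h t / (t - x)) {t : ℝ | ε < |t - x|} := by
    refine ((hh.integrable.abs.const_mul ε⁻¹).integrableOn).mono' ?_ ?_
    · exact (hh.aesm.mul ((by fun_prop : Measurable fun t : ℝ =>
        (t - x)⁻¹).aestronglyMeasurable)).restrict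
    · filter_upwards [ae_restrict_mem hS] with t ht
      rw [norm_div, Real.norm_eq_abs, Real.norm_eq_abs, div_eq_inv_mul]
      exact mul_le_mul_of_nonneg_right (inv_anti₀ hε (le_of_lt ht)) (abs_nonneg _)
  refine ⟨hI, ?_⟩
  set F := {t : ℝ | ε < |t - x|}.indicator fun t => h t / (t - x) with hFdef
  have hF : Integrable F := hI.integrable_indicator hS
  have hF' : Integrable fun s => F (x + s) := hF.comp_add_left x
  rw [truncatedHilbert, ← integral_indicator hS, ← hFdef, ← integral_add_left_eq_self F x,
    integral_eq_integral_Ioi_symm hF', ← integral_indicator measurableSet_Ioi,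
    ← integral_indicator measurableSet_Ioi]
  congr 1
  ext t
  by_cases h1 : ε < t
  · have h0 : 0 < t := hε.trans h1
    rw [indicator_of_mem (show t ∈ Ioi 0 from h0), indicator_of_mem (show t ∈ Ioi ε from h1), hFdef,
      indicator_of_mem, indicator_of_mem]
    · rw [add_sub_cancel_left, add_sub_cancel_left, ← sub_eq_add_neg, div_neg, ← sub_eq_add_neg,
        sub_div]
    · simp [abs_of_pos h0, h1]
    · simp [abs_of_pos h0, h1]
  · rw [indicator_of_notMem (show t ∉ Ioi ε from h1)]
    by_cases h0 : 0 < t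
    · rw [indicator_of_mem (show t ∈ Ioi 0 from h0), hFdef, indicator_of_notMem, indicator_of_notMem,
        add_zero]
      · simpa [abs_of_pos h0] using h1
      · simpa [abs_of_pos h0] using h1
    · rw [indicator_of_notMem (show t ∉ Ioi 0 from h0)]

lemma tendsto_setIntegral_Ioi_zero {F : ℝ → ℝ} (hF : IntegrableOn F (Ioi 0)) :
    Tendsto (fun ε => ∫ t in Ioi ε, F t) (𝓝[>] 0) (𝓝 (∫ t in Ioi (0 : ℝ), F t)) := by
  rw [← integral_indicator measurableSet_Ioi]
  have h0 := hF.integrable_indicator measurableSet_Ioi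
  have : Tendsto (fun ε : ℝ => ∫ t, (Ioi ε).indicator ((Ioi 0).indicator F) t) (𝓝[>] 0)
      (𝓝 (∫ t, (Ioi (0 : ℝ)).indicator F t)) := by
    refine tendsto_integral_filter_of_dominated_convergence (fun t => ‖(Ioi 0).indicator F t‖)
      (.of_forall fun ε => h0.aestronglyMeasurable.indicator measurableSet_Ioi)
      (.of_forall fun ε => .of_forall fun t => norm_indicator_le_norm_self _ _) h0.norm
      (.of_forall fun t => ?_)
    by_cases ht : 0 < t
    · refine tendsto_const_nhds.congr' ?_
      filter_upwards [Ioo_mem_nhdsGT ht] with ε hε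
      exact (indicator_of_mem (show t ∈ Ioi ε from hε.2) _).symm
    · rw [indicator_of_notMem (show t ∉ Ioi 0 from ht)]
      refine tendsto_const_nhds.congr fun ε => ?_
      rw [indicator_apply, indicator_of_notMem (show t ∉ Ioi 0 from ht), ite_self]
  refine this.congr' ?_
  filter_upwards [self_mem_nhdsWithin] with ε hε
  rw [indicator_indicator, inter_eq_left.2 (Ioi_subset_Ioi (le_of_lt hε)),
    integral_indicator measurableSet_Ioi]

lemma QuadDecay.tendsto_truncatedHilbert {h : ℝ → ℝ} (hh : QuadDecay h) (hH : HolderHalf h)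
    (x : ℝ) : Tendsto (truncatedHilbert h x) (𝓝[>] 0) (𝓝 (pvHilbert h x)) := by
  refine (tendsto_setIntegral_Ioi_zero (hh.integrableOn_quot hH x)).congr' ?_
  filter_upwards [self_mem_nhdsWithin] with ε hε using (truncatedHilbert_eq hh x hε).2.symm

lemma QuadDecay.hilbertTransform_eq {h : ℝ → ℝ} (hh : QuadDecay h) (hH : HolderHalf h) :
    hilbertTransform h = pvHilbert h :=
  funext fun x => (hh.tendsto_truncatedHilbert hH x).limUnder_eq

lemma QuadDecay.logPot_sub_eq_pvHilbert {h : ℝ → ℝ} (hh : QuadDecay h) (hH : HolderHalf h)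
    (a b : ℝ) : logPot h b - logPot h a = -∫ x in a..b, pvHilbert h x := by
  have hc := hH.continuous
  have hii : ∀ u v, IntervalIntegrable h volume u v := fun u v => hc.intervalIntegrable u v
  set A : ℝ → ℝ := fun x => ∫ y in (0 : ℝ)..x, h y with hA
  have hAd : ∀ x, HasDerivAt A (h x) x := fun x => (hc.integral_hasStrictDerivAt 0 x).hasDerivAt
  set G : ℝ → ℝ := fun t => ∫ x in a..b, (h (x + t) - h (x - t)) with hG
  have hGA : ∀ t, G t = A (b + t) - A (a + t) - (A (b - t) - A (a - t)) := by
    intro t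
    simp only [hG, hA]
    rw [intervalIntegral.integral_sub
      ((by fun_prop : Continuous fun x => h (x + t)).intervalIntegrable _ _)
      ((by fun_prop : Continuous fun x => h (x - t)).intervalIntegrable _ _),
      intervalIntegral.integral_comp_add_right, intervalIntegral.integral_comp_sub_right,
      intervalIntegral.integral_interval_sub_left (hii _ _) (hii _ _),
      intervalIntegral.integral_interval_sub_left (hii _ _) (hii _ _)]
  set G' : ℝ → ℝ := fun t => (h (b + t) + h (b - t)) - (h (a + t) + h (a - t)) with hG'
  have hGd : ∀ t, HasDerivAt G (G' t) t := by
    intro t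
    have e : G = fun t => A (b + t) - A (a + t) - (A (b - t) - A (a - t)) := funext hGA
    rw [e]
    have := (((hAd (b + t)).comp_const_add b t).sub ((hAd (a + t)).comp_const_add a t)).sub
      (((hAd (b - t)).comp_const_sub b t).sub ((hAd (a - t)).comp_const_sub a t))
    exact this.congr_deriv (by simp only [hG']; ring)
  have hlog : ∀ x, logPot h x = ∫ t in Ioi (0 : ℝ), log t * (h (x + t) + h (x - t)) ∧
      IntegrableOn (fun t => log t * (h (x + t) + h (x - t))) (Ioi 0) := by
    intro x
    have h1 : Integrable fun s => log s * h (x - s) := by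
      simpa using (hh.integrable_log_mul x).comp_sub_left x
    have e : (fun t => log t * (h (x + t) + h (x - t)))
        = fun t => log t * h (x - t) + log (-t) * h (x - -t) := by
      ext t; rw [Real.log_neg_eq_log, sub_neg_eq_add]; ring
    rw [e, logPot_eq_integral_shift, integral_eq_integral_Ioi_symm h1]
    exact ⟨rfl, (h1.add h1.comp_neg).integrableOn⟩
  obtain ⟨C, hC0, hC⟩ := hh.quot_le hH
  set M := |a| + |b| with hM
  have hxM : ∀ x ∈ uIoc a b, x ^ 2 ≤ M ^ 2 := by
    intro x hx
    rw [sq_le_sq, abs_of_nonneg (show 0 ≤ M by positivity), abs_le]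
    rcases mem_uIoc.1 hx with h | h <;> constructor <;>
      linarith [neg_abs_le a, neg_abs_le b, le_abs_self a, le_abs_self b, abs_nonneg a, abs_nonneg b]
  have hprod : Integrable (Function.uncurry fun x t => (h (x + t) - h (x - t)) / t)
      ((volume.restrict (uIoc a b)).prod (volume.restrict (Ioi 0))) := by
    have hdom : Integrable (fun p : ℝ × ℝ => (C * (1 + M ^ 2)) * quotWeight p.2)
        ((volume.restrict (uIoc a b)).prod (volume.restrict (Ioi 0))) := by
      have : Integrable (fun _ : ℝ => C * (1 + M ^ 2)) (volume.restrict (uIoc a b)) := by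
        refine integrableOn_const ?_
        simp [uIoc]
      exact this.mul_prod integrable_quotWeight.integrableOn
    refine hdom.mono' ?_ ?_
    · have := hc.measurable
      exact (by unfold Function.uncurry; fun_prop : Measurable _).aestronglyMeasurable
    · rw [Measure.prod_restrict]
      filter_upwards [ae_restrict_mem (measurableSet_uIoc.prod measurableSet_Ioi)] with p hp
      refine (hC p.1 p.2 hp.2).trans ?_
      exact mul_le_mul_of_nonneg_right (mul_le_mul_of_nonneg_left
        (by linarith [hxM p.1 hp.1]) hC0) (quotWeight_nonneg _)
  have hswap : ∫ x in a..b, pvHilbert h x = ∫ t in Ioi (0 : ℝ), t⁻¹ * G t := by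
    simp only [pvHilbert]
    rw [MeasureTheory.intervalIntegral_integral_swap hprod]
    congr 1; ext t
    rw [intervalIntegral.integral_div, div_eq_inv_mul]
  have hGint : IntegrableOn (fun t => t⁻¹ * G t) (Ioi 0) := by
    have h1 : IntegrableOn (fun t => ∫ x in uIoc a b, (h (x + t) - h (x - t)) / t) (Ioi 0) :=
      hprod.integral_prod_right
    refine (h1.const_mul (if a ≤ b then 1 else -1)).congr (.of_forall fun t => ?_)
    simp only
    rw [hG, ← div_eq_inv_mul, ← intervalIntegral.integral_div,
      intervalIntegral.intervalIntegral_eq_integral_uIoc, smul_eq_mul]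
  obtain ⟨D, hD0, hD⟩ := hh.abs_sub_symm_le
  obtain ⟨H, hH⟩ := hH
  have hH0 : 0 ≤ H := by simpa using (abs_nonneg _).trans (hH 1 0)
  have hG0 : ∀ t, 0 < t → |G t| ≤ 2 * H * |b - a| * √t := by
    intro t ht
    rw [hG, ← Real.norm_eq_abs]
    refine (intervalIntegral.norm_integral_le_of_norm_le_const (C := 2 * H * √t) fun x _ => ?_).trans
      (le_of_eq (by ring))
    refine (hH _ _).trans ?_
    have e : x + t - (x - t) = 2 * t := by ring
    rw [e, abs_of_pos (by positivity), Real.sqrt_mul (by norm_num)]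
    have : √2 ≤ 2 := Real.sqrt_le_iff.2 (by norm_num)
    nlinarith [mul_nonneg hH0 (Real.sqrt_nonneg t)]
  have hG1 : ∀ t, |G t| ≤ D * (1 + M ^ 2) * |b - a| * (1 + t ^ 2)⁻¹ := by
    intro t
    rw [hG, ← Real.norm_eq_abs]
    refine (intervalIntegral.norm_integral_le_of_norm_le_const
      (C := D * (1 + M ^ 2) * (1 + t ^ 2)⁻¹) fun x hx => ?_).trans (le_of_eq (by ring))
    refine (hD x t).trans ?_
    exact mul_le_mul_of_nonneg_right (mul_le_mul_of_nonneg_left (by linarith [hxM x hx]) hD0)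
      (by positivity)
  have hz : Tendsto (log * G) (𝓝[>] 0) (𝓝 0) := by
    have h1 := (tendsto_log_mul_rpow_nhdsGT_zero (r := 1 / 2) (by norm_num)).abs.const_mul
      (2 * H * |b - a|)
    rw [abs_zero, mul_zero] at h1
    refine squeeze_zero_norm' ?_ h1
    filter_upwards [self_mem_nhdsWithin] with t ht
    rw [Pi.mul_apply, norm_mul, Real.norm_eq_abs, Real.norm_eq_abs, abs_mul,
      ← Real.sqrt_eq_rpow, abs_of_nonneg (Real.sqrt_nonneg t)]
    nlinarith [mul_le_mul_of_nonneg_left (hG0 t ht) (abs_nonneg (log t))]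
  have hinf : Tendsto (log * G) atTop (𝓝 0) := by
    have h1 := (tendsto_inv_atTop_zero (𝕜 := ℝ)).const_mul (D * (1 + M ^ 2) * |b - a|)
    rw [mul_zero] at h1
    refine squeeze_zero_norm' ?_ h1
    filter_upwards [eventually_ge_atTop 1] with t ht
    rw [Pi.mul_apply, norm_mul, Real.norm_eq_abs, Real.norm_eq_abs,
      abs_of_nonneg (Real.log_nonneg ht)]
    have h2 : log t ≤ t := (Real.log_le_sub_one_of_pos (by linarith)).trans (by linarith)
    have h3 : t * (1 + t ^ 2)⁻¹ ≤ t⁻¹ := by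
      rw [← div_eq_mul_inv, inv_eq_one_div, div_le_div_iff₀ (by positivity) (by positivity)]
      nlinarith
    calc log t * |G t| ≤ t * (D * (1 + M ^ 2) * |b - a| * (1 + t ^ 2)⁻¹) :=
          mul_le_mul h2 (hG1 t) (abs_nonneg _) (by linarith)
      _ = D * (1 + M ^ 2) * |b - a| * (t * (1 + t ^ 2)⁻¹) := by ring
      _ ≤ _ := mul_le_mul_of_nonneg_left h3 (by positivity)
  have hlG : IntegrableOn (log * G') (Ioi 0) :=
    ((hlog b).2.sub (hlog a).2).congr (.of_forall fun t => by
      simp only [Pi.sub_apply, Pi.mul_apply, hG']; ring)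
  have hparts := integral_Ioi_mul_deriv_eq_deriv_mul (a := (0 : ℝ)) (u := log) (v := G)
    (u' := fun t => t⁻¹) (v' := G') (fun t ht => Real.hasDerivAt_log (ne_of_gt ht))
    (fun t _ => hGd t) hlG hGint hz hinf
  rw [hswap, (hlog b).1, (hlog a).1, ← integral_sub (hlog b).2 (hlog a).2]
  rw [sub_zero, zero_sub] at hparts
  rw [← hparts]
  congr 1; ext t; simp only [hG']; ring

lemma QuadDecay.hasDerivAt_logPot_pvHilbert {h : ℝ → ℝ} (hh : QuadDecay h) (hH : HolderHalf h)
    (x : ℝ) : HasDerivAt (logPot h) (-pvHilbert h x) x := by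
  have e : logPot h = fun b => logPot h 0 + -∫ x in (0 : ℝ)..b, pvHilbert h x := by
    ext b; rw [← hh.logPot_sub_eq_pvHilbert hH]; ring
  rw [e]
  exact (((hh.continuous_pvHilbert hH).integral_hasStrictDerivAt 0 x).hasDerivAt.neg).const_add _

/-- For `C¹` functions the Hilbert transform is minus the logarithmic potential of the derivative. -/
lemma QuadDecay.pvHilbert_eq_neg_logPot {h h' : ℝ → ℝ} (hh : QuadDecay h) (hH : HolderHalf h)
    (hh' : QuadDecay h') (hd : ∀ x, HasDerivAt h (h' x) x) (hc : Continuous h') (x : ℝ) :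
    pvHilbert h x = -logPot h' x := by
  have := (hh.hasDerivAt_logPot_pvHilbert hH x).unique (hh.hasDerivAt_logPot hh' hd hc x)
  linarith

/-! ### Negativity of the logarithmic energy on functions of mean zero -/

lemma integrableOn_exp_neg_mul_Ioi {s : ℝ} (hs : 0 < s) :
    IntegrableOn (fun ξ => exp (-(s * ξ))) (Ioi 0) := by
  have := integrableOn_exp_mul_Ioi (a := -s) (by linarith) 0
  simpa [neg_mul] using this

lemma integral_exp_neg_mul_cos {s : ℝ} (hs : 0 < s) (d : ℝ) :
    ∫ ξ in Ioi (0 : ℝ), exp (-(s * ξ)) * cos (d * ξ) = s / (s ^ 2 + d ^ 2) := by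
  have hne : s ^ 2 + d ^ 2 ≠ 0 := by positivity
  have hder : ∀ ξ ∈ Ici (0 : ℝ), HasDerivAt
      (fun ξ => exp (-(s * ξ)) * (d * sin (d * ξ) - s * cos (d * ξ)) / (s ^ 2 + d ^ 2))
      (exp (-(s * ξ)) * cos (d * ξ)) ξ := by
    intro ξ _
    have h1 : HasDerivAt (fun ξ => exp (-(s * ξ))) (exp (-(s * ξ)) * -s) ξ := by
      have := ((hasDerivAt_id ξ).const_mul s).neg.exp
      simpa using this
    have h2 : HasDerivAt (fun ξ => d * ξ) d ξ := by simpa using (hasDerivAt_id ξ).const_mul d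
    refine ((h1.mul ((h2.sin.const_mul d).sub (h2.cos.const_mul s))).div_const _).congr_deriv ?_
    simp only [Pi.sub_apply]; field_simp; ring
  have hint : IntegrableOn (fun ξ => exp (-(s * ξ)) * cos (d * ξ)) (Ioi 0) := by
    refine (integrableOn_exp_neg_mul_Ioi hs).mono' (by fun_prop) (.of_forall fun ξ => ?_)
    rw [norm_mul, Real.norm_of_nonneg (exp_pos _).le]
    exact mul_le_of_le_one_right (exp_pos _).le (abs_cos_le_one _)
  have hlim : Tendsto (fun ξ => exp (-(s * ξ)) * (d * sin (d * ξ) - s * cos (d * ξ))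
      / (s ^ 2 + d ^ 2)) atTop (𝓝 0) := by
    have h0 : Tendsto (fun ξ => exp (-(s * ξ)) * ((|d| + s) / (s ^ 2 + d ^ 2))) atTop (𝓝 0) := by
      have := (Real.tendsto_exp_neg_atTop_nhds_zero.comp
        (tendsto_id.const_mul_atTop hs)).mul_const ((|d| + s) / (s ^ 2 + d ^ 2))
      simpa using this
    refine squeeze_zero_norm (fun ξ => ?_) h0
    rw [norm_div, norm_mul, Real.norm_of_nonneg (exp_pos _).le, mul_div_assoc,
      Real.norm_of_nonneg (by positivity : 0 ≤ s ^ 2 + d ^ 2), Real.norm_eq_abs]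
    refine mul_le_mul_of_nonneg_left (div_le_div_of_nonneg_right ?_ (by positivity)) (exp_pos _).le
    refine (abs_sub _ _).trans ?_
    rw [abs_mul, abs_mul, abs_of_pos hs]
    exact add_le_add (mul_le_of_le_one_right (abs_nonneg _) (abs_sin_le_one _))
      (mul_le_of_le_one_right hs.le (abs_cos_le_one _))
  rw [integral_Ioi_of_hasDerivAt_of_tendsto' hder hint hlim]
  simp; ring

lemma integral_cos_kernel {k : ℝ → ℝ} (hk : Integrable k) (ξ : ℝ) :
    ∫ p : ℝ × ℝ, cos ((p.1 - p.2) * ξ) * (k p.1 * k p.2) =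
      (∫ x, cos (x * ξ) * k x) ^ 2 + (∫ x, sin (x * ξ) * k x) ^ 2 := by
  have hc : Integrable fun x => cos (x * ξ) * k x :=
    hk.bdd_mul (by fun_prop) (.of_forall fun x => abs_cos_le_one _)
  have hs : Integrable fun x => sin (x * ξ) * k x :=
    hk.bdd_mul (by fun_prop) (.of_forall fun x => abs_sin_le_one _)
  rw [sq, sq, ← integral_prod_mul, ← integral_prod_mul, ← integral_add (hc.mul_prod hc)
    (hs.mul_prod hs)]
  congr 1; ext p
  rw [sub_mul, cos_sub]; ring

lemma integral_poisson_kernel_nonneg {k : ℝ → ℝ} (hk : Integrable k) {s : ℝ} (hs : 0 < s) :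
    0 ≤ ∫ p : ℝ × ℝ, s / (s ^ 2 + (p.1 - p.2) ^ 2) * (k p.1 * k p.2) := by
  have e : ∀ p : ℝ × ℝ, s / (s ^ 2 + (p.1 - p.2) ^ 2) * (k p.1 * k p.2) =
      ∫ ξ in Ioi (0 : ℝ), exp (-(s * ξ)) * (cos ((p.1 - p.2) * ξ) * (k p.1 * k p.2)) := by
    intro p
    rw [← integral_exp_neg_mul_cos hs, ← integral_mul_const]
    congr 1; ext ξ; ring
  simp_rw [e]
  rw [integral_integral_swap]
  · refine integral_nonneg fun ξ => ?_
    rw [integral_const_mul, integral_cos_kernel hk]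
    simp only [Pi.zero_apply]
    positivity
  · have h1 : Integrable (fun q : (ℝ × ℝ) × ℝ => (|k q.1.1| * |k q.1.2|) * exp (-(s * q.2)))
        ((volume : Measure (ℝ × ℝ)).prod (volume.restrict (Ioi 0))) :=
      (hk.abs.mul_prod hk.abs).mul_prod (integrableOn_exp_neg_mul_Ioi hs)
    have hkk : AEStronglyMeasurable (fun q : (ℝ × ℝ) × ℝ => k q.1.1 * k q.1.2)
        ((volume : Measure (ℝ × ℝ)).prod (volume.restrict (Ioi 0))) :=
      (hk.mul_prod hk).aestronglyMeasurable.comp_fst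
    refine h1.mono' ?_ (.of_forall fun q => ?_)
    · unfold Function.uncurry
      exact (by fun_prop : Continuous fun q : (ℝ × ℝ) × ℝ =>
        exp (-(s * q.2))).aestronglyMeasurable.mul ((by fun_prop : Continuous fun q : (ℝ × ℝ) × ℝ =>
        cos ((q.1.1 - q.1.2) * q.2)).aestronglyMeasurable.mul hkk)
    · simp only [Function.uncurry, norm_mul, Real.norm_eq_abs, abs_exp]
      rw [mul_comm]
      exact mul_le_mul_of_nonneg_right (mul_le_of_le_one_left (by positivity) (abs_cos_le_one _))
        (exp_pos _).le

lemma integral_div_sq_add_sq {ε R : ℝ} (hε : 0 < ε) (hR : ε ≤ R) (d : ℝ) :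
    ∫ s in ε..R, s / (s ^ 2 + d ^ 2) = log (R ^ 2 + d ^ 2) / 2 - log (ε ^ 2 + d ^ 2) / 2 := by
  have hpos : ∀ s ∈ uIcc ε R, 0 < s ^ 2 + d ^ 2 := by
    intro s hs
    rw [uIcc_of_le hR] at hs
    have : 0 < s := hε.trans_le hs.1
    positivity
  rw [intervalIntegral.integral_eq_sub_of_hasDerivAt (f := fun s => log (s ^ 2 + d ^ 2) / 2)]
  · intro s hs
    have := (((hasDerivAt_pow 2 s).add_const (d ^ 2)).log (hpos s hs).ne').div_const 2
    refine this.congr_deriv ?_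
    simp; ring
  · refine ContinuousOn.intervalIntegrable fun s hs => ?_
    exact (ContinuousAt.div (f := fun s => s) (g := fun s => s ^ 2 + d ^ 2) (by fun_prop)
      (by fun_prop) (hpos s hs).ne').continuousWithinAt

lemma integral_log_sub_log_nonneg {k : ℝ → ℝ} (hk : Integrable k) {ε R : ℝ} (hε : 0 < ε)
    (hR : ε ≤ R) :
    0 ≤ ∫ p : ℝ × ℝ, (log (R ^ 2 + (p.1 - p.2) ^ 2) / 2 - log (ε ^ 2 + (p.1 - p.2) ^ 2) / 2)
      * (k p.1 * k p.2) := by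
  have e : ∀ p : ℝ × ℝ, (log (R ^ 2 + (p.1 - p.2) ^ 2) / 2 - log (ε ^ 2 + (p.1 - p.2) ^ 2) / 2)
      * (k p.1 * k p.2) =
      ∫ s in ε..R, s / (s ^ 2 + (p.1 - p.2) ^ 2) * (k p.1 * k p.2) := by
    intro p
    rw [← integral_div_sq_add_sq hε hR, ← intervalIntegral.integral_mul_const]
  simp_rw [e]
  rw [← MeasureTheory.intervalIntegral_integral_swap]
  · refine intervalIntegral.integral_nonneg hR fun s hs => ?_
    exact integral_poisson_kernel_nonneg hk (hε.trans_le hs.1)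
  · have h1 : Integrable (fun q : ℝ × (ℝ × ℝ) => ε⁻¹ * (|k q.2.1| * |k q.2.2|))
        ((volume.restrict (uIoc ε R)).prod (volume : Measure (ℝ × ℝ))) := by
      have : Integrable (fun _ : ℝ => ε⁻¹) (volume.restrict (uIoc ε R)) :=
        integrableOn_const (by simp [uIoc])
      exact this.mul_prod (hk.abs.mul_prod hk.abs)
    have hkk : AEStronglyMeasurable (fun q : ℝ × (ℝ × ℝ) => k q.2.1 * k q.2.2)
        ((volume.restrict (uIoc ε R)).prod (volume : Measure (ℝ × ℝ))) :=
      (hk.mul_prod hk).aestronglyMeasurable.comp_snd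
    refine h1.mono' ?_ ?_
    · unfold Function.uncurry
      exact (by fun_prop : Measurable fun q : ℝ × (ℝ × ℝ) =>
        q.1 / (q.1 ^ 2 + (q.2.1 - q.2.2) ^ 2)).aestronglyMeasurable.mul hkk
    · have : ∀ᵐ q ∂((volume.restrict (uIoc ε R)).prod (volume : Measure (ℝ × ℝ))),
          q.1 ∈ uIoc ε R :=
        Measure.quasiMeasurePreserving_fst.ae (ae_restrict_mem measurableSet_uIoc)
      filter_upwards [this] with q hq
      rw [uIoc_of_le hR] at hq
      have h0 : 0 < q.1 := hε.trans hq.1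
      simp only [Function.uncurry, norm_mul, norm_div, Real.norm_eq_abs]
      refine mul_le_mul_of_nonneg_right ?_ (by positivity)
      rw [abs_of_pos h0, abs_of_nonneg (by positivity), inv_eq_one_div,
        div_le_div_iff₀ (by positivity) hε]
      nlinarith [sq_nonneg (q.2.1 - q.2.2), hq.1, mul_pos h0 hε]

lemma ae_fst_ne_snd : ∀ᵐ p : ℝ × ℝ, p.1 ≠ p.2 := by
  rw [Measure.volume_eq_prod]
  have hm : MeasurableSet {p : ℝ × ℝ | p.1 ≠ p.2} :=
    (measurableSet_eq_fun measurable_fst measurable_snd).compl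
  rw [Measure.ae_prod_iff_ae_ae hm]
  refine .of_forall fun x => ?_
  filter_upwards [compl_mem_ae_iff.2 (measure_singleton x)] with y hy h using hy h.symm

/-- The logarithmic energy of an integrable function of mean zero is nonpositive. -/
theorem integral_log_energy_nonpos {k : ℝ → ℝ} (hk : Integrable fun x => (1 + |x|) * k x)
    (h0 : ∫ x, k x = 0)
    (hlog : Integrable fun p : ℝ × ℝ => log (p.1 - p.2) * (k p.1 * k p.2)) :
    ∫ p : ℝ × ℝ, log (p.1 - p.2) * (k p.1 * k p.2) ≤ 0 := by
  have hk1 : Integrable k := by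
    have : k = fun x => (1 + |x|)⁻¹ * ((1 + |x|) * k x) := by
      ext x
      have : 1 + |x| ≠ 0 := by positivity
      field_simp
    rw [this]
    refine hk.bdd_mul (c := 1) (by fun_prop) (.of_forall fun x => ?_)
    rw [norm_inv, Real.norm_of_nonneg (by positivity)]
    exact inv_le_one_of_one_le₀ (by linarith [abs_nonneg x])
  have hkk := hk1.mul_prod hk1
  have hmass : ∫ p : ℝ × ℝ, k p.1 * k p.2 = 0 := by
    rw [Measure.volume_eq_prod, integral_prod_mul, h0, zero_mul]
  set F : ℕ → ℝ × ℝ → ℝ := fun n p => (log (1 + (p.1 - p.2) ^ 2 / (n + 1 : ℝ) ^ 2) / 2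
    - log (((n + 1 : ℝ)⁻¹) ^ 2 + (p.1 - p.2) ^ 2) / 2) * (k p.1 * k p.2) with hF
  have hbound : ∀ (n : ℕ) (d : ℝ), d ≠ 0 → |log (1 + d ^ 2 / (n + 1 : ℝ) ^ 2) / 2
      - log (((n + 1 : ℝ)⁻¹) ^ 2 + d ^ 2) / 2| ≤ |log d| + log (1 + d ^ 2) := by
    intro n d hd
    have hn : (1 : ℝ) ≤ n + 1 := by linarith [n.cast_nonneg (α := ℝ)]
    have hd2 : 0 < d ^ 2 := by positivity
    have hn2 : ((n + 1 : ℝ)⁻¹) ^ 2 ≤ 1 := pow_le_one₀ (by positivity) (inv_le_one_of_one_le₀ hn)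
    have a1 : 0 ≤ log (1 + d ^ 2 / (n + 1 : ℝ) ^ 2) :=
      Real.log_nonneg (by linarith [show 0 ≤ d ^ 2 / (n + 1 : ℝ) ^ 2 by positivity])
    have a2 : log (1 + d ^ 2 / (n + 1 : ℝ) ^ 2) ≤ log (1 + d ^ 2) := by
      refine Real.log_le_log (by positivity) (add_le_add le_rfl (div_le_self hd2.le ?_))
      exact one_le_pow₀ hn
    have a3 : log (((n + 1 : ℝ)⁻¹) ^ 2 + d ^ 2) ≤ log (1 + d ^ 2) :=
      Real.log_le_log (by positivity) (by linarith)
    have a4 : 2 * log d ≤ log (((n + 1 : ℝ)⁻¹) ^ 2 + d ^ 2) := by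
      have : log (d ^ 2) = 2 * log d := by rw [Real.log_pow]; norm_num
      rw [← this]
      exact Real.log_le_log hd2 (by linarith [sq_nonneg ((n + 1 : ℝ)⁻¹)])
    have a5 : 0 ≤ log (1 + d ^ 2) := Real.log_nonneg (by linarith)
    rw [abs_le]
    constructor <;> linarith [neg_abs_le (log d), le_abs_self (log d), abs_nonneg (log d)]
  have hkk' := hk.mul_prod hk
  rw [← Measure.volume_eq_prod] at hkk'
  have hdom : Integrable fun p : ℝ × ℝ =>
      (|log (p.1 - p.2)| + log (1 + (p.1 - p.2) ^ 2)) * |k p.1 * k p.2| := by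
    have h1 : Integrable fun p : ℝ × ℝ => log (1 + (p.1 - p.2) ^ 2) * |k p.1 * k p.2| := by
      refine (hkk'.abs.const_mul 2).mono' ?_ (.of_forall fun p => ?_)
      · exact (by fun_prop : Measurable fun p : ℝ × ℝ =>
          log (1 + (p.1 - p.2) ^ 2)).aestronglyMeasurable.mul hkk.abs.aestronglyMeasurable
      · have b0 : 0 ≤ log (1 + (p.1 - p.2) ^ 2) := Real.log_nonneg (by nlinarith [sq_nonneg (p.1 - p.2)])
        have b1 : log (1 + (p.1 - p.2) ^ 2) ≤ 2 * ((1 + |p.1|) * (1 + |p.2|)) := by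
          have c1 : 1 + (p.1 - p.2) ^ 2 ≤ (1 + |p.1 - p.2|) ^ 2 := by
            nlinarith [sq_abs (p.1 - p.2), abs_nonneg (p.1 - p.2)]
          have c2 := Real.log_le_log (by positivity) c1
          rw [Real.log_pow] at c2
          have c3 := Real.log_le_sub_one_of_pos (show 0 < 1 + |p.1 - p.2| by positivity)
          push_cast at c2
          nlinarith [abs_sub p.1 p.2, mul_nonneg (abs_nonneg p.1) (abs_nonneg p.2)]
        rw [Real.norm_of_nonneg (by positivity)]
        have c4 : |(1 + |p.1|) * k p.1 * ((1 + |p.2|) * k p.2)|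
            = ((1 + |p.1|) * (1 + |p.2|)) * |k p.1 * k p.2| := by
          rw [show (1 + |p.1|) * k p.1 * ((1 + |p.2|) * k p.2)
            = ((1 + |p.1|) * (1 + |p.2|)) * (k p.1 * k p.2) by ring, abs_mul,
            abs_of_nonneg (show 0 ≤ (1 + |p.1|) * (1 + |p.2|) by positivity)]
        rw [c4]
        nlinarith [abs_nonneg (k p.1 * k p.2)]
    refine (hlog.abs.add h1).congr (.of_forall fun p => ?_)
    simp only [Pi.add_apply, abs_mul]; ring
  have hFm : ∀ n, AEStronglyMeasurable (F n) volume := fun n =>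
    (by fun_prop : Measurable fun p : ℝ × ℝ => (log (1 + (p.1 - p.2) ^ 2 / (n + 1 : ℝ) ^ 2) / 2
      - log (((n + 1 : ℝ)⁻¹) ^ 2 + (p.1 - p.2) ^ 2) / 2)).aestronglyMeasurable.mul
      hkk.aestronglyMeasurable
  have hFle : ∀ n, ∀ᵐ p : ℝ × ℝ, ‖F n p‖ ≤
      (|log (p.1 - p.2)| + log (1 + (p.1 - p.2) ^ 2)) * |k p.1 * k p.2| := by
    intro n
    filter_upwards [ae_fst_ne_snd] with p hp
    rw [hF, norm_mul]
    exact mul_le_mul_of_nonneg_right (hbound n _ (sub_ne_zero.2 hp)) (abs_nonneg _)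
  have hlim : Tendsto (fun n => ∫ p, F n p) atTop
      (𝓝 (∫ p : ℝ × ℝ, -(log (p.1 - p.2) * (k p.1 * k p.2)))) := by
    refine tendsto_integral_of_dominated_convergence _ hFm hdom hFle ?_
    filter_upwards [ae_fst_ne_snd] with p hp
    have hd : p.1 - p.2 ≠ 0 := sub_ne_zero.2 hp
    have hinv : Tendsto (fun n : ℕ => ((n + 1 : ℝ))⁻¹) atTop (𝓝 0) := by
      simpa using tendsto_one_div_add_atTop_nhds_zero_nat (𝕜 := ℝ)
    have t1 : Tendsto (fun n : ℕ => log (1 + (p.1 - p.2) ^ 2 / (n + 1 : ℝ) ^ 2) / 2) atTop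
        (𝓝 (log (1 + (p.1 - p.2) ^ 2 * 0 ^ 2) / 2)) := by
      have := ((hinv.pow 2).const_mul ((p.1 - p.2) ^ 2)).const_add 1
      simp only [inv_pow, ← div_eq_mul_inv] at this
      exact (this.log (by simp)).div_const 2
    have t2 : Tendsto (fun n : ℕ => log (((n + 1 : ℝ)⁻¹) ^ 2 + (p.1 - p.2) ^ 2) / 2) atTop
        (𝓝 (log (0 ^ 2 + (p.1 - p.2) ^ 2) / 2)) :=
      (((hinv.pow 2).add_const ((p.1 - p.2) ^ 2)).log (by positivity)).div_const 2
    have t3 := (t1.sub t2).mul_const (k p.1 * k p.2)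
    have e : (log (1 + (p.1 - p.2) ^ 2 * 0 ^ 2) / 2 - log (0 ^ 2 + (p.1 - p.2) ^ 2) / 2)
        * (k p.1 * k p.2) = -(log (p.1 - p.2) * (k p.1 * k p.2)) := by
      simp [Real.log_pow]
    rwa [e] at t3
  have hnn : ∀ n, 0 ≤ ∫ p, F n p := by
    intro n
    have hn : (1 : ℝ) ≤ n + 1 := by linarith [n.cast_nonneg (α := ℝ)]
    have hn0 : (0 : ℝ) < n + 1 := by positivity
    have h1 := integral_log_sub_log_nonneg hk1 (inv_pos.2 hn0)
      ((inv_le_one_of_one_le₀ hn).trans hn)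
    have hFi : Integrable (F n) := hdom.mono' (hFm n) (hFle n)
    have e : ∀ p : ℝ × ℝ, (log ((n + 1 : ℝ) ^ 2 + (p.1 - p.2) ^ 2) / 2
        - log (((n + 1 : ℝ)⁻¹) ^ 2 + (p.1 - p.2) ^ 2) / 2) * (k p.1 * k p.2)
        = F n p + log (n + 1) * (k p.1 * k p.2) := by
      intro p
      have : (n + 1 : ℝ) ^ 2 + (p.1 - p.2) ^ 2
          = (n + 1) ^ 2 * (1 + (p.1 - p.2) ^ 2 / (n + 1 : ℝ) ^ 2) := by field_simp
      rw [this, Real.log_mul (by positivity) (by positivity), Real.log_pow, hF]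
      push_cast; ring
    simp_rw [e] at h1
    rwa [integral_add hFi (hkk.const_mul _), integral_const_mul, hmass, mul_zero, add_zero] at h1
  have := ge_of_tendsto' hlim hnn
  rw [integral_neg] at this
  linarith

/-! ### Measures given by densities -/

/-- `q` is a measurable version of a probability density on the line. -/
structure IsProbDensity (q : ℝ → ℝ) : Prop where
  measurable : Measurable q
  nonneg : ∀ x, 0 ≤ q x
  integrable : Integrable q
  integral_eq_one : ∫ x, q x = 1

/-- The measure with density `q`. -/
def ofDensity (q : ℝ → ℝ) : Measure ℝ := volume.withDensity fun x => ENNReal.ofReal (q x)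

/-- Absolute convergence of the mutual logarithmic energy of `f` and `g`. -/
def LogIntegrable (f g : ℝ → ℝ) : Prop :=
  Integrable fun p : ℝ × ℝ => log (p.1 - p.2) * (f p.1 * g p.2)

/-- The mutual logarithmic energy of `f` and `g`. -/
def logInt (f g : ℝ → ℝ) : ℝ := ∫ p : ℝ × ℝ, log (p.1 - p.2) * (f p.1 * g p.2)

section ofDensity

variable {q : ℝ → ℝ}

lemma integrable_ofDensity_iff (hm : Measurable q) (h0 : ∀ x, 0 ≤ q x) {F : ℝ → ℝ} :
    Integrable F (ofDensity q) ↔ Integrable fun x => F x * q x := by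
  rw [ofDensity, integrable_withDensity_iff_integrable_smul' (by fun_prop) (by simp)]
  simp only [smul_eq_mul, ENNReal.toReal_ofReal (h0 _), mul_comm]

lemma integral_ofDensity (hm : Measurable q) (h0 : ∀ x, 0 ≤ q x) (F : ℝ → ℝ) :
    ∫ x, F x ∂(ofDensity q) = ∫ x, F x * q x := by
  rw [ofDensity, integral_withDensity_eq_integral_toReal_smul (by fun_prop) (by simp)]
  simp only [smul_eq_mul, ENNReal.toReal_ofReal (h0 _), mul_comm]

lemma ofDensity_prod (hm : Measurable q) (h0 : ∀ x, 0 ≤ q x) :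
    (ofDensity q).prod (ofDensity q) =
      (volume : Measure (ℝ × ℝ)).withDensity fun p => ENNReal.ofReal (q p.1 * q p.2) := by
  rw [ofDensity, prod_withDensity (by fun_prop) (by fun_prop), Measure.volume_eq_prod]
  simp only [ENNReal.ofReal_mul (h0 _)]

lemma integrable_ofDensity_prod_iff (hm : Measurable q) (h0 : ∀ x, 0 ≤ q x) {F : ℝ × ℝ → ℝ} :
    Integrable F ((ofDensity q).prod (ofDensity q)) ↔
      Integrable fun p => F p * (q p.1 * q p.2) := by
  rw [ofDensity_prod hm h0, integrable_withDensity_iff_integrable_smul' (by fun_prop) (by simp)]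
  simp only [smul_eq_mul, ENNReal.toReal_ofReal (mul_nonneg (h0 _) (h0 _)), mul_comm]

lemma integral_ofDensity_prod (hm : Measurable q) (h0 : ∀ x, 0 ≤ q x) (F : ℝ × ℝ → ℝ) :
    ∫ p, F p ∂((ofDensity q).prod (ofDensity q)) = ∫ p : ℝ × ℝ, F p * (q p.1 * q p.2) := by
  rw [ofDensity_prod hm h0, integral_withDensity_eq_integral_toReal_smul (by fun_prop) (by simp)]
  simp only [smul_eq_mul, ENNReal.toReal_ofReal (mul_nonneg (h0 _) (h0 _)), mul_comm]

lemma density_ofDensity (hm : Measurable q) (h0 : ∀ x, 0 ≤ q x) :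
    density (ofDensity q) =ᵐ[volume] q := by
  filter_upwards [Measure.rnDeriv_withDensity volume (f := fun x => ENNReal.ofReal (q x))
    (by fun_prop)] with x hx
  rw [density, ofDensity, hx, ENNReal.toReal_ofReal (h0 x)]

lemma isProbabilityMeasure_ofDensity (hq : IsProbDensity q) :
    IsProbabilityMeasure (ofDensity q) := by
  constructor
  rw [ofDensity, withDensity_apply _ MeasurableSet.univ, Measure.restrict_univ,
    ← ofReal_integral_eq_lintegral_ofReal hq.integrable (.of_forall hq.nonneg), hq.integral_eq_one,
    ENNReal.ofReal_one]

end ofDensity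

lemma density_nonneg (μ : Measure ℝ) (x : ℝ) : 0 ≤ density μ x := ENNReal.toReal_nonneg

lemma measurable_density (μ : Measure ℝ) : Measurable (density μ) :=
  (Measure.measurable_rnDeriv μ volume).ennreal_toReal

lemma ofDensity_density {μ : Measure ℝ} [IsProbabilityMeasure μ] (h : μ ≪ volume) :
    ofDensity (density μ) = μ := by
  conv_rhs => rw [← Measure.withDensity_rnDeriv_eq μ volume h]
  refine withDensity_congr_ae ?_
  filter_upwards [Measure.rnDeriv_lt_top μ volume] with x hx
  rw [density, ENNReal.ofReal_toReal hx.ne]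

lemma isProbDensity_density {μ : Measure ℝ} [IsProbabilityMeasure μ] (h : μ ≪ volume) :
    IsProbDensity (density μ) where
  measurable := measurable_density μ
  nonneg := density_nonneg μ
  integrable := Measure.integrable_toReal_rnDeriv
  integral_eq_one := by
    have := integral_ofDensity (measurable_density μ) (density_nonneg μ) (fun _ => 1)
    rw [ofDensity_density h] at this
    simpa using this.symm

/-- The energy of a density, as an integral with respect to Lebesgue measure. -/
def densityEnergy (V : ℝ → ℝ) (P : ℝ) (q : ℝ → ℝ) : ℝ :=
  (∫ x, (V x + log (q x)) * q x) - P * logInt q q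

/-- Finiteness of the energy of a density. -/
structure FiniteDensityEnergy (V q : ℝ → ℝ) : Prop where
  potential : Integrable fun x => V x * q x
  entropy : Integrable fun x => log (q x) * q x
  interaction : LogIntegrable q q

lemma finiteEnergy_ofDensity_iff {V q : ℝ → ℝ} (hq : IsProbDensity q) :
    FiniteEnergy V (ofDensity q) ↔ FiniteDensityEnergy V q := by
  have hd : (fun x => log (density (ofDensity q) x) * q x) =ᵐ[volume] fun x => log (q x) * q x := by
    filter_upwards [density_ofDensity hq.measurable hq.nonneg] with x hx
    rw [hx]
  constructor
  · rintro ⟨-, h1, h2, h3⟩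
    rw [integrable_ofDensity_iff hq.measurable hq.nonneg] at h1 h2
    rw [integrable_ofDensity_prod_iff hq.measurable hq.nonneg] at h3
    simp only [Real.log_abs] at h3
    exact ⟨h1, h2.congr hd, h3⟩
  · rintro ⟨h1, h2, h3⟩
    refine ⟨withDensity_absolutelyContinuous _ _, ?_, ?_, ?_⟩
    · rwa [integrable_ofDensity_iff hq.measurable hq.nonneg]
    · rw [integrable_ofDensity_iff hq.measurable hq.nonneg]
      exact h2.congr hd.symm
    · rw [integrable_ofDensity_prod_iff hq.measurable hq.nonneg]
      simp only [Real.log_abs]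
      exact h3

lemma energy_ofDensity {V q : ℝ → ℝ} (P : ℝ) (hq : IsProbDensity q) :
    energy V P (ofDensity q) = densityEnergy V P q := by
  rw [energy, densityEnergy, logInt, integral_ofDensity hq.measurable hq.nonneg,
    integral_ofDensity_prod hq.measurable hq.nonneg]
  simp only [Real.log_abs]
  congr 1
  refine integral_congr_ae ?_
  filter_upwards [density_ofDensity hq.measurable hq.nonneg] with x hx
  rw [hx]

/-- The density of the equilibrium measure minimizes the energy among densities. -/
lemma IsEquilibriumMeasure.densityEnergy_le {V : ℝ → ℝ} {P : ℝ} {μ : Measure ℝ}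
    (hμ : IsEquilibriumMeasure V P μ) {q : ℝ → ℝ} (hq : IsProbDensity q)
    (hf : FiniteDensityEnergy V q) :
    densityEnergy V P (density μ) ≤ densityEnergy V P q := by
  have := hμ.isProb
  have h1 := hμ.minimal (ofDensity q) (isProbabilityMeasure_ofDensity hq)
    ((finiteEnergy_ofDensity_iff hq).2 hf)
  rwa [energy_ofDensity P hq, ← ofDensity_density hμ.finite.ac,
    energy_ofDensity P (isProbDensity_density hμ.finite.ac)] at h1

lemma IsEquilibriumMeasure.finiteDensityEnergy {V : ℝ → ℝ} {P : ℝ} {μ : Measure ℝ}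
    (hμ : IsEquilibriumMeasure V P μ) : FiniteDensityEnergy V (density μ) := by
  have := hμ.isProb
  rw [← finiteEnergy_ofDensity_iff (isProbDensity_density hμ.finite.ac),
    ofDensity_density hμ.finite.ac]
  exact hμ.finite

/-! ### The mutual logarithmic energy -/

lemma LogIntegrable.symm {f g : ℝ → ℝ} (h : LogIntegrable f g) : LogIntegrable g f := by
  have h1 : Integrable (fun p : ℝ × ℝ => log (p.1 - p.2) * (f p.1 * g p.2))
      ((volume : Measure ℝ).prod volume) := h
  refine h1.swap.congr (.of_forall fun p => ?_)
  simp only [Function.comp_apply, Prod.fst_swap, Prod.snd_swap]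
  rw [← Real.log_neg_eq_log, neg_sub, mul_comm (f p.2)]

lemma logInt_comm (f g : ℝ → ℝ) : logInt f g = logInt g f := by
  rw [logInt, logInt, Measure.volume_eq_prod, ← integral_prod_swap]
  congr 1; ext p
  simp only [Prod.fst_swap, Prod.snd_swap]
  rw [← Real.log_neg_eq_log, neg_sub, mul_comm (f p.2)]

lemma LogIntegrable.add_left {f g k : ℝ → ℝ} (hf : LogIntegrable f k) (hg : LogIntegrable g k)
    (a b : ℝ) : LogIntegrable (fun x => a * f x + b * g x) k ∧
      logInt (fun x => a * f x + b * g x) k = a * logInt f k + b * logInt g k := by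
  have e : ∀ p : ℝ × ℝ, log (p.1 - p.2) * ((a * f p.1 + b * g p.1) * k p.2)
      = a * (log (p.1 - p.2) * (f p.1 * k p.2)) + b * (log (p.1 - p.2) * (g p.1 * k p.2)) := by
    intro p; ring
  rw [LogIntegrable, logInt]
  simp_rw [e]
  exact ⟨(hf.const_mul a).add (hg.const_mul b), by
    rw [integral_add (hf.const_mul a) (hg.const_mul b), integral_const_mul, integral_const_mul,
      logInt, logInt]⟩

lemma LogIntegrable.add_self {f g : ℝ → ℝ} (hf : LogIntegrable f f) (hfg : LogIntegrable f g)
    (hg : LogIntegrable g g) (a b : ℝ) :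
    LogIntegrable (fun x => a * f x + b * g x) (fun x => a * f x + b * g x) ∧
      logInt (fun x => a * f x + b * g x) (fun x => a * f x + b * g x) =
        a ^ 2 * logInt f f + 2 * a * b * logInt f g + b ^ 2 * logInt g g := by
  have h1 := LogIntegrable.add_left hf hfg.symm a b
  have h2 := LogIntegrable.add_left hfg hg a b
  have h3 := LogIntegrable.add_left h1.1.symm h2.1.symm a b
  refine ⟨h3.1, ?_⟩
  rw [h3.2, logInt_comm f, logInt_comm g, h1.2, h2.2, logInt_comm g f]; ring

lemma LogIntegrable.bdd_mul {f g b c : ℝ → ℝ} (h : LogIntegrable f g) (hb : Measurable b)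
    (hc : Measurable c) {B C : ℝ} (hB : ∀ x, |b x| ≤ B) (hC : ∀ x, |c x| ≤ C) :
    LogIntegrable (fun x => b x * f x) (fun x => c x * g x) := by
  have e : ∀ p : ℝ × ℝ, log (p.1 - p.2) * (b p.1 * f p.1 * (c p.2 * g p.2))
      = (b p.1 * c p.2) * (log (p.1 - p.2) * (f p.1 * g p.2)) := by
    intro p; ring
  rw [LogIntegrable]
  simp_rw [e]
  refine Integrable.bdd_mul (c := B * C) h (by fun_prop) (.of_forall fun p => ?_)
  rw [norm_mul]
  exact mul_le_mul (hB _) (hC _) (abs_nonneg _) ((abs_nonneg _).trans (hB 0))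

lemma LogIntegrable.integrable_mul_logPot {f g : ℝ → ℝ} (h : LogIntegrable f g) :
    Integrable (fun x => f x * logPot g x) ∧ logInt f g = ∫ x, f x * logPot g x := by
  have e : ∀ x, ∫ y, log (x - y) * (f x * g y) = f x * logPot g x := by
    intro x
    rw [logPot, ← integral_const_mul]
    congr 1; ext y; ring
  have h1 : Integrable (fun p : ℝ × ℝ => log (p.1 - p.2) * (f p.1 * g p.2))
      ((volume : Measure ℝ).prod volume) := h
  refine ⟨by simpa only [e] using h1.integral_prod_left, ?_⟩
  rw [logInt, Measure.volume_eq_prod, integral_prod _ h1]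
  simp only [e]

lemma QuadDecay.logIntegrable {f g : ℝ → ℝ} (hg : QuadDecay g)
    (hf : Integrable fun x => √(1 + |x|) * |f x|) (hfm : AEStronglyMeasurable f volume) :
    LogIntegrable f g := by
  obtain ⟨C, hC0, hC⟩ := hg.integral_abs_log
  have hm : AEStronglyMeasurable (fun p : ℝ × ℝ => log (p.1 - p.2) * (f p.1 * g p.2))
      ((volume : Measure ℝ).prod volume) :=
    (by fun_prop : Measurable fun p : ℝ × ℝ => log (p.1 - p.2)).aestronglyMeasurable.mul
      (hfm.comp_fst.mul hg.aesm.comp_snd)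
  rw [LogIntegrable, Measure.volume_eq_prod, integrable_prod_iff hm]
  refine ⟨.of_forall fun x => ?_, ?_⟩
  · refine ((hg.integrable_log_mul x).const_mul (f x)).congr (.of_forall fun y => ?_)
    simp only; ring
  · refine (hf.const_mul C).mono' hm.norm.integral_prod_right' (.of_forall fun x => ?_)
    have e : ∫ y, ‖log (x - y) * (f x * g y)‖ = |f x| * ∫ y, |log (x - y)| * |g y| := by
      rw [← integral_const_mul]
      congr 1; ext y; simp only [norm_mul, Real.norm_eq_abs]; ring
    simp only
    rw [e, Real.norm_of_nonneg (mul_nonneg (abs_nonneg _) (integral_nonneg fun _ => by positivity))]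
    nlinarith [(hC x).2, abs_nonneg (f x)]

/-! ### The Euler-Lagrange equation -/

lemma eq_zero_of_forall_quadratic_nonneg {a b : ℝ}
    (h : ∀ t : ℝ, |t| ≤ 1 / 2 → 0 ≤ t * a + t ^ 2 * b) : a = 0 := by
  by_contra ha
  set B := |a| + |b| + 1 with hB
  have hB0 : 0 < B := by positivity
  have ha2 : 0 < a ^ 2 := by positivity
  have h1 := h (-a / (2 * B)) (by
    rw [abs_div, abs_neg, abs_of_pos (by positivity : 0 < 2 * B), div_le_div_iff₀ (by positivity)
      (by norm_num)]
    linarith [abs_nonneg b])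
  have h2 : -a / (2 * B) * a + (-a / (2 * B)) ^ 2 * b = a ^ 2 * (b - 2 * B) / (4 * B ^ 2) := by
    field_simp; ring
  rw [h2] at h1
  have h3 : a ^ 2 * (b - 2 * B) / (4 * B ^ 2) < 0 := by
    refine div_neg_of_neg_of_pos (mul_neg_of_pos_of_neg ha2 ?_) (by positivity)
    linarith [le_abs_self b, abs_nonneg a]
  linarith

lemma integral_add_four {F₁ F₂ F₃ F₄ : ℝ → ℝ} (h₁ : Integrable F₁) (h₂ : Integrable F₂)
    (h₃ : Integrable F₃) (h₄ : Integrable F₄) :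
    ∫ x, (F₁ x + F₂ x + (F₃ x + F₄ x)) =
      (∫ x, F₁ x) + (∫ x, F₂ x) + ((∫ x, F₃ x) + ∫ x, F₄ x) := by
  have h₁₂ : Integrable fun x => F₁ x + F₂ x := h₁.add h₂
  have h₃₄ : Integrable fun x => F₃ x + F₄ x := h₃.add h₄
  rw [integral_add h₁₂ h₃₄, integral_add h₁ h₂, integral_add h₃ h₄]

/-- On the set where the density is positive, the effective potential is constant. -/
theorem IsEquilibriumMeasure.effectivePotential_const {V : ℝ → ℝ} {P : ℝ} {μ : Measure ℝ}
    (hμ : IsEquilibriumMeasure V P μ) :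
    ∃ c : ℝ, ∀ᵐ x, density μ x ≠ 0 →
      V x + log (density μ x) - 2 * P * logPot (density μ) x = c := by
  have := hμ.isProb
  set ρ := density μ with hρ
  have hd : IsProbDensity ρ := isProbDensity_density hμ.finite.ac
  have hE : FiniteDensityEnergy V ρ := hμ.finiteDensityEnergy
  have hS : Integrable fun x => (V x + log (ρ x)) * ρ x :=
    (hE.potential.add hE.entropy).congr (.of_forall fun x => by simp only [Pi.add_apply]; ring)
  have hU := hE.interaction.integrable_mul_logPot.1
  have hΦ : Integrable fun x => (V x + log (ρ x) - 2 * P * logPot ρ x) * ρ x :=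
    (hS.sub (hU.const_mul (2 * P))).congr (.of_forall fun x => by simp only [Pi.sub_apply]; ring)
  set c := ∫ x, (V x + log (ρ x) - 2 * P * logPot ρ x) * ρ x with hc
  have key : ∀ A, MeasurableSet A →
      ∫ x in A, (V x + log (ρ x) - 2 * P * logPot ρ x) * ρ x = (∫ x in A, ρ x) * c := by
    intro A hA
    set m := ∫ x in A, ρ x with hm
    have hm0 : 0 ≤ m := integral_nonneg fun x => hd.nonneg x
    have hm1 : m ≤ 1 := by
      rw [← hd.integral_eq_one]
      exact setIntegral_le_integral hd.integrable (.of_forall hd.nonneg)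
    set ζ : ℝ → ℝ := fun x => A.indicator (fun _ => 1) x - m with hζ
    have hζm : Measurable ζ := (measurable_const.indicator hA).sub_const m
    have hζ1 : ∀ x, |ζ x| ≤ 1 := by
      intro x
      simp only [hζ]
      by_cases hx : x ∈ A
      · rw [indicator_of_mem hx, abs_le]; constructor <;> linarith
      · rw [indicator_of_notMem hx, abs_le]; constructor <;> linarith
    have hζi : ∀ {F : ℝ → ℝ}, Integrable F → Integrable (fun x => ζ x * F x) ∧
        ∫ x, ζ x * F x = (∫ x in A, F x) - m * ∫ x, F x := by
      intro F hF
      refine ⟨hF.bdd_mul hζm.aestronglyMeasurable (.of_forall hζ1), ?_⟩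
      have e : ∀ x, ζ x * F x = A.indicator F x - m * F x := by
        intro x
        simp only [hζ]
        by_cases hx : x ∈ A
        · rw [indicator_of_mem hx, indicator_of_mem hx]; ring
        · rw [indicator_of_notMem hx, indicator_of_notMem hx]; ring
      simp_rw [e]
      rw [integral_sub (hF.indicator hA) (hF.const_mul m), integral_indicator hA,
        integral_const_mul]
    have hζρ := hζi hd.integrable
    rw [hd.integral_eq_one, mul_one, ← hm, sub_self] at hζρ
    have hζS := hζi hS
    have hL1 : LogIntegrable ρ fun x => ζ x * ρ x := by
      simpa using hE.interaction.bdd_mul (b := fun _ => 1) measurable_const hζm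
        (B := 1) (by simp) hζ1
    have hL2 := hE.interaction.bdd_mul hζm hζm hζ1 hζ1
    have hquad : ∀ t : ℝ, |t| ≤ 1 / 2 → 0 ≤ t * ((∫ x, ζ x * ((V x + log (ρ x)) * ρ x))
        - 2 * P * logInt ρ fun x => ζ x * ρ x) +
        t ^ 2 * (1 - P * logInt (fun x => ζ x * ρ x) fun x => ζ x * ρ x) := by
      intro t ht
      have hpos : ∀ x, 1 / 2 ≤ 1 + t * ζ x := by
        intro x
        have : |t * ζ x| ≤ 1 / 2 * 1 := by
          rw [abs_mul]; exact mul_le_mul ht (hζ1 x) (abs_nonneg _) (by norm_num)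
        linarith [neg_abs_le (t * ζ x)]
      set q : ℝ → ℝ := fun x => 1 * ρ x + t * (ζ x * ρ x) with hq
      have hq' : ∀ x, q x = (1 + t * ζ x) * ρ x := fun x => by simp only [hq]; ring
      have hqd : IsProbDensity q := by
        refine ⟨?_, fun x => ?_, ?_, ?_⟩
        · have := hd.measurable; fun_prop
        · rw [hq']; exact mul_nonneg (by linarith [hpos x]) (hd.nonneg x)
        · exact (hd.integrable.const_mul 1).add (hζρ.1.const_mul t)
        · simp only [hq]
          rw [integral_add (hd.integrable.const_mul 1) (hζρ.1.const_mul t), integral_const_mul,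
            integral_const_mul, hd.integral_eq_one, hζρ.2]; ring
      have hlog : ∀ x, log (q x) * q x = (1 + t * ζ x) * (log (ρ x) * ρ x)
          + (log (1 + t * ζ x) * (1 + t * ζ x)) * ρ x := by
        intro x
        rw [hq']
        rcases eq_or_ne (ρ x) 0 with h | h
        · simp [h]
        · rw [Real.log_mul (by linarith [hpos x]) h]; ring
      have hbd : ∀ x, |1 + t * ζ x| ≤ 2 := by
        intro x
        refine (abs_add_le _ _).trans ?_
        rw [abs_mul, abs_one]
        nlinarith [hζ1 x, abs_nonneg t, abs_nonneg (ζ x)]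
      have hlb : ∀ x, log (1 + t * ζ x) * (1 + t * ζ x) ≤ t * ζ x + t ^ 2 := by
        intro x
        have h1 := Real.log_le_sub_one_of_pos (show 0 < 1 + t * ζ x by linarith [hpos x])
        have h2 := hpos x
        have h3 : ζ x ^ 2 ≤ 1 := by
          rw [← sq_abs]; exact pow_le_one₀ (abs_nonneg _) (hζ1 x)
        nlinarith [mul_le_mul_of_nonneg_right h1 (by linarith : 0 ≤ 1 + t * ζ x),
          mul_le_mul_of_nonneg_left h3 (sq_nonneg t)]
      have hlabs : ∀ x, |log (1 + t * ζ x) * (1 + t * ζ x)| ≤ 2 := by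
        intro x
        have h2 := hpos x
        have h1 := hlb x
        have h4 := Real.log_le_sub_one_of_pos (show 0 < (1 + t * ζ x)⁻¹ from
          inv_pos.2 (by linarith))
        rw [Real.log_inv] at h4
        have h5 : (1 + t * ζ x)⁻¹ * (1 + t * ζ x) = 1 := inv_mul_cancel₀ (by linarith)
        have h6 : |t * ζ x| ≤ 1 / 2 * 1 := by
          rw [abs_mul]; exact mul_le_mul ht (hζ1 x) (abs_nonneg _) (by norm_num)
        have h7 := abs_le.1 h6
        have h8 : t ^ 2 ≤ 1 := by
          rw [← sq_abs]; exact pow_le_one₀ (abs_nonneg _) (by linarith)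
        rw [abs_le]
        constructor
        · nlinarith [mul_le_mul_of_nonneg_right h4 (by linarith : 0 ≤ 1 + t * ζ x)]
        · linarith
      have hint2 : Integrable fun x => (log (1 + t * ζ x) * (1 + t * ζ x)) * ρ x :=
        hd.integrable.bdd_mul (by fun_prop : Measurable fun x =>
          log (1 + t * ζ x) * (1 + t * ζ x)).aestronglyMeasurable (.of_forall hlabs)
      have hmul : ∀ {F : ℝ → ℝ}, Integrable F → Integrable fun x => (1 + t * ζ x) * F x := fun hF =>
        hF.bdd_mul (by fun_prop : Measurable fun x => 1 + t * ζ x).aestronglyMeasurable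
          (.of_forall hbd)
      have hqL := LogIntegrable.add_self hE.interaction hL1 hL2 1 t
      have hqE : FiniteDensityEnergy V q := by
        refine ⟨(hmul hE.potential).congr (.of_forall fun x => ?_),
          ((hmul hE.entropy).add hint2).congr (.of_forall fun x => ?_), hqL.1⟩
        · simp only [hq']; ring
        · simp only [Pi.add_apply]; rw [hlog x]
      have hmin := hμ.densityEnergy_le hqd hqE
      have hup : ∫ x, (V x + log (q x)) * q x ≤ ∫ x, ((V x + log (ρ x)) * ρ x
          + t * (ζ x * ((V x + log (ρ x)) * ρ x)) + (t * (ζ x * ρ x) + t ^ 2 * ρ x)) := by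
        refine integral_mono ?_ ?_ fun x => ?_
        · exact (hqE.potential.add hqE.entropy).congr
            (.of_forall fun x => by simp only [Pi.add_apply]; ring)
        · exact (hS.add (hζS.1.const_mul t)).add
            ((hζρ.1.const_mul t).add (hd.integrable.const_mul (t ^ 2)))
        · have := hlog x
          have h1 := mul_le_mul_of_nonneg_right (hlb x) (hd.nonneg x)
          simp only
          rw [add_mul, this, hq' x]
          linarith
      rw [integral_add_four hS (hζS.1.const_mul t) (hζρ.1.const_mul t)
        (hd.integrable.const_mul (t ^ 2)), integral_const_mul,
        integral_const_mul, integral_const_mul, hζρ.2, hd.integral_eq_one] at hup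
      rw [densityEnergy, densityEnergy, hqL.2] at hmin
      linarith
    have hzero := eq_zero_of_forall_quadratic_nonneg hquad
    rw [logInt_comm, LogIntegrable.integrable_mul_logPot hL1.symm |>.2, ← integral_const_mul,
      ← integral_sub hζS.1 ((LogIntegrable.integrable_mul_logPot hL1.symm).1.const_mul _)] at hzero
    have h2 := (hζi hΦ).2
    have e : ∫ x, ζ x * ((V x + log (ρ x) - 2 * P * logPot ρ x) * ρ x) = 0 := by
      rw [← hzero]
      congr 1; ext x; ring
    rw [e] at h2
    linarith
  refine ⟨c, ?_⟩
  have hz : (fun x => (V x + log (ρ x) - 2 * P * logPot ρ x) * ρ x - c * ρ x) =ᵐ[volume] 0 := by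
    refine Integrable.ae_eq_zero_of_forall_setIntegral_eq_zero
      (hΦ.sub (hd.integrable.const_mul c)) fun A hA _ => ?_
    rw [integral_sub hΦ.integrableOn (hd.integrable.const_mul c).integrableOn, key A hA,
      integral_const_mul]
    ring
  filter_upwards [hz] with x hx hne
  simp only [Pi.zero_apply] at hx
  rw [← sub_mul] at hx
  linarith [(mul_eq_zero.1 hx).resolve_right hne]

/-- The equilibrium density is positive almost everywhere. -/
theorem IsEquilibriumMeasure.density_ne_zero {V : ℝ → ℝ} {P : ℝ} {μ : Measure ℝ}
    (hμ : IsEquilibriumMeasure V P μ) (hP : 0 ≤ P) (hV : Continuous V)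
    (hmom : Integrable fun x => (1 + |x|) * density μ x) :
    ∀ᵐ x, density μ x ≠ 0 := by
  have := hμ.isProb
  set ρ := density μ with hρ
  have hd : IsProbDensity ρ := isProbDensity_density hμ.finite.ac
  have hE : FiniteDensityEnergy V ρ := hμ.finiteDensityEnergy
  have hS : Integrable fun x => (V x + log (ρ x)) * ρ x :=
    (hE.potential.add hE.entropy).congr (.of_forall fun x => by simp only [Pi.add_apply]; ring)
  by_contra hcon
  have hZ : volume {x | ρ x = 0} ≠ 0 := by
    intro h
    refine hcon ?_
    rw [ae_iff]
    simpa using h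
  have hZm : MeasurableSet {x | ρ x = 0} := hd.measurable (measurableSet_singleton 0)
  obtain ⟨n, hn⟩ : ∃ n : ℕ, volume ({x | ρ x = 0} ∩ Icc (-(n : ℝ)) n) ≠ 0 := by
    by_contra! h
    refine hZ (measure_mono_null (fun x hx => ?_) (measure_iUnion_null h))
    obtain ⟨n, hn⟩ := exists_nat_ge |x|
    exact mem_iUnion.2 ⟨n, hx, abs_le.1 hn⟩
  set B := {x | ρ x = 0} ∩ Icc (-(n : ℝ)) n with hB
  have hBm : MeasurableSet B := hZm.inter measurableSet_Icc
  have hBfin : volume B ≠ ⊤ :=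
    ((measure_mono inter_subset_right).trans_lt isCompact_Icc.measure_lt_top).ne
  set β := (volume B).toReal with hβ
  have hβ0 : 0 < β := ENNReal.toReal_pos hn hBfin
  set b : ℝ → ℝ := B.indicator fun _ => β⁻¹ with hb
  have hbm : Measurable b := measurable_const.indicator hBm
  have hb0 : ∀ x, 0 ≤ b x := fun x => indicator_nonneg (fun _ _ => by positivity) x
  have hbi : ∀ {F : ℝ → ℝ}, Continuous F → Integrable fun x => F x * b x := by
    intro F hF
    have h1 : IntegrableOn (fun x => F x * β⁻¹) B :=
      (hF.mul_const _).integrableOn_Icc.mono_set inter_subset_right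
    refine (h1.integrable_indicator hBm).congr (.of_forall fun x => ?_)
    simp only [hb, indicator_apply]
    split_ifs <;> simp
  have hbI : Integrable b := by simpa using hbi (F := fun _ => 1) continuous_const
  have hb1 : ∫ x, b x = 1 := by
    rw [hb, integral_indicator hBm, setIntegral_const, smul_eq_mul, Measure.real, ← hβ]
    exact mul_inv_cancel₀ hβ0.ne'
  have hbq : QuadDecay b := by
    refine ⟨hbm.aestronglyMeasurable, β⁻¹ * (1 + (n : ℝ) ^ 2), fun x => ?_⟩
    rw [abs_of_nonneg (hb0 x)]
    by_cases hx : x ∈ B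
    · rw [hb, indicator_of_mem hx, mul_assoc]
      refine le_mul_of_one_le_right (by positivity) ?_
      rw [← div_eq_mul_inv, one_le_div (by positivity)]
      have := sq_le_sq' hx.2.1 hx.2.2
      linarith
    · rw [hb, indicator_of_notMem hx]; positivity
  have hρsq : Integrable fun x => √(1 + |x|) * |ρ x| := by
    refine hmom.mono' ?_ (.of_forall fun x => ?_)
    · exact ((by fun_prop : Measurable fun x : ℝ => √(1 + |x|)).mul
        (hd.measurable.norm)).aestronglyMeasurable
    · rw [Real.norm_of_nonneg (by positivity), abs_of_nonneg (hd.nonneg x)]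
      refine mul_le_mul_of_nonneg_right ?_ (hd.nonneg x)
      exact Real.sqrt_le_iff.2 ⟨by positivity, by nlinarith [abs_nonneg x]⟩
  have hLρb : LogIntegrable ρ b := hbq.logIntegrable hρsq hd.measurable.aestronglyMeasurable
  have hLbb : LogIntegrable b b := by
    refine hbq.logIntegrable ?_ hbq.aesm
    have := hbi (F := fun x => √(1 + |x|)) (by fun_prop)
    exact this.congr (.of_forall fun x => by simp only [abs_of_nonneg (hb0 x)])
  have hρb : ∀ x, b x ≠ 0 → ρ x = 0 := by
    intro x hx
    by_contra h
    exact hx (indicator_of_notMem (fun hxB => h hxB.1) _)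
  have hblog : ∀ x, log (b x) * b x = -log β * b x := by
    intro x
    by_cases hx : x ∈ B
    · rw [hb, indicator_of_mem hx, Real.log_inv]
    · rw [hb, indicator_of_notMem hx]; simp
  set K := -(∫ x, (V x + log (ρ x)) * ρ x) + (∫ x, V x * b x) - log β
    + P * (3 * |logInt ρ ρ| + 2 * |logInt ρ b| + |logInt b b|) with hK
  have hkey : ∀ t : ℝ, 0 < t → t < 1 → 0 ≤ log t + K := by
    intro t ht ht1
    set q : ℝ → ℝ := fun x => (1 - t) * ρ x + t * b x with hq
    have hqd : IsProbDensity q := by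
      refine ⟨?_, fun x => ?_, ?_, ?_⟩
      · have := hd.measurable; fun_prop
      · exact add_nonneg (mul_nonneg (by linarith) (hd.nonneg x)) (mul_nonneg ht.le (hb0 x))
      · exact (hd.integrable.const_mul _).add (hbI.const_mul t)
      · simp only [hq]
        rw [integral_add (hd.integrable.const_mul _) (hbI.const_mul t), integral_const_mul,
          integral_const_mul, hd.integral_eq_one, hb1]; ring
    have hlog : ∀ x, log (q x) * q x = (1 - t) * (log (ρ x) * ρ x) + (1 - t) * log (1 - t) * ρ x
        + t * (log t - log β) * b x := by
      intro x
      simp only [hq]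
      rcases eq_or_ne (b x) 0 with h | h
      · rw [h]
        rcases eq_or_ne (ρ x) 0 with h' | h'
        · simp [h']
        · simp only [mul_zero, add_zero]
          rw [Real.log_mul (by linarith) h']; ring
      · rw [hρb x h]
        simp only [mul_zero, zero_add]
        rw [Real.log_mul ht.ne' h]
        linear_combination t * hblog x
    have hqL := LogIntegrable.add_self hE.interaction hLρb hLbb (1 - t) t
    have hqE : FiniteDensityEnergy V q := by
      refine ⟨((hE.potential.const_mul (1 - t)).add ((hbi hV).const_mul t)).congr
        (.of_forall fun x => ?_), (((hE.entropy.const_mul (1 - t)).add (hd.integrable.const_mul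
        ((1 - t) * log (1 - t)))).add (hbI.const_mul (t * (log t - log β)))).congr
        (.of_forall fun x => ?_), hqL.1⟩
      · simp only [Pi.add_apply, hq]; ring
      · simp only [Pi.add_apply]; rw [hlog x]
    have hmin := hμ.densityEnergy_le hqd hqE
    have hval : ∫ x, (V x + log (q x)) * q x = (1 - t) * (∫ x, (V x + log (ρ x)) * ρ x)
        + (1 - t) * log (1 - t) + (t * (∫ x, V x * b x) + t * (log t - log β)) := by
      have e : ∀ x, (V x + log (q x)) * q x = ((1 - t) * ((V x + log (ρ x)) * ρ x)
          + (1 - t) * log (1 - t) * ρ x) + (t * (V x * b x) + t * (log t - log β) * b x) := by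
        intro x
        rw [add_mul, hlog x]
        simp only [hq]; ring
      simp_rw [e]
      rw [integral_add_four (hS.const_mul _) (hd.integrable.const_mul _) ((hbi hV).const_mul t)
        (hbI.const_mul _), integral_const_mul,
        integral_const_mul, integral_const_mul, integral_const_mul, hd.integral_eq_one, hb1]
      ring
    rw [densityEnergy, densityEnergy, hqL.2, hval] at hmin
    have hl1 : (1 - t) * log (1 - t) ≤ 0 :=
      mul_nonpos_of_nonneg_of_nonpos (by linarith) (Real.log_nonpos (by linarith) (by linarith))
    have hP1 : -(P * ((1 - t) ^ 2 * logInt ρ ρ + 2 * (1 - t) * t * logInt ρ b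
        + t ^ 2 * logInt b b)) + P * logInt ρ ρ
        ≤ t * (P * (3 * |logInt ρ ρ| + 2 * |logInt ρ b| + |logInt b b|)) := by
      have h1 : (2 - t) * logInt ρ ρ ≤ 3 * |logInt ρ ρ| := by
        nlinarith [le_abs_self (logInt ρ ρ), abs_nonneg (logInt ρ ρ)]
      have h2 : -(2 * (1 - t) * logInt ρ b) ≤ 2 * |logInt ρ b| := by
        nlinarith [neg_abs_le (logInt ρ b), abs_nonneg (logInt ρ b)]
      have h3 : -(t * logInt b b) ≤ |logInt b b| := by
        nlinarith [neg_abs_le (logInt b b), abs_nonneg (logInt b b)]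
      have h4 := mul_le_mul_of_nonneg_left (add_le_add (add_le_add h1 h2) h3) (mul_nonneg ht.le hP)
      linarith
    have h5 : 0 ≤ t * (log t + K) := by
      rw [hK]; linarith
    exact nonneg_of_mul_nonneg_right h5 ht
  have h1 := hkey (exp (-(|K| + 1))) (exp_pos _) (by
    rw [Real.exp_lt_one_iff]; linarith [abs_nonneg K])
  rw [Real.log_exp] at h1
  linarith [le_abs_self K]

/-! ### Bounded functions and Hölder continuity -/

lemma BoundedFun.exists_nonneg {f : ℝ → ℝ} (hf : BoundedFun f) : ∃ C, 0 ≤ C ∧ ∀ x, |f x| ≤ C := by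
  obtain ⟨C, hC⟩ := hf
  exact ⟨C, (abs_nonneg _).trans (hC 0), hC⟩

lemma BoundedFun.add {f g : ℝ → ℝ} (hf : BoundedFun f) (hg : BoundedFun g) :
    BoundedFun fun x => f x + g x := by
  obtain ⟨C, hC⟩ := hf
  obtain ⟨D, hD⟩ := hg
  exact ⟨C + D, fun x => (abs_add_le _ _).trans (add_le_add (hC x) (hD x))⟩

lemma BoundedFun.mul {f g : ℝ → ℝ} (hf : BoundedFun f) (hg : BoundedFun g) :
    BoundedFun fun x => f x * g x := by
  obtain ⟨C, hC0, hC⟩ := hf.exists_nonneg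
  obtain ⟨D, hD⟩ := hg
  exact ⟨C * D, fun x => by rw [abs_mul]; exact mul_le_mul (hC x) (hD x) (abs_nonneg _) hC0⟩

lemma boundedFun_const (c : ℝ) : BoundedFun fun _ => c := ⟨|c|, fun _ => le_rfl⟩

lemma BoundedFun.const_mul {f : ℝ → ℝ} (hf : BoundedFun f) (c : ℝ) : BoundedFun fun x => c * f x :=
  (boundedFun_const c).mul hf

lemma BoundedFun.sub {f g : ℝ → ℝ} (hf : BoundedFun f) (hg : BoundedFun g) :
    BoundedFun fun x => f x - g x := by
  simpa [sub_eq_add_neg] using hf.add (hg.const_mul (-1))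

lemma BoundedFun.mono {f g : ℝ → ℝ} (hg : BoundedFun g) (h : ∀ x, |f x| ≤ |g x|) :
    BoundedFun f := by
  obtain ⟨C, hC⟩ := hg
  exact ⟨C, fun x => (h x).trans (hC x)⟩

lemma QuadDecay.boundedFun {h : ℝ → ℝ} (hh : QuadDecay h) : BoundedFun h := by
  obtain ⟨C, -, hC⟩ := hh.exists_bound_const
  exact ⟨C, hC⟩

lemma holderHalf_of_local {f : ℝ → ℝ} (hb : BoundedFun f) {C : ℝ}
    (h : ∀ x y, |x - y| ≤ 1 → |f x - f y| ≤ C * √|x - y|) : HolderHalf f := by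
  obtain ⟨B, hB0, hB⟩ := hb.exists_nonneg
  refine ⟨max C (2 * B), fun x y => ?_⟩
  rcases le_or_gt |x - y| 1 with h1 | h1
  · exact (h x y h1).trans (mul_le_mul_of_nonneg_right (le_max_left _ _) (Real.sqrt_nonneg _))
  · have h2 : 1 ≤ √|x - y| := Real.one_le_sqrt.2 h1.le
    have h3 : |f x - f y| ≤ 2 * B := (abs_sub _ _).trans (by linarith [hB x, hB y])
    calc |f x - f y| ≤ 2 * B := h3
      _ ≤ 2 * B * √|x - y| := le_mul_of_one_le_right (by positivity) h2
      _ ≤ _ := mul_le_mul_of_nonneg_right (le_max_right _ _) (Real.sqrt_nonneg _)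

lemma abs_le_sqrt_abs {s : ℝ} (h : |s| ≤ 1) : |s| ≤ √|s| := by
  refine Real.le_sqrt_of_sq_le ?_
  nlinarith [abs_nonneg s]

lemma abs_sub_le_of_deriv_bounded {f f' : ℝ → ℝ} (hd : ∀ x, HasDerivAt f (f' x) x) {C : ℝ}
    (hC : ∀ x, |f' x| ≤ C) (x y : ℝ) : |f x - f y| ≤ C * |x - y| := by
  have := convex_univ.norm_image_sub_le_of_norm_hasDerivWithin_le (f := f) (f' := f') (C := C)
    (fun x _ => (hd x).hasDerivWithinAt) (fun x _ => hC x) (mem_univ y) (mem_univ x)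
  simpa using this

lemma holderHalf_of_deriv {f f' : ℝ → ℝ} (hb : BoundedFun f) (hd : ∀ x, HasDerivAt f (f' x) x)
    (hb' : BoundedFun f') : HolderHalf f := by
  obtain ⟨C, hC0, hC⟩ := hb'.exists_nonneg
  exact holderHalf_of_local hb (C := C) fun x y hxy =>
    (abs_sub_le_of_deriv_bounded hd hC x y).trans
      (mul_le_mul_of_nonneg_left (abs_le_sqrt_abs hxy) hC0)

lemma HolderHalf.add {f g : ℝ → ℝ} (hf : HolderHalf f) (hg : HolderHalf g) :
    HolderHalf fun x => f x + g x := by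
  obtain ⟨C, hC⟩ := hf
  obtain ⟨D, hD⟩ := hg
  refine ⟨C + D, fun x y => ?_⟩
  rw [show f x + g x - (f y + g y) = (f x - f y) + (g x - g y) by ring, add_mul]
  exact (abs_add_le _ _).trans (add_le_add (hC x y) (hD x y))

lemma HolderHalf.const_mul {f : ℝ → ℝ} (hf : HolderHalf f) (c : ℝ) :
    HolderHalf fun x => c * f x := by
  obtain ⟨C, hC⟩ := hf
  refine ⟨|c| * C, fun x y => ?_⟩
  rw [← mul_sub, abs_mul, mul_assoc]
  exact mul_le_mul_of_nonneg_left (hC x y) (abs_nonneg _)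

lemma HolderHalf.mul {f g : ℝ → ℝ} (hf : HolderHalf f) (hg : HolderHalf g) (hfb : BoundedFun f)
    (hgb : BoundedFun g) : HolderHalf fun x => f x * g x := by
  obtain ⟨C, hC⟩ := hf
  obtain ⟨D, hD⟩ := hg
  obtain ⟨A, hA0, hA⟩ := hfb.exists_nonneg
  obtain ⟨B, hB0, hB⟩ := hgb.exists_nonneg
  refine ⟨A * D + C * B, fun x y => ?_⟩
  rw [show f x * g x - f y * g y = f x * (g x - g y) + (f x - f y) * g y by ring]
  refine (abs_add_le _ _).trans ?_
  rw [abs_mul, abs_mul, add_mul]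
  refine add_le_add ?_ ?_
  · rw [mul_assoc]; exact mul_le_mul (hA x) (hD x y) (abs_nonneg _) hA0
  · rw [mul_right_comm]
    exact mul_le_mul (hC x y) (hB y) (abs_nonneg _) ((abs_nonneg _).trans (hC x y))

lemma abs_exp_sub_exp_le {a b M : ℝ} (ha : a ≤ M) (hb : b ≤ M) :
    |exp a - exp b| ≤ exp M * |a - b| := by
  have key : ∀ {a b : ℝ}, a ≤ M → exp a - exp b ≤ exp M * |a - b| := by
    intro a b ha
    have h1 := Real.add_one_le_exp (b - a)
    have h2 : exp b = exp a * exp (b - a) := by rw [← Real.exp_add]; ring_nf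
    have h3 : exp a - exp b ≤ exp a * (a - b) := by rw [h2]; nlinarith [exp_pos a]
    exact h3.trans ((mul_le_mul_of_nonneg_left (le_abs_self (a - b)) (exp_pos a).le).trans
      (mul_le_mul_of_nonneg_right (exp_le_exp.2 ha) (abs_nonneg _)))
  rw [abs_le]
  have h1 := key (b := b) ha
  have h2 := key (b := a) hb
  rw [abs_sub_comm] at h2
  constructor <;> linarith

lemma boundedFun_of_isBigO_cocompact {f : ℝ → ℝ} (hf : Continuous f)
    (h : f =O[cocompact ℝ] fun _ => (1 : ℝ)) : BoundedFun f := by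
  obtain ⟨c, hc⟩ := h.bound
  obtain ⟨K, hK, hKc⟩ := mem_cocompact.1 hc
  obtain ⟨D, hD⟩ := hK.exists_bound_of_continuousOn hf.continuousOn
  refine ⟨max c D, fun x => ?_⟩
  by_cases hx : x ∈ K
  · exact (hD x hx).trans (le_max_right _ _)
  · have : ‖f x‖ ≤ c * ‖(1 : ℝ)‖ := hKc hx
    rw [norm_one, mul_one] at this
    exact this.trans (le_max_left _ _)

lemma _root_.HasDerivAt.comp_neg_self {f : ℝ → ℝ} {f' x : ℝ} (h : HasDerivAt f f' (-x)) :
    HasDerivAt (fun x => f (-x)) (-f') x := by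
  simpa [Function.comp_def] using h.comp x (hasDerivAt_neg x)

lemma hasDerivAt_iteratedDeriv {f : ℝ → ℝ} {n : ℕ} (hf : ContDiff ℝ n f) {k : ℕ} (hk : k < n)
    (x : ℝ) : HasDerivAt (iteratedDeriv k f) (iteratedDeriv (k + 1) f x) x := by
  rw [iteratedDeriv_succ]
  exact (hf.differentiable_iteratedDeriv k (by exact_mod_cast hk) x).hasDerivAt

/-! ### Consequences of the assumptions on the potential -/

section potential

variable {V : ℝ → ℝ} {μ : Measure ℝ}

lemma PotentialAssumptions.hasDerivAt (hV : PotentialAssumptions V μ) (x : ℝ) :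
    HasDerivAt V (deriv V x) x :=
  ((hV.smooth.differentiable (by norm_num)) x).hasDerivAt

lemma PotentialAssumptions.hasDerivAt_deriv (hV : PotentialAssumptions V μ) (x : ℝ) :
    HasDerivAt (deriv V) (iteratedDeriv 2 V x) x := by
  have := hasDerivAt_iteratedDeriv (n := 3) hV.smooth (k := 1) (by norm_num) x
  rwa [iteratedDeriv_one] at this

lemma PotentialAssumptions.hasDerivAt_deriv2 (hV : PotentialAssumptions V μ) (x : ℝ) :
    HasDerivAt (iteratedDeriv 2 V) (iteratedDeriv 3 V x) x :=
  hasDerivAt_iteratedDeriv (n := 3) hV.smooth (k := 2) (by norm_num) x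

lemma PotentialAssumptions.continuous_deriv (hV : PotentialAssumptions V μ) :
    Continuous (deriv V) :=
  continuous_iff_continuousAt.2 fun x => (hV.hasDerivAt_deriv x).continuousAt

lemma PotentialAssumptions.continuous_deriv2 (hV : PotentialAssumptions V μ) :
    Continuous (iteratedDeriv 2 V) :=
  continuous_iff_continuousAt.2 fun x => (hV.hasDerivAt_deriv2 x).continuousAt

lemma PotentialAssumptions.continuous_deriv3 (hV : PotentialAssumptions V μ) :
    Continuous (iteratedDeriv 3 V) :=
  hV.smooth.continuous_iteratedDeriv 3 le_rfl

/-- If `f → +∞` and `|f'| → +∞` at `+∞` then `f' → +∞` at `+∞`. -/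
lemma tendsto_deriv_atTop_of_abs {f f' : ℝ → ℝ} (hd : ∀ x, HasDerivAt f (f' x) x)
    (hc : Continuous f') (hf : Tendsto f atTop atTop)
    (hf' : Tendsto (fun x => |f' x|) atTop atTop) : Tendsto f' atTop atTop := by
  obtain ⟨x₀, hx₀⟩ := eventually_atTop.1 (hf'.eventually_ge_atTop 1)
  have hne : ∀ x ∈ Ici x₀, f' x ≠ 0 := fun x hx h => by
    have := hx₀ x hx
    rw [h, abs_zero] at this
    linarith
  have hpos : ∀ x ∈ Ici x₀, 0 < f' x := by
    by_contra! h
    obtain ⟨x₁, hx₁, hx₁'⟩ := h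
    have hneg : ∀ x ∈ Ici x₀, f' x ≤ 0 := by
      intro x hx
      by_contra! hpos
      obtain ⟨z, hz, hz0⟩ := isPreconnected_Ici.intermediate_value hx₁ hx hc.continuousOn
        (show (0 : ℝ) ∈ Icc (f' x₁) (f' x) from ⟨hx₁', hpos.le⟩)
      exact hne z hz hz0
    have hanti : AntitoneOn f (Ici x₀) := by
      refine antitoneOn_of_deriv_nonpos (convex_Ici x₀)
        (fun x _ => (hd x).continuousAt.continuousWithinAt)
        (fun x _ => (hd x).differentiableAt.differentiableWithinAt) fun x hx => ?_
      rw [(hd x).deriv]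
      exact hneg x (interior_subset hx)
    obtain ⟨x, hx, hx'⟩ := ((hf.eventually_gt_atTop (f x₀)).and (eventually_ge_atTop x₀)).exists
    exact absurd (hanti self_mem_Ici hx' hx') (not_le.2 hx)
  refine hf'.congr' ?_
  filter_upwards [eventually_ge_atTop x₀] with x hx using abs_of_pos (hpos x hx)

lemma PotentialAssumptions.tendsto_deriv_atTop (hV : PotentialAssumptions V μ) :
    Tendsto (deriv V) atTop atTop := by
  have h1 := hV.tendsto
  have h2 := hV.tendsto_deriv
  rw [cocompact_eq_atBot_atTop] at h1 h2
  exact tendsto_deriv_atTop_of_abs hV.hasDerivAt hV.continuous_deriv (h1.mono_left le_sup_right)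
    (h2.mono_left le_sup_right)

lemma PotentialAssumptions.tendsto_deriv_atBot (hV : PotentialAssumptions V μ) :
    Tendsto (fun x => -deriv V (-x)) atTop atTop := by
  have h1 := hV.tendsto
  have h2 := hV.tendsto_deriv
  rw [cocompact_eq_atBot_atTop] at h1 h2
  refine tendsto_deriv_atTop_of_abs (f := fun x => V (-x)) (fun x => ?_)
    (hV.continuous_deriv.comp continuous_neg).neg
    ((h1.mono_left le_sup_left).comp tendsto_neg_atTop_atBot) ?_
  · exact (hV.hasDerivAt (-x)).comp_neg_self
  · simpa [Function.comp_def] using (h2.mono_left le_sup_left).comp tendsto_neg_atTop_atBot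

lemma exists_le_add_of_tendsto_deriv {f f' : ℝ → ℝ} (hd : ∀ x, HasDerivAt f (f' x) x)
    (hf' : Tendsto f' atTop atTop) : ∃ C : ℝ, ∀ x, 0 ≤ x → x ≤ f x + C := by
  obtain ⟨x₀, hx₀⟩ := eventually_atTop.1 (hf'.eventually_ge_atTop 1)
  set z := max x₀ 0 with hz
  have hcf : Continuous f := continuous_iff_continuousAt.2 fun x => (hd x).continuousAt
  have hmono : MonotoneOn (fun x => f x - x) (Ici z) := by
    refine monotoneOn_of_deriv_nonneg (convex_Ici z) (by fun_prop)
      (fun x _ => ((hd x).sub (hasDerivAt_id x)).differentiableAt.differentiableWithinAt)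
      fun x hx => ?_
    have := ((hd x).sub (hasDerivAt_id' x)).deriv
    simp only [Pi.sub_def] at this
    rw [this]
    linarith [hx₀ x ((le_max_left x₀ 0).trans (interior_subset hx))]
  obtain ⟨D, hD⟩ := (isCompact_Icc (a := (0 : ℝ)) (b := z)).exists_bound_of_continuousOn
    (f := fun x => x - f x) (by fun_prop)
  refine ⟨max D (z - f z), fun x hx => ?_⟩
  rcases le_total x z with h | h
  · have := (le_abs_self _).trans (hD x ⟨hx, h⟩)
    linarith [le_max_left D (z - f z)]
  · have := hmono self_mem_Ici h h
    simp only at this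
    linarith [le_max_right D (z - f z)]

lemma PotentialAssumptions.exists_abs_le (hV : PotentialAssumptions V μ) :
    ∃ C : ℝ, ∀ x, |x| ≤ V x + C := by
  obtain ⟨C, hC⟩ := exists_le_add_of_tendsto_deriv hV.hasDerivAt hV.tendsto_deriv_atTop
  obtain ⟨D, hD⟩ := exists_le_add_of_tendsto_deriv (f := fun x => V (-x))
    (fun x => (hV.hasDerivAt (-x)).comp_neg_self) hV.tendsto_deriv_atBot
  refine ⟨max C D, fun x => ?_⟩
  rcases le_total 0 x with h | h
  · rw [abs_of_nonneg h]; linarith [hC x h, le_max_left C D]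
  · have := hD (-x) (by linarith)
    rw [neg_neg] at this
    rw [abs_of_nonpos h]; linarith [le_max_right C D]

lemma PotentialAssumptions.exists_le_deriv (hV : PotentialAssumptions V μ) {g : ℝ → ℝ}
    (hg : Continuous g) (h : (fun x => g x / deriv V x) =O[cocompact ℝ] fun _ => (1 : ℝ)) :
    ∃ C : ℝ, 0 ≤ C ∧ ∀ x, |g x| ≤ C * (1 + |deriv V x|) := by
  have hc := hV.continuous_deriv
  have hb : BoundedFun fun x => g x / (1 + |deriv V x|) := by
    refine boundedFun_of_isBigO_cocompact (hg.div (by fun_prop) fun x => by positivity) ?_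
    refine IsBigO.trans ?_ h
    refine IsBigO.of_bound 1 ?_
    filter_upwards [hV.tendsto_deriv.eventually_gt_atTop 0] with x hx
    rw [one_mul, norm_div, norm_div, Real.norm_eq_abs, Real.norm_eq_abs, Real.norm_eq_abs,
      abs_of_pos (show 0 < 1 + |deriv V x| by positivity)]
    exact div_le_div_of_nonneg_left (abs_nonneg _) hx (by linarith)
  obtain ⟨C, hC0, hC⟩ := hb.exists_nonneg
  refine ⟨C, hC0, fun x => ?_⟩
  have := hC x
  rwa [abs_div, abs_of_pos (show 0 < 1 + |deriv V x| by positivity),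
    div_le_iff₀ (by positivity)] at this

lemma PotentialAssumptions.weighted_exp_le (hV : PotentialAssumptions V μ) (k m : ℕ) :
    ∃ C : ℝ, 0 ≤ C ∧
      ∀ x, (1 + deriv V x ^ 2) ^ k * (1 + x ^ 2) ^ m * exp (-V x) ≤ C := by
  have hc := hV.continuous_deriv
  have hcV := hV.smooth.continuous
  have hb : BoundedFun fun x => (1 + deriv V x ^ 2) ^ k * (1 + x ^ 2) ^ m * exp (-V x) := by
    refine boundedFun_of_isBigO_cocompact (by fun_prop) ?_
    have h1 := (hV.decay ((1 + X ^ 2) ^ k) (2 * (m + 1)) (by positivity)).isBigO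
    have h2 : (fun x : ℝ => (1 + x ^ 2) ^ m) =O[cocompact ℝ] fun x => |x| ^ (2 * ((m : ℝ) + 1)) := by
      refine IsBigO.of_bound (2 ^ m) ?_
      have : ∀ᶠ x : ℝ in cocompact ℝ, 1 ≤ ‖x‖ :=
        tendsto_norm_cocompact_atTop.eventually_ge_atTop 1
      filter_upwards [this] with x hx
      rw [Real.norm_eq_abs] at hx
      have hx2 : 1 ≤ x ^ 2 := by nlinarith [sq_abs x]
      have e : |x| ^ (2 * ((m : ℝ) + 1)) = (x ^ 2) ^ (m + 1) := by
        rw [Real.rpow_mul (abs_nonneg _), show (2 : ℝ) = ((2 : ℕ) : ℝ) by norm_num,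
          Real.rpow_natCast, sq_abs, ← Nat.cast_succ, Real.rpow_natCast]
      rw [e, Real.norm_of_nonneg (by positivity), Real.norm_of_nonneg (by positivity)]
      calc (1 + x ^ 2) ^ m ≤ (2 * x ^ 2) ^ m := by gcongr; linarith
        _ = 2 ^ m * (x ^ 2) ^ m := mul_pow _ _ _
        _ ≤ _ := mul_le_mul_of_nonneg_left (pow_le_pow_right₀ hx2 (Nat.le_succ m)) (by positivity)
    refine ((h1.mul h2).congr' ?_ ?_)
    · refine .of_forall fun x => ?_
      simp; ring
    · have : ∀ᶠ x : ℝ in cocompact ℝ, 1 ≤ ‖x‖ :=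
        tendsto_norm_cocompact_atTop.eventually_ge_atTop 1
      filter_upwards [this] with x hx
      rw [Real.norm_eq_abs] at hx
      rw [← Real.rpow_add (by linarith)]
      simp
  obtain ⟨C, hC0, hC⟩ := hb.exists_nonneg
  exact ⟨C, hC0, fun x => (le_abs_self _).trans (hC x)⟩

end potential

/-! ### Regularity of the equilibrium density -/

lemma logPot_congr_ae {h k : ℝ → ℝ} (e : h =ᵐ[volume] k) : logPot h = logPot k := by
  ext x
  refine integral_congr_ae ?_
  filter_upwards [e] with y hy
  rw [hy]

lemma log_sub_le (x y : ℝ) : log (x - y) ≤ log (1 + |x|) + |y| := by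
  have h1 : log (1 + |y|) ≤ |y| := by
    linarith [Real.log_le_sub_one_of_pos (show 0 < 1 + |y| by positivity)]
  have h0 : 0 ≤ log (1 + |x|) := Real.log_nonneg (by linarith [abs_nonneg x])
  rcases eq_or_ne (x - y) 0 with h | h
  · rw [h, Real.log_zero]; positivity
  · have h2 : log |x - y| ≤ log ((1 + |x|) * (1 + |y|)) := by
      refine Real.log_le_log (abs_pos.2 h) ?_
      nlinarith [abs_sub x y, mul_nonneg (abs_nonneg x) (abs_nonneg y)]
    rw [Real.log_mul (by positivity) (by positivity), Real.log_abs] at h2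
    linarith

lemma logPot_le {q : ℝ → ℝ} (hq : IsProbDensity q) (hmom : Integrable fun x => (1 + |x|) * q x) :
    ∃ M : ℝ, ∀ x, logPot q x ≤ log (1 + x ^ 2) / 2 + M := by
  have hmom' : Integrable fun x => |x| * q x :=
    (hmom.sub hq.integrable).congr (.of_forall fun x => by simp only [Pi.sub_apply]; ring)
  have hM0 : 0 ≤ ∫ y, |y| * q y := integral_nonneg fun y => mul_nonneg (abs_nonneg y) (hq.nonneg y)
  refine ⟨log 2 / 2 + ∫ y, |y| * q y, fun x => ?_⟩
  have h1 : log (1 + |x|) ≤ log (1 + x ^ 2) / 2 + log 2 / 2 := by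
    have : log ((1 + |x|) ^ 2) ≤ log (2 * (1 + x ^ 2)) :=
      Real.log_le_log (by positivity) (by nlinarith [sq_nonneg (1 - |x|), sq_abs x])
    rw [Real.log_pow, Real.log_mul (by norm_num) (by positivity)] at this
    push_cast at this
    linarith
  have h0 : 0 ≤ log (1 + |x|) := Real.log_nonneg (by linarith [abs_nonneg x])
  by_cases hI : Integrable fun y => log (x - y) * q y
  · have h2 : logPot q x ≤ ∫ y, (log (1 + |x|) * q y + |y| * q y) := by
      refine integral_mono hI ((hq.integrable.const_mul _).add hmom') fun y => ?_
      have := mul_le_mul_of_nonneg_right (log_sub_le x y) (hq.nonneg y)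
      simp only
      linarith
    rw [integral_add (hq.integrable.const_mul _) hmom', integral_const_mul,
      hq.integral_eq_one] at h2
    linarith
  · rw [logPot, integral_undef hI]
    linarith

lemma IsEquilibriumMeasure.integrable_moment {V : ℝ → ℝ} {P : ℝ} {μ : Measure ℝ}
    (hμ : IsEquilibriumMeasure V P μ) (hV : PotentialAssumptions V μ) :
    Integrable fun x => (1 + |x|) * density μ x := by
  have := hμ.isProb
  have hd := isProbDensity_density hμ.finite.ac
  obtain ⟨C, hC⟩ := hV.exists_abs_le
  refine (hμ.finiteDensityEnergy.potential.add (hd.integrable.const_mul (1 + C))).mono' ?_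
    (.of_forall fun x => ?_)
  · have := hd.measurable
    exact (by fun_prop : Measurable fun x => (1 + |x|) * density μ x).aestronglyMeasurable
  · rw [Real.norm_of_nonneg (mul_nonneg (by positivity) (hd.nonneg x))]
    simp only [Pi.add_apply]
    nlinarith [hC x, hd.nonneg x]

/-- The Euler-Lagrange equation for the equilibrium density. -/
theorem IsEquilibriumMeasure.exists_density_eq_exp {V : ℝ → ℝ} {P : ℝ} {μ : Measure ℝ}
    (hμ : IsEquilibriumMeasure V P μ) (hV : PotentialAssumptions V μ) (hP : 0 ≤ P) :
    ∃ (r : ℝ → ℝ) (c M : ℝ), density μ =ᵐ[volume] r ∧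
      (∀ x, r x = exp (-V x + 2 * P * logPot r x + c)) ∧
      ∀ x, logPot r x ≤ log (1 + x ^ 2) / 2 + M := by
  have := hμ.isProb
  have hmom := hμ.integrable_moment hV
  obtain ⟨c, hc⟩ := hμ.effectivePotential_const
  obtain ⟨M, hM⟩ := logPot_le (isProbDensity_density hμ.finite.ac) hmom
  set r : ℝ → ℝ := fun x => exp (-V x + 2 * P * logPot (density μ) x + c) with hr
  have hae : density μ =ᵐ[volume] r := by
    filter_upwards [hc, hμ.density_ne_zero hP hV.smooth.continuous hmom] with x h1 h2
    have h3 : 0 < density μ x := lt_of_le_of_ne (density_nonneg μ x) h2.symm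
    rw [hr, ← Real.exp_log h3]
    congr 1
    linarith [h1 h2]
  have e := logPot_congr_ae hae
  exact ⟨r, c, M, hae, fun x => by rw [← e], by rwa [← e]⟩

/-- Functions of at most polynomial growth in `x` and `V'(x)`. -/
def ModerateGrowth (V b : ℝ → ℝ) : Prop :=
  ∃ (C : ℝ) (k m : ℕ), 0 ≤ C ∧ ∀ x, |b x| ≤ C * ((1 + deriv V x ^ 2) ^ k * (1 + x ^ 2) ^ m)

section ModerateGrowth

variable {V b c : ℝ → ℝ}

lemma ModerateGrowth.mul (hb : ModerateGrowth V b) (hc : ModerateGrowth V c) :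
    ModerateGrowth V fun x => b x * c x := by
  obtain ⟨C, k, m, hC0, hC⟩ := hb
  obtain ⟨D, l, n, hD0, hD⟩ := hc
  refine ⟨C * D, k + l, m + n, by positivity, fun x => ?_⟩
  rw [abs_mul, pow_add, pow_add]
  refine (mul_le_mul (hC x) (hD x) (abs_nonneg _) (by positivity)).trans (le_of_eq (by ring))

lemma ModerateGrowth.add (hb : ModerateGrowth V b) (hc : ModerateGrowth V c) :
    ModerateGrowth V fun x => b x + c x := by
  obtain ⟨C, k, m, hC0, hC⟩ := hb
  obtain ⟨D, l, n, hD0, hD⟩ := hc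
  refine ⟨C + D, k + l, m + n, by positivity, fun x => (abs_add_le _ _).trans ?_⟩
  rw [add_mul]
  have h1 : 1 ≤ 1 + deriv V x ^ 2 := by linarith [sq_nonneg (deriv V x)]
  have h2 : 1 ≤ 1 + x ^ 2 := by linarith [sq_nonneg x]
  refine add_le_add ((hC x).trans ?_) ((hD x).trans ?_)
  · exact mul_le_mul_of_nonneg_left (mul_le_mul (pow_le_pow_right₀ h1 (by omega))
      (pow_le_pow_right₀ h2 (by omega)) (by positivity) (by positivity)) hC0
  · exact mul_le_mul_of_nonneg_left (mul_le_mul (pow_le_pow_right₀ h1 (by omega))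
      (pow_le_pow_right₀ h2 (by omega)) (by positivity) (by positivity)) hD0

lemma BoundedFun.moderateGrowth (hb : BoundedFun b) : ModerateGrowth V b := by
  obtain ⟨C, hC0, hC⟩ := hb.exists_nonneg
  exact ⟨C, 0, 0, hC0, fun x => by simpa using hC x⟩

lemma ModerateGrowth.const_mul (hb : ModerateGrowth V b) (d : ℝ) :
    ModerateGrowth V fun x => d * b x :=
  (boundedFun_const d).moderateGrowth.mul hb

lemma ModerateGrowth.sub (hb : ModerateGrowth V b) (hc : ModerateGrowth V c) :
    ModerateGrowth V fun x => b x - c x := by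
  simpa [sub_eq_add_neg] using hb.add (hc.const_mul (-1))

lemma moderateGrowth_of_le_deriv {C : ℝ} (hC0 : 0 ≤ C) (h : ∀ x, |b x| ≤ C * (1 + |deriv V x|)) :
    ModerateGrowth V b := by
  refine ⟨2 * C, 1, 0, by positivity, fun x => (h x).trans ?_⟩
  rw [pow_one, pow_zero, mul_one]
  nlinarith [sq_abs (deriv V x), sq_nonneg (|deriv V x| - 1), mul_nonneg hC0 (sq_nonneg (deriv V x)),
    mul_nonneg hC0 (sq_nonneg (|deriv V x| - 1))]

lemma moderateGrowth_deriv : ModerateGrowth V (deriv V) :=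
  moderateGrowth_of_le_deriv zero_le_one fun x => by linarith

end ModerateGrowth

/-- Densities that decay faster than any power of `x` and of `V'(x)`. -/
def RapidDecay (V r : ℝ → ℝ) : Prop :=
  ∀ k m : ℕ, ∃ C : ℝ, 0 ≤ C ∧ ∀ x, (1 + deriv V x ^ 2) ^ k * (1 + x ^ 2) ^ m * |r x| ≤ C

lemma RapidDecay.boundedFun_mul {V r b : ℝ → ℝ} (hr : RapidDecay V r) (hb : ModerateGrowth V b) :
    BoundedFun fun x => b x * r x := by
  obtain ⟨C, k, m, hC0, hC⟩ := hb
  obtain ⟨D, hD0, hD⟩ := hr k m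
  refine ⟨C * D, fun x => ?_⟩
  rw [abs_mul]
  calc |b x| * |r x| ≤ C * ((1 + deriv V x ^ 2) ^ k * (1 + x ^ 2) ^ m) * |r x| :=
        mul_le_mul_of_nonneg_right (hC x) (abs_nonneg _)
    _ = C * ((1 + deriv V x ^ 2) ^ k * (1 + x ^ 2) ^ m * |r x|) := by ring
    _ ≤ _ := mul_le_mul_of_nonneg_left (hD x) hC0

lemma RapidDecay.exists_le_pow {V r b : ℝ → ℝ} (hr : RapidDecay V r) (hb : ModerateGrowth V b)
    (n : ℕ) : ∃ C : ℝ, 0 ≤ C ∧ ∀ x, |b x * r x| ≤ C * ((1 + x ^ 2)⁻¹) ^ n := by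
  have h1 : ModerateGrowth V fun x => (1 + x ^ 2) ^ n :=
    ⟨1, 0, n, zero_le_one, fun x => by
      rw [abs_of_nonneg (by positivity), pow_zero, one_mul, one_mul]⟩
  obtain ⟨C, hC0, hC⟩ := (hr.boundedFun_mul (h1.mul hb)).exists_nonneg
  refine ⟨C, hC0, fun x => ?_⟩
  have h2 := hC x
  have h3 : 0 < (1 + x ^ 2) ^ n := by positivity
  rw [mul_assoc, abs_mul, abs_of_pos h3] at h2
  rw [inv_pow, ← div_eq_mul_inv, le_div_iff₀ h3]
  linarith

lemma RapidDecay.quadDecay_mul {V r b : ℝ → ℝ} (hr : RapidDecay V r) (hb : ModerateGrowth V b)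
    (hm : AEStronglyMeasurable (fun x => b x * r x) volume) : QuadDecay fun x => b x * r x := by
  obtain ⟨C, -, hC⟩ := hr.exists_le_pow hb 1
  exact ⟨hm, C, by simpa only [pow_one] using hC⟩

/-- A smooth version `r` of the equilibrium density, together with `a = -(log r)'` and the first
two derivatives of `a`. -/
structure SmoothEquilibrium (V : ℝ → ℝ) (P : ℝ) (r a a₁ a₂ : ℝ → ℝ) : Prop where
  pos : ∀ x, 0 < r x
  rapidDecay : RapidDecay V r
  holderHalf : HolderHalf r
  hasDerivAt : ∀ x, HasDerivAt r (-(a x * r x)) x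
  hasDerivAt_a : ∀ x, HasDerivAt a (a₁ x) x
  hasDerivAt_a₁ : ∀ x, HasDerivAt a₁ (a₂ x) x
  a_eq : ∀ x, a x = deriv V x + 2 * P * pvHilbert r x
  boundedFun_sub : BoundedFun fun x => a x - deriv V x
  a₁_le : ∃ C : ℝ, 0 ≤ C ∧ ∀ x, |a₁ x| ≤ C * (1 + |deriv V x|)
  a₂_le : ∃ C : ℝ, 0 ≤ C ∧ ∀ x, |a₂ x| ≤ C * (1 + |deriv V x|)

lemma le_deriv_add_bounded {V b c : ℝ → ℝ} {C : ℝ} (h : ∀ x, |b x| ≤ C * (1 + |deriv V x|))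
    (hc : BoundedFun c) : ∃ D : ℝ, 0 ≤ D ∧ ∀ x, |b x + c x| ≤ D * (1 + |deriv V x|) := by
  obtain ⟨B, hB0, hB⟩ := hc.exists_nonneg
  refine ⟨max C 0 + B, by positivity, fun x => (abs_add_le _ _).trans ?_⟩
  rw [add_mul]
  have h1 : 1 ≤ 1 + |deriv V x| := by linarith [abs_nonneg (deriv V x)]
  refine add_le_add ((h x).trans ?_) ((hB x).trans (le_mul_of_one_le_right hB0 h1))
  exact mul_le_mul_of_nonneg_right (le_max_left _ _) (by positivity)

lemma holderHalf_exp_of_le {V U r : ℝ → ℝ} {μ : Measure ℝ} (hV : PotentialAssumptions V μ)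
    {P c M : ℝ} (hP : 0 ≤ P) (hr : ∀ x, r x = exp (-V x + 2 * P * U x + c))
    (hU : HolderHalf U) (hM : ∀ x, U x ≤ log (1 + x ^ 2) / 2 + M) : HolderHalf r := by
  obtain ⟨n, hn⟩ := exists_nat_ge P
  set F : ℝ → ℝ := fun x => (1 + x ^ 2) ^ n * exp (-V x) with hF
  set G : ℝ → ℝ := fun x => 2 * P * U x - n * log (1 + x ^ 2) + c with hG
  have hrFG : r = fun x => F x * exp (G x) := by
    ext x
    have : (1 + x ^ 2) ^ n = exp (n * log (1 + x ^ 2)) := by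
      rw [mul_comm, Real.exp_mul, Real.exp_log (by positivity), Real.rpow_natCast]
    simp only [hF, hG]
    rw [hr, this, ← Real.exp_add, ← Real.exp_add]
    congr 1; ring
  have hGle : ∀ x, G x ≤ 2 * P * M + c := by
    intro x
    have h1 := mul_le_mul_of_nonneg_left (hM x) (by positivity : 0 ≤ 2 * P)
    have h2 : 0 ≤ log (1 + x ^ 2) := Real.log_nonneg (by linarith [sq_nonneg x])
    have h3 := mul_le_mul_of_nonneg_right hn h2
    simp only [hG]
    linarith
  have hGb : BoundedFun fun x => exp (G x) :=
    ⟨exp (2 * P * M + c), fun x => by rw [abs_exp]; exact exp_le_exp.2 (hGle x)⟩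
  have hld : ∀ x : ℝ, HasDerivAt (fun x => log (1 + x ^ 2)) (2 * x / (1 + x ^ 2)) x := by
    intro x
    have := ((hasDerivAt_pow 2 x).const_add 1).log (by positivity : 1 + x ^ 2 ≠ 0)
    simpa using this
  have hl1 : ∀ x : ℝ, |2 * x / (1 + x ^ 2)| ≤ 1 := by
    intro x
    rw [abs_div, abs_of_pos (by positivity : 0 < 1 + x ^ 2), div_le_one (by positivity), abs_mul,
      abs_two]
    nlinarith [sq_nonneg (1 - |x|), sq_abs x]
  obtain ⟨A, hA⟩ := hU
  have hGH : HolderHalf fun x => exp (G x) := by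
    refine holderHalf_of_local hGb (C := exp (2 * P * M + c) * (2 * P * A + n)) fun x y hxy => ?_
    refine (abs_exp_sub_exp_le (hGle x) (hGle y)).trans ?_
    rw [mul_assoc (exp _)]
    refine mul_le_mul_of_nonneg_left ?_ (exp_pos _).le
    have e : G x - G y = 2 * P * (U x - U y) - n * (log (1 + x ^ 2) - log (1 + y ^ 2)) := by
      simp only [hG]; ring
    have h1 := (abs_sub_le_of_deriv_bounded hld hl1 x y).trans
      ((one_mul _).le.trans (abs_le_sqrt_abs hxy))
    rw [e]
    refine (abs_sub _ _).trans ?_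
    rw [abs_mul (2 * P), abs_mul (n : ℝ), abs_of_nonneg (by positivity : 0 ≤ 2 * P), Nat.abs_cast]
    nlinarith [mul_le_mul_of_nonneg_left (hA x y) (by positivity : 0 ≤ 2 * P),
      mul_le_mul_of_nonneg_left h1 (by positivity : (0 : ℝ) ≤ n)]
  have hFd : ∀ x, HasDerivAt F (n * (1 + x ^ 2) ^ (n - 1) * (2 * x) * exp (-V x)
      + (1 + x ^ 2) ^ n * (exp (-V x) * -deriv V x)) x := by
    intro x
    have h1 := ((hasDerivAt_pow 2 x).const_add 1).pow n
    have h2 := (hV.hasDerivAt x).neg.exp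
    refine (h1.mul h2).congr_deriv ?_
    simp
  have hexp : RapidDecay V fun x => exp (-V x) := fun k m => by
    obtain ⟨C, hC0, hC⟩ := hV.weighted_exp_le k m
    exact ⟨C, hC0, fun x => by rw [abs_exp]; exact hC x⟩
  have hpow : ∀ j : ℕ, ModerateGrowth V fun x => (1 + x ^ 2) ^ j := fun j =>
    ⟨1, 0, j, zero_le_one, fun x => by
      rw [abs_of_nonneg (by positivity), pow_zero, one_mul, one_mul]⟩
  have hx : ModerateGrowth V fun x => 2 * x :=
    ⟨1, 0, 1, zero_le_one, fun x => by
      rw [abs_mul, abs_two, pow_zero, pow_one]; nlinarith [sq_nonneg (1 - |x|), sq_abs x]⟩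
  have hFb : BoundedFun F := hexp.boundedFun_mul (hpow n)
  have hFH : HolderHalf F := by
    refine holderHalf_of_deriv hFb hFd (BoundedFun.add ?_ ?_)
    · exact hexp.boundedFun_mul (((hpow (n - 1)).const_mul n).mul hx)
    · refine (hexp.boundedFun_mul ((hpow n).mul (moderateGrowth_deriv.const_mul (-1)))).mono
        fun x => le_of_eq ?_
      congr 1; ring
  rw [hrFG]
  exact hFH.mul hGH hFb hGb

lemma rapidDecay_exp_of_le {V U r : ℝ → ℝ} {μ : Measure ℝ} (hV : PotentialAssumptions V μ)
    {P c M : ℝ} (hP : 0 ≤ P) (hr : ∀ x, r x = exp (-V x + 2 * P * U x + c))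
    (hM : ∀ x, U x ≤ log (1 + x ^ 2) / 2 + M) : RapidDecay V r := by
  obtain ⟨n, hn⟩ := exists_nat_ge P
  intro k m
  obtain ⟨C, hC0, hC⟩ := hV.weighted_exp_le k (m + n)
  refine ⟨exp (2 * P * M + c) * C, by positivity, fun x => ?_⟩
  have h1 : r x ≤ exp (2 * P * M + c) * ((1 + x ^ 2) ^ n * exp (-V x)) := by
    have : (1 + x ^ 2) ^ n = exp (n * log (1 + x ^ 2)) := by
      rw [mul_comm, Real.exp_mul, Real.exp_log (by positivity), Real.rpow_natCast]
    rw [hr, this, ← Real.exp_add, ← Real.exp_add]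
    refine exp_le_exp.2 ?_
    have h1 := mul_le_mul_of_nonneg_left (hM x) (by positivity : 0 ≤ 2 * P)
    have h2 : 0 ≤ log (1 + x ^ 2) := Real.log_nonneg (by linarith [sq_nonneg x])
    have h3 := mul_le_mul_of_nonneg_right hn h2
    linarith
  rw [abs_of_pos (by rw [hr]; exact exp_pos _)]
  calc (1 + deriv V x ^ 2) ^ k * (1 + x ^ 2) ^ m * r x
      ≤ (1 + deriv V x ^ 2) ^ k * (1 + x ^ 2) ^ m *
        (exp (2 * P * M + c) * ((1 + x ^ 2) ^ n * exp (-V x))) :=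
        mul_le_mul_of_nonneg_left h1 (by positivity)
    _ = exp (2 * P * M + c) * ((1 + deriv V x ^ 2) ^ k * (1 + x ^ 2) ^ (m + n) * exp (-V x)) := by
        rw [pow_add]; ring
    _ ≤ _ := mul_le_mul_of_nonneg_left (hC x) (exp_pos _).le

theorem exists_smoothEquilibrium {V r : ℝ → ℝ} {μ : Measure ℝ} (hV : PotentialAssumptions V μ)
    {P c M : ℝ} (hP : 0 ≤ P) (hrm : AEStronglyMeasurable r volume)
    (hr : ∀ x, r x = exp (-V x + 2 * P * logPot r x + c))
    (hM : ∀ x, logPot r x ≤ log (1 + x ^ 2) / 2 + M) :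
    ∃ a a₁ a₂ : ℝ → ℝ, SmoothEquilibrium V P r a a₁ a₂ := by
  have hrd : RapidDecay V r := rapidDecay_exp_of_le hV hP hr hM
  have hone : ModerateGrowth V fun _ => (1 : ℝ) := (boundedFun_const 1).moderateGrowth
  have hq : QuadDecay r := by
    simpa only [one_mul] using hrd.quadDecay_mul hone (by simpa only [one_mul] using hrm)
  have hH : HolderHalf r := holderHalf_exp_of_le hV hP hr hq.holderHalf_logPot hM
  have hc := hH.continuous
  have hpos : ∀ x, 0 < r x := fun x => by rw [hr]; exact exp_pos _
  have hV1 := hV.continuous_deriv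
  have hV2 := hV.continuous_deriv2
  obtain ⟨K₂, hK₂0, hK₂⟩ := hV.exists_le_deriv hV2 hV.second_deriv
  obtain ⟨K₃, hK₃0, hK₃⟩ := hV.exists_le_deriv hV.continuous_deriv3 hV.third_deriv
  have mV1 : ModerateGrowth V (deriv V) := moderateGrowth_deriv
  have mV2 : ModerateGrowth V (iteratedDeriv 2 V) := moderateGrowth_of_le_deriv hK₂0 hK₂
  have mV3 : ModerateGrowth V (iteratedDeriv 3 V) := moderateGrowth_of_le_deriv hK₃0 hK₃
  -- first derivative
  set a : ℝ → ℝ := fun x => deriv V x + 2 * P * pvHilbert r x with ha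
  have hp1 : BoundedFun (pvHilbert r) := hq.boundedFun_pvHilbert hH
  have cp1 : Continuous (pvHilbert r) := hq.continuous_pvHilbert hH
  have ca : Continuous a := by fun_prop
  have ma : ModerateGrowth V a := mV1.add (hp1.const_mul (2 * P)).moderateGrowth
  have dr : ∀ x, HasDerivAt r (-(a x * r x)) x := by
    intro x
    have h1 := (((hV.hasDerivAt x).neg.add
      ((hq.hasDerivAt_logPot_pvHilbert hH x).const_mul (2 * P))).add_const c).exp
    have e : r = fun x => exp (-V x + 2 * P * logPot r x + c) := funext hr
    refine (h1.congr_of_eventuallyEq (.of_forall fun y => hr y)).congr_deriv ?_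
    simp only [Pi.add_apply, Pi.neg_apply]
    rw [← hr x, ha]; ring
  -- second derivative
  set r₁ : ℝ → ℝ := fun x => -(a x * r x) with hr₁
  have cr₁ : Continuous r₁ := by fun_prop
  have hq₁ : QuadDecay r₁ := by
    have := (hrd.quadDecay_mul ma (by fun_prop)).const_mul (-1)
    simpa only [neg_one_mul] using this
  have hL1 : ∀ x, pvHilbert r x = -logPot r₁ x := hq.pvHilbert_eq_neg_logPot hH hq₁ dr cr₁
  have hp1H : HolderHalf (pvHilbert r) := by
    have e : pvHilbert r = fun x => -1 * logPot r₁ x := by ext x; rw [hL1]; ring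
    rw [e]; exact hq₁.holderHalf_logPot.const_mul _
  have hV1r : ∀ {b b' : ℝ → ℝ}, ModerateGrowth V b → ModerateGrowth V b' →
      (∀ x, HasDerivAt b (b' x) x) → HolderHalf fun x => b x * r x := by
    intro b b' hb hb' hd
    refine holderHalf_of_deriv (hrd.boundedFun_mul hb) (fun x => (hd x).mul (dr x)) ?_
    refine (hrd.boundedFun_mul (hb'.sub (hb.mul ma))).mono fun x => le_of_eq ?_
    congr 1; ring
  have hH₁ : HolderHalf r₁ := by
    have h1 := (hV1r mV1 mV2 hV.hasDerivAt_deriv).add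
      ((hp1H.mul hH hp1 hq.boundedFun).const_mul (2 * P))
    have e : r₁ = fun x => -1 * (deriv V x * r x + 2 * P * (pvHilbert r x * r x)) := by
      ext x; simp only [hr₁, ha]; ring
    rw [e]; exact h1.const_mul _
  set a₁ : ℝ → ℝ := fun x => iteratedDeriv 2 V x + 2 * P * pvHilbert r₁ x with ha₁
  have hp2 : BoundedFun (pvHilbert r₁) := hq₁.boundedFun_pvHilbert hH₁
  have cp2 : Continuous (pvHilbert r₁) := hq₁.continuous_pvHilbert hH₁
  have ca₁ : Continuous a₁ := by fun_prop
  have ma₁ : ModerateGrowth V a₁ := mV2.add (hp2.const_mul (2 * P)).moderateGrowth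
  have dp1 : ∀ x, HasDerivAt (pvHilbert r) (pvHilbert r₁ x) x := by
    intro x
    have h1 := (hq₁.hasDerivAt_logPot_pvHilbert hH₁ x).neg
    rw [neg_neg] at h1
    exact h1.congr_of_eventuallyEq (.of_forall fun y => hL1 y)
  have da : ∀ x, HasDerivAt a (a₁ x) x := fun x =>
    (hV.hasDerivAt_deriv x).add ((dp1 x).const_mul (2 * P))
  -- third derivative
  set r₂ : ℝ → ℝ := fun x => (a x * a x - a₁ x) * r x with hr₂
  have cr₂ : Continuous r₂ := by fun_prop
  have dr₁ : ∀ x, HasDerivAt r₁ (r₂ x) x := by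
    intro x
    refine ((da x).mul (dr x)).neg.congr_deriv ?_
    simp only [hr₂]; ring
  have hq₂ : QuadDecay r₂ := hrd.quadDecay_mul ((ma.mul ma).sub ma₁) cr₂.aestronglyMeasurable
  have hL2 : ∀ x, pvHilbert r₁ x = -logPot r₂ x := hq₁.pvHilbert_eq_neg_logPot hH₁ hq₂ dr₁ cr₂
  have hp2H : HolderHalf (pvHilbert r₁) := by
    have e : pvHilbert r₁ = fun x => -1 * logPot r₂ x := by ext x; rw [hL2]; ring
    rw [e]; exact hq₂.holderHalf_logPot.const_mul _
  have hH₂ : HolderHalf r₂ := by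
    have h1 := (hV1r ((ma.mul ma).sub mV2) (((ma₁.mul ma).add (ma.mul ma₁)).sub mV3)
      (fun x => ((da x).mul (da x)).sub (hV.hasDerivAt_deriv2 x))).add
      ((hp2H.mul hH hp2 hq.boundedFun).const_mul (-(2 * P)))
    have e : r₂ = fun x => (a x * a x - iteratedDeriv 2 V x) * r x
        + -(2 * P) * (pvHilbert r₁ x * r x) := by
      ext x; simp only [hr₂, ha₁]; ring
    rw [e]; exact h1
  set a₂ : ℝ → ℝ := fun x => iteratedDeriv 3 V x + 2 * P * pvHilbert r₂ x with ha₂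
  have hp3 : BoundedFun (pvHilbert r₂) := hq₂.boundedFun_pvHilbert hH₂
  have dp2 : ∀ x, HasDerivAt (pvHilbert r₁) (pvHilbert r₂ x) x := by
    intro x
    have h1 := (hq₂.hasDerivAt_logPot_pvHilbert hH₂ x).neg
    rw [neg_neg] at h1
    exact h1.congr_of_eventuallyEq (.of_forall fun y => hL2 y)
  exact ⟨a, a₁, a₂,
    { pos := hpos
      rapidDecay := hrd
      holderHalf := hH
      hasDerivAt := dr
      hasDerivAt_a := da
      hasDerivAt_a₁ := fun x => (hV.hasDerivAt_deriv2 x).add ((dp2 x).const_mul (2 * P))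
      a_eq := fun _ => rfl
      boundedFun_sub := (hp1.const_mul (2 * P)).mono fun x => le_of_eq (by simp only [ha]; ring_nf)
      a₁_le := le_deriv_add_bounded hK₂ (hp2.const_mul (2 * P))
      a₂_le := le_deriv_add_bounded hK₃ (hp3.const_mul (2 * P)) }⟩

/-! ### Solution of the integral equation in `L²(μ)` -/

/-- If `T` is dissipative on the orthogonal complement of the unit vector `e`, then `w = y + c T w`
is solvable modulo `e` for `y` orthogonal to `e`. -/
lemma exists_solution_of_dissipative {E : Type*} [NormedAddCommGroup E] [InnerProductSpace ℝ E]
    [CompleteSpace E] (T : E →L[ℝ] E) {e : E} (he : ‖e‖ = 1) {c : ℝ} (hc : 0 ≤ c)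
    (hT : ∀ z : E, inner ℝ e z = 0 → inner ℝ (T z) z ≤ 0) {y : E} (hy : inner ℝ e y = 0) :
    ∃ (w : E) (k : ℝ), inner ℝ e w = 0 ∧ w = y + c • T w + k • e := by
  have hee : inner ℝ e e = 1 := by rw [real_inner_self_eq_norm_sq, he]; norm_num
  set Q : E →L[ℝ] E := ContinuousLinearMap.id ℝ E - (innerSL ℝ e).smulRight e with hQ
  have hQv : ∀ v, Q v = v - inner ℝ e v • e := fun v => by simp [hQ]
  have hQe : ∀ v, inner ℝ e (Q v) = 0 := fun v => by
    rw [hQv, inner_sub_right, inner_smul_right, hee]; ring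
  have hQs : ∀ u v, inner ℝ (Q u) v = inner ℝ u (Q v) := fun u v => by
    rw [hQv, hQv, inner_sub_left, inner_sub_right, inner_smul_left, inner_smul_right,
      real_inner_comm e u]
    simp; ring
  set S : E →L[ℝ] E := ContinuousLinearMap.id ℝ E - c • (Q.comp (T.comp Q)) with hS
  have hSv : ∀ v, S v = v - c • Q (T (Q v)) := fun v => by simp [hS]
  have hunit : IsUnit S := by
    refine ContinuousLinearMap.isUnit_of_forall_le_norm_inner_map S (c := 1) one_pos fun v => ?_
    have h1 : inner ℝ (S v) v = ‖v‖ ^ 2 - c * inner ℝ (T (Q v)) (Q v) := by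
      rw [hSv, inner_sub_left, real_inner_self_eq_norm_sq, inner_smul_left, hQs]
      simp
    have h2 := mul_nonpos_of_nonneg_of_nonpos hc (hT (Q v) (hQe v))
    rw [h1, NNReal.coe_one, mul_one]
    exact (by linarith : ‖v‖ ^ 2 ≤ _).trans (le_abs_self _)
  obtain ⟨w, hw⟩ := (ContinuousLinearMap.isUnit_iff_bijective.1 hunit).2 y
  rw [hSv] at hw
  have hew : inner ℝ e w = 0 := by
    have := congrArg (inner ℝ e) hw
    rw [inner_sub_right, inner_smul_right, hQe, hy] at this
    linarith
  have hQw : Q w = w := by rw [hQv, hew]; simp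
  refine ⟨w, -(c * inner ℝ e (T w)), hew, ?_⟩
  rw [hQw, hQv (T w), sub_eq_iff_eq_add] at hw
  nth_rewrite 1 [hw]
  rw [smul_sub, smul_smul, neg_smul]
  abel

lemma integral_abs_mul_abs_le {α : Type*} [MeasurableSpace α] {μ : Measure α} {f g : α → ℝ}
    (hf : MemLp f 2 μ) (hg : MemLp g 2 μ) :
    ∫ x, |f x| * |g x| ∂μ ≤ √(∫ x, f x ^ 2 ∂μ) * √(∫ x, g x ^ 2 ∂μ) := by
  have := integral_mul_norm_le_Lp_mul_Lq (μ := μ) (f := f) (g := g) Real.HolderConjugate.two_two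
    (by simpa using hf) (by simpa using hg)
  simpa [Real.sqrt_eq_rpow] using this

section kernel

variable {r : ℝ → ℝ}

/-- `r` is a bounded probability density with second moments. -/
structure IsTameDensity (r : ℝ → ℝ) : Prop extends IsProbDensity r where
  quadDecay : QuadDecay r
  moment : Integrable fun x => (1 + |x|) ^ 2 * r x

lemma IsTameDensity.memLp_weight (hr : IsTameDensity r) :
    MemLp (fun x : ℝ => 1 + |x|) 2 (ofDensity r) := by
  rw [memLp_two_iff_integrable_sq (by fun_prop), integrable_ofDensity_iff hr.measurable hr.nonneg]
  exact hr.moment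

lemma IsTameDensity.memLp_log (hr : IsTameDensity r) :
    ∃ A : ℝ, 0 ≤ A ∧ ∀ x, MemLp (fun y => log (x - y)) 2 (ofDensity r) ∧
      √(∫ y, log (x - y) ^ 2 ∂(ofDensity r)) ≤ A * (1 + |x|) := by
  obtain ⟨A, hA0, hA⟩ := hr.quadDecay.integral_sqrt
  obtain ⟨B, hB0, hB⟩ := hr.quadDecay.integral_inv_sqrt
  refine ⟨√(16 * (A + B)), by positivity, fun x => ?_⟩
  have hle : ∀ y, log (x - y) ^ 2 * r y ≤ 16 * (√|x - y| * |r y| + (√|x - y|)⁻¹ * |r y|) := by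
    intro y
    have := mul_le_mul_of_nonneg_right (log_sq_le_sqrt (x - y)) (hr.nonneg y)
    rw [abs_of_nonneg (hr.nonneg y)]
    linarith
  have hdom : Integrable fun y => 16 * (√|x - y| * |r y| + (√|x - y|)⁻¹ * |r y|) :=
    ((hA x).1.add (hB x).1).const_mul 16
  have hint : Integrable fun y => log (x - y) ^ 2 * r y := by
    refine hdom.mono' ?_ (.of_forall fun y => ?_)
    · have := hr.measurable
      exact (by fun_prop : Measurable fun y => log (x - y) ^ 2 * r y).aestronglyMeasurable
    · rw [Real.norm_of_nonneg (mul_nonneg (sq_nonneg _) (hr.nonneg y))]; exact hle y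
  constructor
  · rw [memLp_two_iff_integrable_sq (by fun_prop : Measurable fun y =>
      log (x - y)).aestronglyMeasurable, integrable_ofDensity_iff hr.measurable hr.nonneg]
    exact hint
  · rw [integral_ofDensity hr.measurable hr.nonneg]
    have h1 := integral_mono hint hdom hle
    rw [integral_const_mul, integral_add (hA x).1 (hB x).1] at h1
    have hx : 1 ≤ 1 + |x| := by linarith [abs_nonneg x]
    have hs : √(1 + |x|) ≤ 1 + |x| := Real.sqrt_le_iff.2 ⟨by positivity, by nlinarith⟩
    rw [Real.sqrt_le_left (by positivity), mul_pow, Real.sq_sqrt (by positivity)]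
    have h2 : A * √(1 + |x|) ≤ A * (1 + |x|) ^ 2 :=
      mul_le_mul_of_nonneg_left (hs.trans (by nlinarith)) hA0
    have h3 : B ≤ B * (1 + |x|) ^ 2 := le_mul_of_one_le_right hB0 (one_le_pow₀ hx)
    linarith [(hA x).2, (hB x).2]

lemma IsTameDensity.logPot_mul_eq (hr : IsTameDensity r) (v : ℝ → ℝ) (x : ℝ) :
    logPot (fun y => v y * r y) x = ∫ y, log (x - y) * v y ∂(ofDensity r) := by
  rw [integral_ofDensity hr.measurable hr.nonneg, logPot]
  congr 1; ext y; ring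

lemma IsTameDensity.exists_logPot_le (hr : IsTameDensity r) :
    ∃ A : ℝ, 0 ≤ A ∧ ∀ v, MemLp v 2 (ofDensity r) → ∀ x,
      Integrable (fun y => log (x - y) * v y) (ofDensity r) ∧
      ∫ y, |log (x - y)| * |v y| ∂(ofDensity r) ≤ √(∫ y, v y ^ 2 ∂(ofDensity r)) * (A * (1 + |x|)) ∧
      |logPot (fun y => v y * r y) x| ≤ √(∫ y, v y ^ 2 ∂(ofDensity r)) * (A * (1 + |x|)) := by
  obtain ⟨A, hA0, hA⟩ := hr.memLp_log
  refine ⟨A, hA0, fun v hv x => ?_⟩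
  have h1 : ∫ y, |log (x - y)| * |v y| ∂(ofDensity r)
      ≤ √(∫ y, v y ^ 2 ∂(ofDensity r)) * (A * (1 + |x|)) := by
    refine (integral_abs_mul_abs_le (hA x).1 hv).trans ?_
    rw [mul_comm]
    exact mul_le_mul_of_nonneg_left (hA x).2 (Real.sqrt_nonneg _)
  refine ⟨(hA x).1.integrable_mul hv, h1, le_trans ?_ h1⟩
  rw [hr.logPot_mul_eq, ← Real.norm_eq_abs]
  refine (norm_integral_le_integral_norm _).trans (le_of_eq ?_)
  simp only [norm_mul, Real.norm_eq_abs]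

lemma IsTameDensity.aestronglyMeasurable_mul (hr : IsTameDensity r) {v : ℝ → ℝ}
    (hv : MemLp v 2 (ofDensity r)) : AEStronglyMeasurable (fun x => v x * r x) volume := by
  have := isProbabilityMeasure_ofDensity hr.toIsProbDensity
  exact ((integrable_ofDensity_iff hr.measurable hr.nonneg).1
    (hv.integrable one_le_two)).aestronglyMeasurable

lemma IsTameDensity.aestronglyMeasurable_logPot (hr : IsTameDensity r) {v : ℝ → ℝ}
    (hv : MemLp v 2 (ofDensity r)) :
    AEStronglyMeasurable (logPot fun x => v x * r x) volume := by
  have h1 : AEStronglyMeasurable (fun p : ℝ × ℝ => log (p.1 - p.2) * (v p.2 * r p.2))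
      ((volume : Measure ℝ).prod volume) :=
    (by fun_prop : Measurable fun p : ℝ × ℝ => log (p.1 - p.2)).aestronglyMeasurable.mul
      (hr.aestronglyMeasurable_mul hv).comp_snd
  exact h1.integral_prod_right'

lemma ofDensity_absolutelyContinuous (r : ℝ → ℝ) : ofDensity r ≪ volume :=
  withDensity_absolutelyContinuous _ _

lemma IsTameDensity.memLp_logPot (hr : IsTameDensity r) {v : ℝ → ℝ}
    (hv : MemLp v 2 (ofDensity r)) : MemLp (logPot fun x => v x * r x) 2 (ofDensity r) := by
  obtain ⟨A, hA0, hA⟩ := hr.exists_logPot_le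
  refine (hr.memLp_weight.const_mul (√(∫ y, v y ^ 2 ∂(ofDensity r)) * A)).mono
    ((hr.aestronglyMeasurable_logPot hv).mono_ac (ofDensity_absolutelyContinuous r))
    (.of_forall fun x => ?_)
  rw [Real.norm_eq_abs, Real.norm_of_nonneg (by positivity), mul_assoc]
  exact (hA v hv x).2.2

lemma IsTameDensity.logIntegrable (hr : IsTameDensity r) {v : ℝ → ℝ}
    (hv : MemLp v 2 (ofDensity r)) :
    Integrable (fun x => (1 + |x|) * (v x * r x)) ∧
      LogIntegrable (fun x => v x * r x) (fun x => v x * r x) := by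
  obtain ⟨A, hA0, hA⟩ := hr.exists_logPot_le
  have hvm := hr.aestronglyMeasurable_mul hv
  have h1 : Integrable fun x => (1 + |x|) * (v x * r x) := by
    have := (integrable_ofDensity_iff hr.measurable hr.nonneg).1 (hr.memLp_weight.integrable_mul hv)
    refine this.congr (.of_forall fun x => ?_)
    simp only [Pi.mul_apply]; ring
  refine ⟨h1, ?_⟩
  have hm : AEStronglyMeasurable (fun p : ℝ × ℝ => log (p.1 - p.2) *
      ((v p.1 * r p.1) * (v p.2 * r p.2))) ((volume : Measure ℝ).prod volume) :=
    (by fun_prop : Measurable fun p : ℝ × ℝ => log (p.1 - p.2)).aestronglyMeasurable.mul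
      (hvm.comp_fst.mul hvm.comp_snd)
  rw [LogIntegrable, Measure.volume_eq_prod, integrable_prod_iff hm]
  refine ⟨.of_forall fun x => ?_, ?_⟩
  · have := (integrable_ofDensity_iff hr.measurable hr.nonneg).1 (hA v hv x).1
    refine (this.const_mul (v x * r x)).congr (.of_forall fun y => ?_)
    simp only; ring
  · refine (h1.norm.const_mul (√(∫ y, v y ^ 2 ∂(ofDensity r)) * A)).mono'
      hm.norm.integral_prod_right' (.of_forall fun x => ?_)
    have e : ∫ y, ‖log (x - y) * ((v x * r x) * (v y * r y))‖
        = |v x * r x| * ∫ y, |log (x - y)| * |v y| ∂(ofDensity r) := by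
      rw [integral_ofDensity hr.measurable hr.nonneg, ← integral_const_mul]
      congr 1; ext y
      simp only [norm_mul, Real.norm_eq_abs, abs_mul, abs_of_nonneg (hr.nonneg y)]; ring
    simp only
    rw [e, Real.norm_of_nonneg (mul_nonneg (abs_nonneg _) (integral_nonneg fun _ => by positivity)),
      norm_mul, Real.norm_of_nonneg (by positivity : 0 ≤ 1 + |x|), Real.norm_eq_abs]
    nlinarith [mul_le_mul_of_nonneg_left (hA v hv x).2.1 (abs_nonneg (v x * r x))]

/-- The logarithmic potential is dissipative on functions of mean zero. -/
lemma IsTameDensity.integral_logPot_mul_nonpos (hr : IsTameDensity r) {v : ℝ → ℝ}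
    (hv : MemLp v 2 (ofDensity r)) (h0 : ∫ x, v x * r x = 0) :
    ∫ x, (v x * r x) * logPot (fun x => v x * r x) x ≤ 0 := by
  obtain ⟨h1, h2⟩ := hr.logIntegrable hv
  rw [← h2.integrable_mul_logPot.2]
  exact integral_log_energy_nonpos h1 h0 h2

/-- The operator `v ↦ ∫ log |x - y| v(y) dμ(y)` on `L²(μ)`. -/
def IsTameDensity.logOperator (hr : IsTameDensity r) :
    Lp ℝ 2 (ofDensity r) →L[ℝ] Lp ℝ 2 (ofDensity r) :=
  LinearMap.mkContinuousOfExistsBound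
    { toFun := fun v => (hr.memLp_logPot (Lp.memLp v)).toLp _
      map_add' := fun u v => by
        obtain ⟨A, -, hA⟩ := hr.exists_logPot_le
        rw [← MemLp.toLp_add]
        refine MemLp.toLp_congr _ _ (.of_forall fun x => ?_)
        simp only [Pi.add_apply, hr.logPot_mul_eq]
        rw [← integral_add (hA u (Lp.memLp u) x).1 (hA v (Lp.memLp v) x).1]
        refine integral_congr_ae ?_
        filter_upwards [Lp.coeFn_add u v] with y hy
        rw [hy, Pi.add_apply, mul_add]
      map_smul' := fun c v => by
        rw [RingHom.id_apply, ← MemLp.toLp_const_smul]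
        refine MemLp.toLp_congr _ _ (.of_forall fun x => ?_)
        simp only [Pi.smul_apply, hr.logPot_mul_eq, smul_eq_mul]
        rw [← integral_const_mul]
        refine integral_congr_ae ?_
        filter_upwards [Lp.coeFn_smul c v] with y hy
        rw [hy, Pi.smul_apply, smul_eq_mul]; ring }
    (by
      obtain ⟨A, hA0, hA⟩ := hr.exists_logPot_le
      refine ⟨A * ‖hr.memLp_weight.toLp _‖, fun v => ?_⟩
      have hn : √(∫ y, v y ^ 2 ∂(ofDensity r)) = ‖v‖ := by
        rw [Real.sqrt_eq_iff_mul_self_eq (integral_nonneg fun _ => sq_nonneg _) (norm_nonneg _),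
          ← real_inner_self_eq_norm_mul_norm, L2.inner_def]
        simp [sq]
      have : ‖(hr.memLp_logPot (Lp.memLp v)).toLp _‖ ≤ (‖v‖ * A) * ‖hr.memLp_weight.toLp _‖ := by
        refine Lp.norm_le_mul_norm_of_ae_le_mul ?_
        filter_upwards [(hr.memLp_logPot (Lp.memLp v)).coeFn_toLp, hr.memLp_weight.coeFn_toLp]
          with x h1 h2
        rw [h1, h2, Real.norm_eq_abs, Real.norm_of_nonneg (by positivity : 0 ≤ 1 + |x|), mul_assoc,
          ← hn]
        exact (hA v (Lp.memLp v) x).2.2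
      refine this.trans (le_of_eq (by ring)))

lemma IsTameDensity.coeFn_logOperator (hr : IsTameDensity r) (v : Lp ℝ 2 (ofDensity r)) :
    hr.logOperator v =ᵐ[ofDensity r] logPot fun x => v x * r x :=
  (hr.memLp_logPot (Lp.memLp v)).coeFn_toLp

/-- The equation `w = f + c + 2P ∫ log |x - y| w(y) dμ(y)` has a solution of mean zero. -/
theorem IsTameDensity.exists_solution (hr : IsTameDensity r) (hpos : ∀ x, 0 < r x) {P : ℝ}
    (hP : 0 ≤ P) {f : ℝ → ℝ} (hf : MemLp f 2 (ofDensity r)) (hf0 : ∫ x, f x * r x = 0) :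
    ∃ (w : ℝ → ℝ) (c A : ℝ), MemLp w 2 (ofDensity r) ∧ ∫ x, w x * r x = 0 ∧
      (∀ x, w x = f x + c + 2 * P * logPot (fun y => w y * r y) x) ∧
      ∀ x, |logPot (fun y => w y * r y) x| ≤ A * (1 + |x|) := by
  have hprob := isProbabilityMeasure_ofDensity hr.toIsProbDensity
  have h1 : MemLp (fun _ : ℝ => (1 : ℝ)) 2 (ofDensity r) := memLp_const 1
  have hinner : ∀ v : Lp ℝ 2 (ofDensity r), inner ℝ (h1.toLp _) v = ∫ x, v x * r x := by
    intro v
    rw [L2.inner_def, ← integral_ofDensity hr.measurable hr.nonneg]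
    refine integral_congr_ae ?_
    filter_upwards [h1.coeFn_toLp] with x hx
    rw [hx]; simp
  have he : ‖h1.toLp _‖ = 1 := by
    have h2 := hinner (h1.toLp _)
    rw [real_inner_self_eq_norm_sq, ← integral_ofDensity hr.measurable hr.nonneg,
      integral_congr_ae h1.coeFn_toLp] at h2
    simp only [integral_const, probReal_univ, smul_eq_mul, mul_one] at h2
    nlinarith [norm_nonneg (h1.toLp fun _ => (1 : ℝ))]
  have hT : ∀ z : Lp ℝ 2 (ofDensity r), inner ℝ (h1.toLp _) z = 0 →
      inner ℝ (hr.logOperator z) z ≤ 0 := by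
    intro z hz
    rw [hinner] at hz
    refine le_trans (le_of_eq ?_) (hr.integral_logPot_mul_nonpos (Lp.memLp z) hz)
    have e : ∀ x, z x * r x * logPot (fun x => z x * r x) x
        = (z x * logPot (fun x => z x * r x) x) * r x := fun x => by ring
    simp_rw [e]
    rw [L2.inner_def, ← integral_ofDensity hr.measurable hr.nonneg
      (fun x => z x * logPot (fun x => z x * r x) x)]
    refine integral_congr_ae ?_
    filter_upwards [hr.coeFn_logOperator z] with x hx
    rw [hx]; simp
  have hy : inner ℝ (h1.toLp _) (hf.toLp f) = 0 := by
    rw [hinner, ← integral_ofDensity hr.measurable hr.nonneg, integral_congr_ae hf.coeFn_toLp,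
      integral_ofDensity hr.measurable hr.nonneg, hf0]
  obtain ⟨z, c, hz0, hz⟩ := exists_solution_of_dissipative hr.logOperator he
    (by positivity : 0 ≤ 2 * P) hT hy
  rw [hinner] at hz0
  set w : ℝ → ℝ := fun x => f x + c + 2 * P * logPot (fun y => z y * r y) x with hw
  have hzw : z =ᵐ[ofDensity r] w := by
    have e1 : (z : ℝ → ℝ) =ᵐ[ofDensity r]
        (hf.toLp f + (2 * P) • hr.logOperator z + c • h1.toLp _ : Lp ℝ 2 (ofDensity r)) := by
      rw [← hz]
    filter_upwards [e1, Lp.coeFn_add (hf.toLp f + (2 * P) • hr.logOperator z) (c • h1.toLp _),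
      Lp.coeFn_add (hf.toLp f) ((2 * P) • hr.logOperator z),
      Lp.coeFn_smul (2 * P) (hr.logOperator z), Lp.coeFn_smul c (h1.toLp _), h1.coeFn_toLp,
      hf.coeFn_toLp, hr.coeFn_logOperator z] with x a1 a2 a3 a4 a5 a6 a7 a8
    rw [a1, a2, Pi.add_apply, a3, Pi.add_apply, a4, a5, Pi.smul_apply, Pi.smul_apply, a6, a7, a8]
    simp only [hw, smul_eq_mul]; ring
  have hzw' : (fun x => z x * r x) =ᵐ[volume] fun x => w x * r x := by
    have hac : (volume : Measure ℝ) ≪ ofDensity r :=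
      withDensity_absolutelyContinuous' (by have := hr.measurable; fun_prop)
        (.of_forall fun x => by simpa using hpos x)
    filter_upwards [hac.ae_eq hzw] with x hx
    rw [hx]
  have hpot := logPot_congr_ae hzw'
  obtain ⟨A, hA0, hA⟩ := hr.exists_logPot_le
  refine ⟨w, c, √(∫ y, z y ^ 2 ∂(ofDensity r)) * A, (memLp_congr_ae hzw).1 (Lp.memLp z), ?_,
    fun x => ?_, fun x => ?_⟩
  · rw [← integral_congr_ae hzw', hz0]
  · rw [← hpot]
  · rw [← hpot, mul_assoc]
    exact (hA z (Lp.memLp z) x).2.2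

/-- Uniqueness for the homogeneous equation. -/
lemma IsTameDensity.eq_zero_of_homogeneous (hr : IsTameDensity r) (hpos : ∀ x, 0 < r x) {P : ℝ}
    (hP : 0 ≤ P) {w : ℝ → ℝ} {c : ℝ} (hw : MemLp w 2 (ofDensity r)) (hwc : Continuous w)
    (hrc : Continuous r) (hw0 : ∫ x, w x * r x = 0)
    (heq : ∀ x, w x = c + 2 * P * logPot (fun y => w y * r y) x) : ∀ x, w x = 0 := by
  have hprob := isProbabilityMeasure_ofDensity hr.toIsProbDensity
  have hi : Integrable fun x => w x * r x :=
    (integrable_ofDensity_iff hr.measurable hr.nonneg).1 (hw.integrable one_le_two)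
  have hi2 := (hr.logIntegrable hw).2.integrable_mul_logPot.1
  have hsq : Integrable fun x => w x ^ 2 * r x :=
    (integrable_ofDensity_iff hr.measurable hr.nonneg).1 hw.integrable_sq
  have h1 : ∫ x, w x ^ 2 * r x ≤ 0 := by
    have e : ∀ x, w x ^ 2 * r x = c * (w x * r x)
        + 2 * P * ((w x * r x) * logPot (fun y => w y * r y) x) := by
      intro x
      rw [sq]
      nth_rewrite 1 [heq x]
      ring
    simp_rw [e]
    rw [integral_add (hi.const_mul c) (hi2.const_mul (2 * P)), integral_const_mul,
      integral_const_mul, hw0, mul_zero, zero_add]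
    exact mul_nonpos_of_nonneg_of_nonpos (by positivity) (hr.integral_logPot_mul_nonpos hw hw0)
  have h2 : ∀ x, 0 ≤ w x ^ 2 * r x := fun x => mul_nonneg (sq_nonneg _) (hr.nonneg x)
  have h3 : ∫ x, w x ^ 2 * r x = 0 := le_antisymm h1 (integral_nonneg h2)
  rw [integral_eq_zero_iff_of_nonneg h2 hsq] at h3
  have h4 := Continuous.ae_eq_iff_eq volume (by fun_prop : Continuous fun x => w x ^ 2 * r x)
    continuous_const |>.1 h3
  intro x
  have h5 : w x ^ 2 * r x = 0 := congrFun h4 x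
  simpa using (mul_eq_zero.1 h5).resolve_right (hpos x).ne'

end kernel

/-! ### Decay estimates for first order linear equations -/

lemma eventually_mul_le_of_ode_atTop {r a b b' ψ s : ℝ → ℝ} (hr0 : ∀ x, 0 < r x)
    (hr : ∀ x, HasDerivAt r (-(a x * r x)) x) (hb : ∀ x, HasDerivAt b (b' x) x)
    (hψ : ∀ x, HasDerivAt ψ (a x * ψ x + s x) x) (hs : BoundedFun s)
    (hab : BoundedFun fun x => a x - b x) {K : ℝ} (hb' : ∀ x, |b' x| ≤ K * (1 + |b x|))
    (hbt : Tendsto b atTop atTop) (hrt : Tendsto r atTop (𝓝 0))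
    (hψr : Tendsto (fun x => ψ x * r x) atTop (𝓝 0)) :
    ∃ D : ℝ, ∀ᶠ x in atTop, |ψ x| * (1 + |b x|) ≤ D := by
  obtain ⟨B, hB0, hB⟩ := hs.exists_nonneg
  obtain ⟨C, hC0, hC⟩ := hab.exists_nonneg
  obtain ⟨x₀, hx₀⟩ := eventually_atTop.1
    (hbt.eventually_ge_atTop (max 1 (max (4 * C) (8 * K))))
  have h1 : ∀ x, x₀ ≤ x → 1 ≤ b x := fun x hx => (le_max_left _ _).trans (hx₀ x hx)
  have h2 : ∀ x, x₀ ≤ x → 4 * C ≤ b x := fun x hx =>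
    (le_max_left _ _).trans ((le_max_right _ _).trans (hx₀ x hx))
  have h3 : ∀ x, x₀ ≤ x → 8 * K ≤ b x := fun x hx =>
    (le_max_right _ _).trans ((le_max_right _ _).trans (hx₀ x hx))
  have key : ∀ {ψ s : ℝ → ℝ}, (∀ x, HasDerivAt ψ (a x * ψ x + s x) x) → (∀ x, |s x| ≤ B) →
      Tendsto (fun x => ψ x * r x) atTop (𝓝 0) → ∀ x, x₀ ≤ x → ψ x ≤ 2 * B / b x := by
    intro ψ s hψ hB hψr
    set Y : ℝ → ℝ := fun x => (ψ x - 2 * B / b x) * r x with hY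
    have hζ : ∀ x, x₀ ≤ x → HasDerivAt (fun x => 2 * B / b x) (-(2 * B * b' x) / b x ^ 2) x := by
      intro x hx
      have hne : b x ≠ 0 := by linarith [h1 x hx]
      exact ((hasDerivAt_const x (2 * B)).div (hb x) hne).congr_deriv (by simp)
    have hYd : ∀ x, x₀ ≤ x → HasDerivAt Y ((s x + 2 * B * (a x / b x) + 2 * B * (b' x / b x ^ 2))
        * r x) x := by
      intro x hx
      refine (((hψ x).sub (hζ x hx)).mul (hr x)).congr_deriv ?_
      simp only [Pi.sub_apply]; ring
    have hYnn : ∀ x, x₀ ≤ x → 0 ≤ (s x + 2 * B * (a x / b x) + 2 * B * (b' x / b x ^ 2)) * r x := by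
      intro x hx
      have b1 := h1 x hx
      have e1 : 3 / 4 ≤ a x / b x := by
        rw [le_div_iff₀ (by linarith)]
        have := (abs_le.1 (hC x)).1
        linarith [h2 x hx]
      have e2 : -(1 / 4) ≤ b' x / b x ^ 2 := by
        rw [le_div_iff₀ (by positivity)]
        have := (abs_le.1 (hb' x)).1
        rw [abs_of_pos (by linarith : 0 < b x)] at this
        have h3' := h3 x hx
        rcases le_total 0 K with hK | hK
        · nlinarith
        · nlinarith
      have e3 := (abs_le.1 (hB x)).1
      refine mul_nonneg ?_ (hr0 x).le
      nlinarith [mul_le_mul_of_nonneg_left e1 hB0, mul_le_mul_of_nonneg_left e2 hB0]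
    have hmono : MonotoneOn Y (Ici x₀) := by
      refine monotoneOn_of_deriv_nonneg (convex_Ici x₀)
        (fun x hx => (hYd x hx).continuousAt.continuousWithinAt)
        (fun x hx => (hYd x (interior_subset hx)).differentiableAt.differentiableWithinAt)
        fun x hx => ?_
      rw [(hYd x (interior_subset hx)).deriv]
      exact hYnn x (interior_subset hx)
    have hYt : Tendsto Y atTop (𝓝 0) := by
      have t1 : Tendsto (fun x => 2 * B / b x * r x) atTop (𝓝 (0 * 0)) :=
        (hbt.const_div_atTop (2 * B)).mul hrt
      have := hψr.sub t1
      rw [mul_zero, sub_zero] at this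
      refine this.congr fun x => ?_
      simp only [hY]; ring
    intro x hx
    have hle : Y x ≤ 0 := by
      refine ge_of_tendsto hYt ?_
      filter_upwards [eventually_ge_atTop x] with z hz
      exact hmono hx (hx.trans hz) hz
    by_contra! hcon
    have : 0 < Y x := mul_pos (by linarith) (hr0 x)
    linarith
  refine ⟨4 * B, ?_⟩
  filter_upwards [eventually_ge_atTop x₀] with x hx
  have b1 := h1 x hx
  have u1 := key hψ hB hψr x hx
  have u2 := key (ψ := fun x => -ψ x) (s := fun x => -s x)
    (fun x => (hψ x).neg.congr_deriv (by ring)) (fun x => by rw [abs_neg]; exact hB x)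
    (by simpa using hψr.neg) x hx
  have u3 : |ψ x| ≤ 2 * B / b x := abs_le.2 ⟨by linarith, u1⟩
  rw [abs_of_pos (by linarith : 0 < b x)]
  calc |ψ x| * (1 + b x) ≤ 2 * B / b x * (2 * b x) :=
        mul_le_mul u3 (by linarith) (by linarith) (by positivity)
    _ = 4 * B := by field_simp; ring

lemma QuadDecay.tendsto_zero {h : ℝ → ℝ} (hh : QuadDecay h) :
    Tendsto h (cocompact ℝ) (𝓝 0) := by
  obtain ⟨C, hC⟩ := hh.bound
  have h1 : Tendsto (fun x : ℝ => 1 + ‖x‖ ^ 2) (cocompact ℝ) atTop :=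
    tendsto_atTop_add_const_left _ _
      ((tendsto_pow_atTop two_ne_zero).comp tendsto_norm_cocompact_atTop)
  have h2 := h1.inv_tendsto_atTop.const_mul C
  rw [mul_zero] at h2
  refine squeeze_zero_norm (fun x => ?_) h2
  simpa using hC x

section SmoothEquilibrium

variable {V r a a₁ a₂ : ℝ → ℝ} {P : ℝ} {μ : Measure ℝ}

lemma SmoothEquilibrium.quadDecay (hS : SmoothEquilibrium V P r a a₁ a₂) : QuadDecay r := by
  have := hS.rapidDecay.quadDecay_mul (b := fun _ => 1) (boundedFun_const 1).moderateGrowth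
    (by simpa only [one_mul] using hS.holderHalf.continuous.aestronglyMeasurable)
  simpa only [one_mul] using this

lemma SmoothEquilibrium.continuous (hS : SmoothEquilibrium V P r a a₁ a₂) : Continuous r :=
  hS.holderHalf.continuous

lemma SmoothEquilibrium.continuous_a (hS : SmoothEquilibrium V P r a a₁ a₂) : Continuous a :=
  continuous_iff_continuousAt.2 fun x => (hS.hasDerivAt_a x).continuousAt

lemma SmoothEquilibrium.moderateGrowth_a (hS : SmoothEquilibrium V P r a a₁ a₂) :
    ModerateGrowth V a := by
  simpa using (moderateGrowth_deriv (V := V)).add hS.boundedFun_sub.moderateGrowth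

lemma SmoothEquilibrium.moderateGrowth_a₁ (hS : SmoothEquilibrium V P r a a₁ a₂) :
    ModerateGrowth V a₁ := by
  obtain ⟨C, h0, h⟩ := hS.a₁_le
  exact moderateGrowth_of_le_deriv h0 h

lemma SmoothEquilibrium.isTameDensity (hS : SmoothEquilibrium V P r a a₁ a₂)
    (h1 : ∫ x, r x = 1) : IsTameDensity r where
  measurable := hS.continuous.measurable
  nonneg := fun x => (hS.pos x).le
  integrable := hS.quadDecay.integrable
  integral_eq_one := h1
  quadDecay := hS.quadDecay
  moment := by
    refine (hS.rapidDecay.quadDecay_mul (b := fun x => (1 + |x|) ^ 2) ?_ ?_).integrable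
    · refine ⟨2, 0, 1, by norm_num, fun x => ?_⟩
      rw [abs_of_nonneg (by positivity), pow_zero, pow_one, one_mul]
      nlinarith [sq_nonneg (1 - |x|), sq_abs x]
    · have := hS.continuous
      exact (by fun_prop : Continuous fun x => (1 + |x|) ^ 2 * r x).aestronglyMeasurable

/-- Products `b r` with `b` and `b'` of moderate growth are Hölder continuous. -/
lemma SmoothEquilibrium.holderHalf_mul (hS : SmoothEquilibrium V P r a a₁ a₂) {b b' : ℝ → ℝ}
    (hb : ModerateGrowth V b) (hb' : ModerateGrowth V b') (hd : ∀ x, HasDerivAt b (b' x) x) :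
    HolderHalf fun x => b x * r x := by
  refine holderHalf_of_deriv (hS.rapidDecay.boundedFun_mul hb)
    (fun x => (hd x).mul (hS.hasDerivAt x)) ?_
  refine (hS.rapidDecay.boundedFun_mul (hb'.sub (hb.mul hS.moderateGrowth_a))).mono
    fun x => le_of_eq ?_
  congr 1; ring

/-- Solutions of `ψ' = a ψ + s` with `s` bounded and `ψ r → 0` are of order `1 / V'`. -/
lemma SmoothEquilibrium.boundedFun_of_ode (hS : SmoothEquilibrium V P r a a₁ a₂)
    (hV : PotentialAssumptions V μ) {ψ s : ℝ → ℝ}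
    (hψ : ∀ x, HasDerivAt ψ (a x * ψ x + s x) x) (hs : BoundedFun s)
    (hψr : Tendsto (fun x => ψ x * r x) (cocompact ℝ) (𝓝 0)) :
    BoundedFun fun x => ψ x * (1 + |deriv V x|) := by
  obtain ⟨K, hK0, hK⟩ := hV.exists_le_deriv hV.continuous_deriv2 hV.second_deriv
  have hψc : Continuous ψ := continuous_iff_continuousAt.2 fun x => (hψ x).continuousAt
  have hV1 := hV.continuous_deriv
  have hr0 := hS.quadDecay.tendsto_zero
  rw [cocompact_eq_atBot_atTop] at hr0 hψr
  refine boundedFun_of_isBigO_cocompact (by fun_prop) ?_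
  rw [cocompact_eq_atBot_atTop, isBigO_sup]
  constructor
  · obtain ⟨D, hD⟩ := eventually_mul_le_of_ode_atTop (r := fun x => r (-x)) (a := fun x => -a (-x))
      (b := fun x => -deriv V (-x)) (b' := fun x => iteratedDeriv 2 V (-x))
      (ψ := fun x => ψ (-x)) (s := fun x => -s (-x)) (K := K) (fun x => hS.pos _)
      (fun x => (hS.hasDerivAt (-x)).comp_neg_self.congr_deriv (by ring))
      (fun x => (hV.hasDerivAt_deriv (-x)).comp_neg_self.neg.congr_deriv (by ring))
      (fun x => (hψ (-x)).comp_neg_self.congr_deriv (by ring))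
      (by obtain ⟨C, hC⟩ := hs; exact ⟨C, fun x => by rw [abs_neg]; exact hC _⟩)
      (by
        obtain ⟨C, hC⟩ := hS.boundedFun_sub
        exact ⟨C, fun x => by
          simp only
          rw [show -a (-x) - -deriv V (-x) = -(a (-x) - deriv V (-x)) by ring, abs_neg]
          exact hC _⟩)
      (fun x => by rw [abs_neg]; exact hK _) hV.tendsto_deriv_atBot
      ((hr0.mono_left le_sup_left).comp tendsto_neg_atTop_atBot)
      ((hψr.mono_left le_sup_left).comp tendsto_neg_atTop_atBot)
    refine IsBigO.of_bound D ?_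
    filter_upwards [tendsto_neg_atBot_atTop.eventually hD] with x hx
    simp only [neg_neg, abs_neg] at hx
    rwa [norm_mul, norm_one, mul_one, Real.norm_eq_abs,
      Real.norm_of_nonneg (by positivity : 0 ≤ 1 + |deriv V x|)]
  · obtain ⟨D, hD⟩ := eventually_mul_le_of_ode_atTop hS.pos hS.hasDerivAt hV.hasDerivAt_deriv hψ hs
      hS.boundedFun_sub hK hV.tendsto_deriv_atTop (hr0.mono_left le_sup_right)
      (hψr.mono_left le_sup_right)
    refine IsBigO.of_bound D ?_
    filter_upwards [hD] with x hx
    rwa [norm_mul, norm_one, mul_one, Real.norm_eq_abs,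
      Real.norm_of_nonneg (by positivity : 0 ≤ 1 + |deriv V x|)]

/-! ### Regularity of the solution -/

/-- The primitive of a rapidly decaying function of mean zero has quadratic decay. -/
lemma exists_primitive_quadDecay {k : ℝ → ℝ} (hk : Continuous k) {C : ℝ} (hC0 : 0 ≤ C)
    (hC : ∀ x, |k x| ≤ C * ((1 + x ^ 2)⁻¹) ^ 2) (h0 : ∫ x, k x = 0) :
    ∃ g : ℝ → ℝ, QuadDecay g ∧ ∀ x, HasDerivAt g (k x) x := by
  have hki : Integrable k := by
    refine (integrable_inv_one_add_sq.const_mul C).mono' hk.aestronglyMeasurable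
      (.of_forall fun x => (hC x).trans (mul_le_mul_of_nonneg_left ?_ hC0))
    rw [sq]
    exact mul_le_of_le_one_left (by positivity) (inv_one_add_sq_le_one x)
  set J := ∫ x : ℝ, (1 + x ^ 2)⁻¹ with hJ
  have hset : ∀ (x : ℝ) (S : Set ℝ), MeasurableSet S → (∀ t ∈ S, x ^ 2 ≤ t ^ 2) →
      |∫ t in S, k t| ≤ C * J * (1 + x ^ 2)⁻¹ := by
    intro x S hSm hS
    have hi : Integrable fun t : ℝ => C * (1 + x ^ 2)⁻¹ * (1 + t ^ 2)⁻¹ :=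
      integrable_inv_one_add_sq.const_mul _
    calc |∫ t in S, k t| ≤ ∫ t in S, C * (1 + x ^ 2)⁻¹ * (1 + t ^ 2)⁻¹ := by
          rw [← Real.norm_eq_abs]
          refine norm_integral_le_of_norm_le hi.integrableOn ?_
          filter_upwards [ae_restrict_mem hSm] with t ht
          refine (hC t).trans ?_
          rw [sq, mul_assoc]
          refine mul_le_mul_of_nonneg_left (mul_le_mul_of_nonneg_right ?_ (by positivity)) hC0
          exact inv_anti₀ (by positivity) (by linarith [hS t ht])
      _ ≤ ∫ t, C * (1 + x ^ 2)⁻¹ * (1 + t ^ 2)⁻¹ :=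
          setIntegral_le_integral hi (.of_forall fun t => by
            simp only [Pi.zero_apply]; positivity)
      _ = _ := by rw [integral_const_mul]; ring
  have hd : ∀ x, HasDerivAt (fun x => ∫ t in Iic x, k t) (k x) x := by
    intro x
    have e : (fun x => ∫ t in Iic x, k t) = fun x => (∫ t in Iic (0 : ℝ), k t)
        + ∫ t in (0 : ℝ)..x, k t := by
      ext x
      rw [← intervalIntegral.integral_Iic_sub_Iic hki.integrableOn hki.integrableOn]; ring
    rw [e]
    exact (hk.integral_hasStrictDerivAt 0 x).hasDerivAt.const_add _
  refine ⟨fun x => ∫ t in Iic x, k t, ⟨?_, C * J, fun x => ?_⟩, hd⟩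
  · exact (continuous_iff_continuousAt.2 fun x => (hd x).continuousAt).aestronglyMeasurable
  · rcases le_total x 0 with hx | hx
    · exact hset x _ measurableSet_Iic fun t ht => by nlinarith [mem_Iic.1 ht]
    · have e : ∫ t in Iic x, k t = -∫ t in Ioi x, k t := by
        have := intervalIntegral.integral_Iic_add_Ioi (b := x) hki.integrableOn hki.integrableOn
        linarith
      rw [e, abs_neg]
      exact hset x _ measurableSet_Ioi fun t ht => by nlinarith [mem_Ioi.1 ht]

/-- Solutions of the integral equation are twice differentiable with bounded derivatives. -/
theorem SmoothEquilibrium.regularity (hS : SmoothEquilibrium V P r a a₁ a₂)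
    {f w : ℝ → ℝ} {c A : ℝ} (hf : ContDiff ℝ 2 f) (hf0 : BoundedFun f)
    (hf1 : BoundedFun (deriv f)) (hf2 : BoundedFun (iteratedDeriv 2 f))
    (hwm : AEStronglyMeasurable w volume)
    (hw : ∀ x, w x = f x + c + 2 * P * logPot (fun y => w y * r y) x)
    (hA : ∀ x, |logPot (fun y => w y * r y) x| ≤ A * (1 + |x|)) (h0 : ∫ x, w x * r x = 0) :
    ∃ g w₁ w₂ : ℝ → ℝ, BoundedFun w ∧ BoundedFun w₁ ∧ BoundedFun w₂ ∧
      (∀ x, HasDerivAt w (w₁ x) x) ∧ (∀ x, HasDerivAt w₁ (w₂ x) x) ∧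
      QuadDecay g ∧ ∀ x, HasDerivAt g (w x * r x) x := by
  have df : ∀ x, HasDerivAt f (deriv f x) x := fun x =>
    (hf.differentiable (by norm_num) x).hasDerivAt
  have df1 : ∀ x, HasDerivAt (deriv f) (iteratedDeriv 2 f x) x := fun x => by
    have := hasDerivAt_iteratedDeriv (n := 2) hf (k := 1) (by norm_num) x
    rwa [iteratedDeriv_one] at this
  have hrc := hS.continuous
  have hrH := hS.holderHalf
  have hrb := hS.quadDecay.boundedFun
  have hrd := hS.rapidDecay
  have ma := hS.moderateGrowth_a
  have ma1 := hS.moderateGrowth_a₁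
  have hac := hS.continuous_a
  set k : ℝ → ℝ := fun x => w x * r x with hk
  -- growth of `w`
  have mL : ModerateGrowth V (logPot k) := by
    have hA0 : 0 ≤ A := by simpa using (abs_nonneg _).trans (hA 0)
    refine ⟨2 * A, 0, 1, by positivity, fun x => (hA x).trans ?_⟩
    rw [pow_zero, pow_one, one_mul]
    nlinarith [sq_nonneg (1 - |x|), sq_abs x, mul_nonneg hA0 (sq_nonneg x),
      mul_nonneg hA0 (sq_nonneg (1 - |x|))]
  have mw : ModerateGrowth V w := by
    have : w = fun x => f x + c + 2 * P * logPot k x := funext hw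
    rw [this]
    exact (hf0.add (boundedFun_const c)).moderateGrowth.add (mL.const_mul (2 * P))
  have hkq : QuadDecay k := hrd.quadDecay_mul mw (hwm.mul hrc.aestronglyMeasurable)
  have hLc : Continuous (logPot k) := hkq.continuous_logPot
  have hwc : Continuous w := by
    have : w = fun x => f x + c + 2 * P * logPot k x := funext hw
    rw [this]
    have := hf.continuous
    fun_prop
  have hkc : Continuous k := hwc.mul hrc
  -- boundedness of `w`
  obtain ⟨C, hC0, hC⟩ := hrd.exists_le_pow mw 2
  obtain ⟨g, hg, hgd⟩ := exists_primitive_quadDecay hkc hC0 hC h0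
  have hgH : HolderHalf g := holderHalf_of_deriv hg.boundedFun hgd hkq.boundedFun
  have hLb : BoundedFun (logPot k) := by
    refine (hg.boundedFun_pvHilbert hgH).mono fun x => le_of_eq ?_
    rw [hg.pvHilbert_eq_neg_logPot hgH hkq hgd hkc x, abs_neg]
  have hwb : BoundedFun w := by
    have : w = fun x => f x + c + 2 * P * logPot k x := funext hw
    rw [this]
    exact (hf0.add (boundedFun_const c)).add (hLb.const_mul (2 * P))
  -- first derivative
  have hwH : HolderHalf w := by
    have e : w = fun x => f x + 2 * P * logPot k x + c * 1 := by ext x; rw [hw]; ring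
    have h1 := (holderHalf_of_deriv hf0 df hf1).add (hkq.holderHalf_logPot.const_mul (2 * P))
    have h2 : HolderHalf fun _ => c * 1 := ⟨0, by simp⟩
    rw [e]; exact h1.add h2
  have hkH : HolderHalf k := hwH.mul hrH hwb hrb
  have hp1 := hkq.boundedFun_pvHilbert hkH
  have cp1 := hkq.continuous_pvHilbert hkH
  set w₁ : ℝ → ℝ := fun x => deriv f x + -(2 * P) * pvHilbert k x with hw₁
  have dw : ∀ x, HasDerivAt w (w₁ x) x := by
    intro x
    have h1 := ((df x).add_const c).add
      ((hkq.hasDerivAt_logPot_pvHilbert hkH x).const_mul (2 * P))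
    refine (h1.congr_of_eventuallyEq (.of_forall fun y => hw y)).congr_deriv ?_
    simp only [hw₁]; ring
  have hw₁b : BoundedFun w₁ := hf1.add (hp1.const_mul _)
  have hdfc : Continuous (deriv f) := continuous_iff_continuousAt.2 fun x => (df1 x).continuousAt
  have hw₁c : Continuous w₁ := by fun_prop
  set k₁ : ℝ → ℝ := fun x => (w₁ x - a x * w x) * r x with hk₁
  have hk₁c : Continuous k₁ := by fun_prop
  have dk : ∀ x, HasDerivAt k (k₁ x) x := by
    intro x
    refine ((dw x).mul (hS.hasDerivAt x)).congr_deriv ?_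
    simp only [hk₁]; ring
  have hk₁q : QuadDecay k₁ := hrd.quadDecay_mul
    (hw₁b.moderateGrowth.sub (ma.mul hwb.moderateGrowth)) hk₁c.aestronglyMeasurable
  have hL1 : ∀ x, pvHilbert k x = -logPot k₁ x := hkq.pvHilbert_eq_neg_logPot hkH hk₁q dk hk₁c
  have hp1H : HolderHalf (pvHilbert k) := by
    have e : pvHilbert k = fun x => -1 * logPot k₁ x := by ext x; rw [hL1]; ring
    rw [e]; exact hk₁q.holderHalf_logPot.const_mul _
  -- second derivative
  have hw₁H : HolderHalf w₁ := (holderHalf_of_deriv hf1 df1 hf2).add (hp1H.const_mul _)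
  have hk₁H : HolderHalf k₁ := by
    have h1 := (hw₁H.mul hrH hw₁b hrb).add ((hS.holderHalf_mul (ma.mul hwb.moderateGrowth)
      ((ma1.mul hwb.moderateGrowth).add (ma.mul hw₁b.moderateGrowth))
      (fun x => (hS.hasDerivAt_a x).mul (dw x))).const_mul (-1))
    have e : k₁ = fun x => w₁ x * r x + -1 * (a x * w x * r x) := by
      ext x; simp only [hk₁]; ring
    rw [e]; exact h1
  have hp2 := hk₁q.boundedFun_pvHilbert hk₁H
  refine ⟨g, w₁, fun x => iteratedDeriv 2 f x + -(2 * P) * pvHilbert k₁ x, hwb, hw₁b,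
    hf2.add (hp2.const_mul _), dw, fun x => ?_, hg, hgd⟩
  have h1 := (hk₁q.hasDerivAt_logPot_pvHilbert hk₁H x).neg
  rw [neg_neg] at h1
  exact (df1 x).add ((h1.congr_of_eventuallyEq (.of_forall fun y => hL1 y)).const_mul _)

/-- Functions of order `V'` times functions of order `1 / V'` are bounded. -/
lemma boundedFun_mul_of_le_deriv {b φ : ℝ → ℝ}
    (hb : ∃ C : ℝ, 0 ≤ C ∧ ∀ x, |b x| ≤ C * (1 + |deriv V x|))
    (hφ : BoundedFun fun x => φ x * (1 + |deriv V x|)) : BoundedFun fun x => b x * φ x := by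
  obtain ⟨C, hC0, hC⟩ := hb
  obtain ⟨D, hD⟩ := hφ
  refine ⟨C * D, fun x => ?_⟩
  have h1 := hD x
  rw [abs_mul, abs_of_pos (show 0 < 1 + |deriv V x| by positivity)] at h1
  rw [abs_mul]
  calc |b x| * |φ x| ≤ C * (1 + |deriv V x|) * |φ x| :=
        mul_le_mul_of_nonneg_right (hC x) (abs_nonneg _)
    _ = C * (|φ x| * (1 + |deriv V x|)) := by ring
    _ ≤ _ := mul_le_mul_of_nonneg_left h1 hC0

lemma BoundedFun.of_mul_weight {φ : ℝ → ℝ} (hφ : BoundedFun fun x => φ x * (1 + |deriv V x|)) :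
    BoundedFun φ := by
  have := boundedFun_mul_of_le_deriv (V := V) (b := fun _ => 1)
    ⟨1, zero_le_one, fun x => by rw [abs_one]; linarith [abs_nonneg (deriv V x)]⟩ hφ
  simpa using this

/-- Existence of the derivative `φ` of the solution, with its decay at infinity. -/
theorem SmoothEquilibrium.exists_phi (hS : SmoothEquilibrium V P r a a₁ a₂)
    (hV : PotentialAssumptions V μ) {g w w₁ w₂ : ℝ → ℝ} (hw : BoundedFun w) (hw₁ : BoundedFun w₁)
    (hw₂ : BoundedFun w₂) (dw : ∀ x, HasDerivAt w (w₁ x) x) (dw₁ : ∀ x, HasDerivAt w₁ (w₂ x) x)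
    (hg : QuadDecay g) (dg : ∀ x, HasDerivAt g (w x * r x) x) :
    ∃ φ φ₁ φ₂ φ₃ : ℝ → ℝ, (∀ x, HasDerivAt φ (φ₁ x) x) ∧ (∀ x, HasDerivAt φ₁ (φ₂ x) x) ∧
      (∀ x, HasDerivAt φ₂ (φ₃ x) x) ∧ (∀ x, φ₁ x = w x + a x * φ x) ∧
      BoundedFun (fun x => φ x * (1 + |deriv V x|)) ∧
      BoundedFun (fun x => φ₁ x * (1 + |deriv V x|)) ∧
      BoundedFun (fun x => φ₂ x * (1 + |deriv V x|)) := by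
  have hr0 := hS.quadDecay.tendsto_zero
  have ha : ∃ C : ℝ, 0 ≤ C ∧ ∀ x, |a x| ≤ C * (1 + |deriv V x|) := by
    obtain ⟨D, h0, hD⟩ := le_deriv_add_bounded (V := V) (b := deriv V) (C := 1)
      (fun x => by linarith) hS.boundedFun_sub
    exact ⟨D, h0, fun x => by simpa using hD x⟩
  have hbr : ∀ {ψ : ℝ → ℝ}, BoundedFun ψ → Tendsto (fun x => ψ x * r x) (cocompact ℝ) (𝓝 0) := by
    rintro ψ ⟨C, hC⟩
    have := hr0.norm.const_mul C
    rw [norm_zero, mul_zero] at this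
    refine squeeze_zero_norm (fun x => ?_) this
    rw [norm_mul]
    exact mul_le_mul_of_nonneg_right (hC x) (norm_nonneg _)
  set φ : ℝ → ℝ := fun x => g x / r x with hφ
  set φ₁ : ℝ → ℝ := fun x => w x + a x * φ x with hφ₁
  set φ₂ : ℝ → ℝ := fun x => w₁ x + (a₁ x * φ x + a x * φ₁ x) with hφ₂
  set φ₃ : ℝ → ℝ := fun x => w₂ x + ((a₂ x * φ x + a₁ x * φ₁ x) + (a₁ x * φ₁ x + a x * φ₂ x))
    with hφ₃
  have dφ : ∀ x, HasDerivAt φ (φ₁ x) x := by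
    intro x
    have hne := (hS.pos x).ne'
    refine ((dg x).div (hS.hasDerivAt x) hne).congr_deriv ?_
    simp only [hφ₁, hφ]
    field_simp; ring
  have dφ₁ : ∀ x, HasDerivAt φ₁ (φ₂ x) x := fun x =>
    (dw x).add ((hS.hasDerivAt_a x).mul (dφ x))
  have dφ₂ : ∀ x, HasDerivAt φ₂ (φ₃ x) x := fun x =>
    (dw₁ x).add (((hS.hasDerivAt_a₁ x).mul (dφ x)).add ((hS.hasDerivAt_a x).mul (dφ₁ x)))
  have b0 : BoundedFun fun x => φ x * (1 + |deriv V x|) := by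
    refine hS.boundedFun_of_ode hV (s := w) (fun x => (dφ x).congr_deriv ?_) hw ?_
    · simp only [hφ₁]; ring
    · refine hg.tendsto_zero.congr fun x => ?_
      have hne := (hS.pos x).ne'
      simp only [hφ]; field_simp
  have c1 : BoundedFun fun x => w₁ x + a₁ x * φ x :=
    hw₁.add (boundedFun_mul_of_le_deriv hS.a₁_le b0)
  have b1 : BoundedFun fun x => φ₁ x * (1 + |deriv V x|) := by
    refine hS.boundedFun_of_ode hV (fun x => (dφ₁ x).congr_deriv ?_) c1
      (hbr (hw.add (boundedFun_mul_of_le_deriv ha b0)))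
    simp only [hφ₂]; ring
  have b2 : BoundedFun fun x => φ₂ x * (1 + |deriv V x|) := by
    refine hS.boundedFun_of_ode hV
      (s := fun x => w₂ x + (a₂ x * φ x + (a₁ x * φ₁ x + a₁ x * φ₁ x)))
      (fun x => (dφ₂ x).congr_deriv ?_) ?_ (hbr ?_)
    · simp only [hφ₃]; ring
    · exact hw₂.add ((boundedFun_mul_of_le_deriv hS.a₂_le b0).add
        ((boundedFun_mul_of_le_deriv hS.a₁_le b1).add (boundedFun_mul_of_le_deriv hS.a₁_le b1)))
    · exact hw₁.add ((boundedFun_mul_of_le_deriv hS.a₁_le b0).add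
        (boundedFun_mul_of_le_deriv ha b1))
  exact ⟨φ, φ₁, φ₂, φ₃, dφ, dφ₁, dφ₂, fun x => rfl, b0, b1, b2⟩

end SmoothEquilibrium

/-! ### The master operator -/

lemma truncatedHilbert_congr_ae {g h : ℝ → ℝ} (e : g =ᵐ[volume] h) :
    truncatedHilbert g = truncatedHilbert h := by
  ext x ε
  refine integral_congr_ae (ae_restrict_of_ae ?_)
  filter_upwards [e] with t ht
  rw [ht]

/-- Difference quotients against a density, in terms of Hilbert transforms. -/
lemma integral_quotient_mul {φ r : ℝ → ℝ} (hr : QuadDecay r) (hrH : HolderHalf r)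
    (hg : QuadDecay fun y => φ y * r y) (hgH : HolderHalf fun y => φ y * r y) {x : ℝ}
    (hi : Integrable fun y => (φ x - φ y) / (x - y) * r y) :
    ∫ y, (φ x - φ y) / (x - y) * r y = pvHilbert (fun y => φ y * r y) x - φ x * pvHilbert r x := by
  have hm : ∀ ε : ℝ, MeasurableSet {y : ℝ | ε < |y - x|} := fun ε =>
    measurableSet_lt (by fun_prop) (by fun_prop)
  have t1 : Tendsto (fun ε : ℝ => ∫ y in {y : ℝ | ε < |y - x|}, (φ x - φ y) / (x - y) * r y)
      (𝓝[>] 0) (𝓝 (∫ y, (φ x - φ y) / (x - y) * r y)) := by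
    simp_rw [← integral_indicator (hm _)]
    refine tendsto_integral_filter_of_dominated_convergence
      (fun y => ‖(φ x - φ y) / (x - y) * r y‖)
      (.of_forall fun ε => hi.aestronglyMeasurable.indicator (hm ε))
      (.of_forall fun ε => .of_forall fun t => norm_indicator_le_norm_self _ _) hi.norm ?_
    have hne : ∀ᵐ y : ℝ ∂volume, y ≠ x := Measure.ae_ne volume x
    filter_upwards [hne] with y hy
    have hpos : (0 : ℝ) < |y - x| := abs_pos.2 (sub_ne_zero.2 hy)
    refine tendsto_const_nhds.congr' ?_
    filter_upwards [Ioo_mem_nhdsGT hpos] with ε hε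
    have hy : y ∈ {y : ℝ | ε < |y - x|} := hε.2
    rw [indicator_of_mem hy]
  have t2 := (hg.tendsto_truncatedHilbert hgH x).sub
    ((hr.tendsto_truncatedHilbert hrH x).const_mul (φ x))
  refine tendsto_nhds_unique t1 (t2.congr' ?_)
  filter_upwards [self_mem_nhdsWithin] with ε hε
  rw [truncatedHilbert, truncatedHilbert, ← integral_const_mul,
    ← integral_sub (truncatedHilbert_eq hg x hε).1 ((truncatedHilbert_eq hr x hε).1.const_mul _)]
  congr 1; ext y
  rw [← neg_sub (φ y), ← neg_sub y, neg_div_neg_eq]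
  ring

section SmoothEquilibrium

variable {V r a a₁ a₂ : ℝ → ℝ} {P : ℝ} {μ : Measure ℝ}

/-- For `φ` with bounded derivative, the master operator acts on `φ` as
`w - 2P ∫ log |x - y| w(y) dμ(y)`, up to a constant, where `w = φ' - a φ`. -/
theorem SmoothEquilibrium.masterOperator_eq (hS : SmoothEquilibrium V P r a a₁ a₂)
    (hμ : IsProbabilityMeasure μ) (hr : μ = ofDensity r) {φ φ₁ : ℝ → ℝ}
    (dφ : ∀ x, HasDerivAt φ (φ₁ x) x)
    (hφ : BoundedFun φ) (hφ₁ : BoundedFun φ₁) (hc : Continuous φ₁) :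
    MasterOperatorConverges μ φ ∧ (∫ x, (φ₁ x - a x * φ x) * r x = 0) ∧
      Integrable (logPot fun y => (φ₁ y - a y * φ y) * r y) μ ∧
      ∀ x, masterOperator V P μ φ x =
        φ₁ x - a x * φ x - 2 * P * logPot (fun y => (φ₁ y - a y * φ y) * r y) x
          + 2 * P * ∫ y, logPot (fun y => (φ₁ y - a y * φ y) * r y) y ∂μ := by
  have hrq := hS.quadDecay
  have hrH := hS.holderHalf
  have hrm := hS.continuous.measurable
  have hrc := hS.continuous
  have hr0 : ∀ x, 0 ≤ r x := fun x => (hS.pos x).le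
  have hac := hS.continuous_a
  have hφc : Continuous φ := continuous_iff_continuousAt.2 fun x => (dφ x).continuousAt
  set g : ℝ → ℝ := fun x => φ x * r x with hg
  set k : ℝ → ℝ := fun x => (φ₁ x - a x * φ x) * r x with hk
  have hgq : QuadDecay g := hS.rapidDecay.quadDecay_mul hφ.moderateGrowth
    (by fun_prop : Continuous fun x => φ x * r x).aestronglyMeasurable
  have hgH : HolderHalf g := hS.holderHalf_mul hφ.moderateGrowth hφ₁.moderateGrowth dφ
  have hkc : Continuous k := by fun_prop
  have hkq : QuadDecay k := hS.rapidDecay.quadDecay_mul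
    (hφ₁.moderateGrowth.sub (hS.moderateGrowth_a.mul hφ.moderateGrowth)) hkc.aestronglyMeasurable
  have dg : ∀ x, HasDerivAt g (k x) x := fun x =>
    ((dφ x).mul (hS.hasDerivAt x)).congr_deriv (by simp only [hk]; ring)
  have hpv : pvHilbert g = fun x => -logPot k x :=
    funext fun x => hgq.pvHilbert_eq_neg_logPot hgH hkq dg hkc x
  have hd : (fun t => φ t * density μ t) =ᵐ[volume] g := by
    filter_upwards [hr ▸ density_ofDensity hrm hr0] with t ht
    rw [ht]
  have hH : hilbertTransform (fun t => φ t * density μ t) = fun x => -logPot k x := by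
    rw [← hpv, ← hgq.hilbertTransform_eq hgH]
    ext x
    rw [hilbertTransform, hilbertTransform, truncatedHilbert_congr_ae hd]
  have hint : Integrable (logPot k) μ := by
    obtain ⟨C, hC⟩ := hgq.boundedFun_pvHilbert hgH
    refine Integrable.of_bound hkq.continuous_logPot.aestronglyMeasurable C (.of_forall fun x => ?_)
    have := hC x
    rwa [hpv, abs_neg] at this
  have hq : ∀ x, Integrable (fun y => (φ x - φ y) / (x - y)) μ := by
    intro x
    obtain ⟨C, hC0, hC⟩ := hφ₁.exists_nonneg
    refine Integrable.of_bound (by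
      have := hφc.measurable
      exact (by fun_prop : Measurable fun y => (φ x - φ y) / (x - y)).aestronglyMeasurable) C
      (.of_forall fun y => ?_)
    rw [norm_div]
    exact div_le_of_le_mul₀ (norm_nonneg _) hC0 (abs_sub_le_of_deriv_bounded dφ hC x y)
  refine ⟨⟨hq, fun x ε hε => ?_, fun x => ⟨pvHilbert g x, ?_⟩, ?_⟩,
    integral_eq_zero_of_hasDerivAt_of_integrable dg hkq.integrable hgq.integrable, hint, fun x => ?_⟩
  · refine (truncatedHilbert_eq hgq x hε).1.congr_fun_ae (ae_restrict_of_ae ?_)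
    filter_upwards [hd] with t ht
    rw [ht]
  · rw [truncatedHilbert_congr_ae hd]
    exact hgq.tendsto_truncatedHilbert hgH x
  · rw [hH]; exact hint.neg
  · have hi := hq x
    rw [hr, integrable_ofDensity_iff hrm hr0] at hi
    rw [masterOperator, hH, integral_neg, (dφ x).deriv]
    conv_lhs => enter [1, 1, 1, 2]; rw [hr, integral_ofDensity hrm hr0]
    rw [integral_quotient_mul hrq hrH hgq hgH hi, congrFun hpv x, hS.a_eq]
    ring

end SmoothEquilibrium

/-! ### Regular solutions -/

/-- Functions in `H¹(ℝ)` are bounded. -/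
lemma boundedFun_of_memLp_two {φ φ₁ : ℝ → ℝ} (dφ : ∀ x, HasDerivAt φ (φ₁ x) x)
    (h : MemLp φ 2 volume) (h₁ : MemLp φ₁ 2 volume) : BoundedFun φ := by
  have hi : Integrable fun x => 2 * (φ x * φ₁ x) := (h.integrable_mul h₁).const_mul 2
  have hd : ∀ x, HasDerivAt (fun x => φ x ^ 2) (2 * (φ x * φ₁ x)) x := fun x =>
    ((dφ x).pow 2).congr_deriv (by push_cast; ring)
  set B := φ 0 ^ 2 + ∫ x, ‖2 * (φ x * φ₁ x)‖ with hB
  refine ⟨√B, fun x => abs_le_sqrt ?_⟩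
  have h1 := intervalIntegral.integral_eq_sub_of_hasDerivAt (a := 0) (b := x) (fun y _ => hd y)
    hi.intervalIntegrable
  have h2 := (intervalIntegral.norm_integral_le_integral_norm_uIoc (f := fun x => 2 * (φ x * φ₁ x))
    (a := 0) (b := x) (μ := volume)).trans
    (setIntegral_le_integral hi.norm (.of_forall fun _ => norm_nonneg _))
  rw [h1, Real.norm_eq_abs] at h2
  linarith [le_abs_self (φ x ^ 2 - φ 0 ^ 2)]

lemma contDiff_succ_of_hasDerivAt {n : ℕ} {f f' : ℝ → ℝ} (d : ∀ x, HasDerivAt f (f' x) x)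
    (h : ContDiff ℝ n f') : ContDiff ℝ (n + 1 : ℕ) f := by
  have e : deriv f = f' := funext fun x => (d x).deriv
  push_cast
  rw [contDiff_succ_iff_deriv]
  exact ⟨fun x => (d x).differentiableAt, by simp, e ▸ h⟩

lemma iteratedDeriv_succ_of_hasDerivAt {n : ℕ} {f g g' : ℝ → ℝ} (e : iteratedDeriv n f = g)
    (d : ∀ x, HasDerivAt g (g' x) x) : iteratedDeriv (n + 1) f = g' := by
  rw [iteratedDeriv_succ, e]
  exact funext fun x => (d x).deriv

section SmoothEquilibrium

variable {V r a a₁ a₂ : ℝ → ℝ} {P : ℝ} {μ : Measure ℝ}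

lemma PotentialAssumptions.memLp_two (hV : PotentialAssumptions V μ) {φ : ℝ → ℝ}
    (hc : Continuous φ) (hφ : BoundedFun fun x => φ x * (1 + |deriv V x|)) :
    MemLp φ 2 volume := by
  rw [memLp_two_iff_integrable_sq hc.aestronglyMeasurable]
  obtain ⟨C, hC⟩ := hφ
  refine (hc.pow 2).locallyIntegrable.integrable_of_isBigO_cocompact ?_ hV.integrable_at_infinity
  refine IsBigO.of_bound (C ^ 2) ?_
  filter_upwards [hV.tendsto_deriv.eventually_gt_atTop 0] with x hx
  have h1 : |φ x| * |deriv V x| ≤ C := by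
    refine le_trans ?_ (hC x)
    rw [abs_mul, abs_of_pos (by positivity : 0 < 1 + |deriv V x|)]
    nlinarith [abs_nonneg (φ x)]
  rw [Pi.pow_apply, norm_inv, norm_pow, norm_pow, Real.norm_eq_abs, Real.norm_eq_abs, ← div_eq_mul_inv,
    le_div_iff₀ (by positivity), ← mul_pow]
  exact pow_le_pow_left₀ (by positivity) h1 2

lemma PotentialAssumptions.isBigO_inv (hV : PotentialAssumptions V μ) {φ : ℝ → ℝ}
    (hφ : BoundedFun fun x => φ x * (1 + |deriv V x|)) :
    φ =O[cocompact ℝ] fun x => (deriv V x)⁻¹ := by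
  obtain ⟨C, hC⟩ := hφ
  refine IsBigO.of_bound C ?_
  filter_upwards [hV.tendsto_deriv.eventually_gt_atTop 0] with x hx
  rw [norm_inv, Real.norm_eq_abs, Real.norm_eq_abs, ← div_eq_mul_inv, le_div_iff₀ hx]
  refine le_trans ?_ (hC x)
  rw [abs_mul, abs_of_pos (by positivity : 0 < 1 + |deriv V x|)]
  nlinarith [abs_nonneg (φ x)]

lemma SmoothEquilibrium.memLp_of_moderateGrowth (hS : SmoothEquilibrium V P r a a₁ a₂)
    {b : ℝ → ℝ} (hb : ModerateGrowth V b) (hc : Continuous b) : MemLp b 2 (ofDensity r) := by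
  have hrc := hS.continuous
  rw [memLp_two_iff_integrable_sq hc.aestronglyMeasurable,
    integrable_ofDensity_iff hrc.measurable fun x => (hS.pos x).le]
  have := (hS.rapidDecay.quadDecay_mul (hb.mul hb)
    (by fun_prop : Continuous fun x => b x * b x * r x).aestronglyMeasurable).integrable
  simpa only [sq] using this

/-- The function `w = u'' - a u'` of a regular solution `u` solves an integral equation. -/
lemma SmoothEquilibrium.integral_equation (hS : SmoothEquilibrium V P r a a₁ a₂)
    (hμ : IsProbabilityMeasure μ) (hr : μ = ofDensity r) {f v : ℝ → ℝ}
    (hv : IsRegularSolution V P μ f v) :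
    ∃ (w : ℝ → ℝ) (c : ℝ), (∀ x, HasDerivAt v (deriv v x) x) ∧
      (∀ x, HasDerivAt (deriv v) (w x + a x * deriv v x) x) ∧ BoundedFun (deriv v) ∧
      Continuous w ∧ ModerateGrowth V w ∧ (∫ x, w x * r x = 0) ∧
      ∀ x, w x = f x + c + 2 * P * logPot (fun y => w y * r y) x := by
  have d0 : ∀ x, HasDerivAt v (deriv v x) x := fun x =>
    (hv.smooth.differentiable (by norm_num) x).hasDerivAt
  have d1 : ∀ x, HasDerivAt (deriv v) (iteratedDeriv 2 v x) x := fun x => by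
    have := hasDerivAt_iteratedDeriv (n := 3) hv.smooth (k := 1) (by norm_num) x
    rwa [iteratedDeriv_one] at this
  have d2 : ∀ x, HasDerivAt (iteratedDeriv 2 v) (iteratedDeriv 3 v x) x := fun x =>
    hasDerivAt_iteratedDeriv (n := 3) hv.smooth (k := 2) (by norm_num) x
  have e1 : iteratedDeriv 1 (deriv v) = iteratedDeriv 2 v := by
    rw [← iteratedDeriv_succ']
  have e2 : iteratedDeriv 2 (deriv v) = iteratedDeriv 3 v := by
    rw [← iteratedDeriv_succ']
  have m0 : MemLp (deriv v) 2 volume := by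
    simpa only [iteratedDeriv_zero] using hv.deriv_sobolev.memLp 0 (by norm_num)
  have m1 := hv.deriv_sobolev.memLp 1 (by norm_num)
  have m2 := hv.deriv_sobolev.memLp 2 le_rfl
  rw [e1] at m1
  rw [e2] at m2
  have b0 := boundedFun_of_memLp_two d1 m0 m1
  have b1 := boundedFun_of_memLp_two d2 m1 m2
  have c1 : Continuous (iteratedDeriv 2 v) :=
    continuous_iff_continuousAt.2 fun x => (d2 x).continuousAt
  have c0 : Continuous (deriv v) := continuous_iff_continuousAt.2 fun x => (d1 x).continuousAt
  have hac := hS.continuous_a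
  obtain ⟨-, h0, -, heq⟩ := hS.masterOperator_eq hμ hr d1 b0 b1 c1
  refine ⟨fun x => iteratedDeriv 2 v x - a x * deriv v x, -(2 * P *
    ∫ y, logPot (fun y => (iteratedDeriv 2 v y - a y * deriv v y) * r y) y ∂μ), d0,
    fun x => (d1 x).congr_deriv (by ring), b0, by fun_prop,
    b1.moderateGrowth.sub (hS.moderateGrowth_a.mul b0.moderateGrowth), h0, fun x => ?_⟩
  have := hv.equation x
  rw [operatorL, heq] at this
  linarith

/-- Regular solutions are unique. -/
theorem SmoothEquilibrium.regularSolution_unique (hS : SmoothEquilibrium V P r a a₁ a₂)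
    (hP : 0 ≤ P) (h1 : ∫ x, r x = 1) (hμ : IsProbabilityMeasure μ) (hr : μ = ofDensity r)
    {f u v : ℝ → ℝ} (hu : IsRegularSolution V P μ f u) (hv : IsRegularSolution V P μ f v) :
    v = u := by
  obtain ⟨w, c, du, du', bu, cw, mw, zw, ew⟩ := hS.integral_equation hμ hr hu
  obtain ⟨z, d, dv, dv', bv, cz, mz, zz, ez⟩ := hS.integral_equation hμ hr hv
  have hrc := hS.continuous
  have hwq : QuadDecay fun x => w x * r x := hS.rapidDecay.quadDecay_mul mw
    (by fun_prop : Continuous fun x => w x * r x).aestronglyMeasurable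
  have hzq : QuadDecay fun x => z x * r x := hS.rapidDecay.quadDecay_mul mz
    (by fun_prop : Continuous fun x => z x * r x).aestronglyMeasurable
  have hzero : ∀ x, z x - w x = 0 := by
    refine (hS.isTameDensity h1).eq_zero_of_homogeneous hS.pos hP (c := d - c)
      (hS.memLp_of_moderateGrowth (mz.sub mw) (by fun_prop)) (by fun_prop) hrc ?_ fun x => ?_
    · simp_rw [sub_mul]
      rw [integral_sub hzq.integrable hwq.integrable, zw, zz, sub_zero]
    · have : logPot (fun y => (z y - w y) * r y) x
          = logPot (fun y => z y * r y) x - logPot (fun y => w y * r y) x := by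
        rw [logPot, logPot, logPot, ← integral_sub (hzq.integrable_log_mul x)
          (hwq.integrable_log_mul x)]
        congr 1; ext y; ring
      rw [this, ez, ew]; ring
  have hwz : ∀ x, z x = w x := fun x => sub_eq_zero.1 (hzero x)
  have hφ : ∀ x, deriv v x - deriv u x = 0 := by
    set D : ℝ → ℝ := fun x => (deriv v x - deriv u x) * r x with hD
    have hDd : ∀ x, HasDerivAt D 0 x := fun x =>
      (((dv' x).sub (du' x)).mul (hS.hasDerivAt x)).congr_deriv (by
        simp only [Pi.sub_apply, hwz]; ring)
    have hDc : Continuous D := continuous_iff_continuousAt.2 fun x => (hDd x).continuousAt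
    have hDq : QuadDecay D :=
      hS.rapidDecay.quadDecay_mul (bv.sub bu).moderateGrowth hDc.aestronglyMeasurable
    have hconst : ∀ x y, D x = D y := is_const_of_deriv_eq_zero
      (fun x => (hDd x).differentiableAt) fun x => (hDd x).deriv
    intro x
    have h2 : D x = 0 := by
      refine tendsto_nhds_unique (tendsto_const_nhds.congr fun y => ?_) hDq.tendsto_zero
      exact hconst x y
    exact (mul_eq_zero.1 h2).resolve_right (hS.pos x).ne'
  have hconst : ∀ x y, v x - u x = v y - u y := is_const_of_deriv_eq_zero
    (f := fun x => v x - u x) (fun x => ((dv x).sub (du x)).differentiableAt)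
    fun x => (((dv x).sub (du x)).deriv).trans (hφ x)
  have hint : ∫ x, (v x - u x) ∂μ = 0 := by
    rw [integral_sub (hv.memH.memLp.integrable one_le_two) (hu.memH.memLp.integrable one_le_two),
      hv.memH.mean_zero, hu.memH.mean_zero, sub_zero]
  ext x
  rw [integral_congr_ae (.of_forall fun y => hconst y x), integral_const, probReal_univ,
    one_smul] at hint
  exact sub_eq_zero.1 hint

end SmoothEquilibrium

section SmoothEquilibrium

variable {V r a a₁ a₂ : ℝ → ℝ} {P : ℝ} {μ : Measure ℝ}

/-- Existence of regular solutions, with their decay at infinity. -/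
theorem SmoothEquilibrium.exists_regularSolution (hS : SmoothEquilibrium V P r a a₁ a₂)
    (hV : PotentialAssumptions V μ) (hP : 0 ≤ P) (h1 : ∫ x, r x = 1)
    (hμ : IsProbabilityMeasure μ) (hr : μ = ofDensity r) {f : ℝ → ℝ} (hf : MemT μ f) :
    ∃ u, IsRegularSolution V P μ f u ∧ MasterOperatorConverges μ (deriv u) ∧
      BoundedFun (fun x => deriv u x * (1 + |deriv V x|)) ∧
      BoundedFun (fun x => iteratedDeriv 2 u x * (1 + |deriv V x|)) ∧
      BoundedFun (fun x => iteratedDeriv 3 u x * (1 + |deriv V x|)) := by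
  have hrm := hS.continuous.measurable
  have hr0 : ∀ x, 0 ≤ r x := fun x => (hS.pos x).le
  have hT := hS.isTameDensity h1
  have hint : ∀ F : ℝ → ℝ, ∫ x, F x ∂μ = ∫ x, F x * r x := fun F => by
    rw [hr, integral_ofDensity hrm hr0]
  have hf2 : MemLp f 2 (ofDensity r) :=
    hS.memLp_of_moderateGrowth hf.bounded.moderateGrowth hf.smooth.continuous
  obtain ⟨w, c, A, hw2, hw0, hweq, hA⟩ :=
    hT.exists_solution hS.pos hP hf2 ((hint f).symm.trans hf.mean_zero)
  have hwm : AEStronglyMeasurable w volume := by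
    have e : w = fun x => f x + c + 2 * P * logPot (fun y => w y * r y) x := funext hweq
    have hfc := hf.smooth.continuous
    rw [e]
    exact (by fun_prop : Continuous fun x => f x + c).aestronglyMeasurable.add
      ((hT.aestronglyMeasurable_logPot hw2).const_mul (2 * P))
  obtain ⟨g, w₁, w₂, hwb, hw₁b, hw₂b, dw, dw₁, hg, dg⟩ := hS.regularity hf.smooth hf.bounded
    hf.bounded_deriv hf.bounded_deriv2 hwm hweq hA hw0
  obtain ⟨φ, φ₁, φ₂, φ₃, d0, d1, d2, e1, b0, b1, b2⟩ :=
    hS.exists_phi hV hwb hw₁b hw₂b dw dw₁ hg dg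
  have c0 : Continuous φ := continuous_iff_continuousAt.2 fun x => (d0 x).continuousAt
  have c1 : Continuous φ₁ := continuous_iff_continuousAt.2 fun x => (d1 x).continuousAt
  have c2 : Continuous φ₂ := continuous_iff_continuousAt.2 fun x => (d2 x).continuousAt
  have b0' := b0.of_mul_weight
  have b1' := b1.of_mul_weight
  obtain ⟨hconv, -, hLi, heq⟩ := hS.masterOperator_eq hμ hr d0 b0' b1' c1
  have hew : ∀ x, φ₁ x - a x * φ x = w x := fun x => by rw [e1]; ring
  simp only [hew] at hLi heq
  set u₀ : ℝ → ℝ := fun x => ∫ t in (0 : ℝ)..x, φ t with hu₀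
  have du₀ : ∀ x, HasDerivAt u₀ (φ x) x := fun x => (c0.integral_hasStrictDerivAt 0 x).hasDerivAt
  have hu₀2 : MemLp u₀ 2 μ := by
    obtain ⟨C, hC0, hC⟩ := b0'.exists_nonneg
    rw [hr]
    refine (hT.memLp_weight.const_mul C).mono
      (continuous_iff_continuousAt.2 fun x => (du₀ x).continuousAt).aestronglyMeasurable
      (.of_forall fun x => ?_)
    have h2 := intervalIntegral.norm_integral_le_of_norm_le_const (a := 0) (b := x) (C := C)
      (f := φ) fun t _ => hC t
    rw [sub_zero] at h2
    rw [Real.norm_of_nonneg (by positivity : 0 ≤ C * (1 + |x|))]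
    exact h2.trans (mul_le_mul_of_nonneg_left (by linarith [abs_nonneg x]) hC0)
  set u : ℝ → ℝ := fun x => u₀ x - ∫ y, u₀ y ∂μ with hu
  have du : ∀ x, HasDerivAt u (φ x) x := fun x => (du₀ x).sub_const _
  have eu1 : deriv u = φ := funext fun x => (du x).deriv
  have eu2 : iteratedDeriv 2 u = φ₁ :=
    iteratedDeriv_succ_of_hasDerivAt (iteratedDeriv_one.trans eu1) d0
  have eu3 : iteratedDeriv 3 u = φ₂ := iteratedDeriv_succ_of_hasDerivAt eu2 d1
  have hφ2 : ContDiff ℝ (2 : ℕ) φ :=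
    contDiff_succ_of_hasDerivAt d0 (contDiff_succ_of_hasDerivAt d1 (contDiff_zero.2 c2))
  have hsob : MemC2H2 φ := by
    refine ⟨hφ2, fun i hi => ?_⟩
    have f1 : iteratedDeriv 1 φ = φ₁ := iteratedDeriv_one.trans (funext fun x => (d0 x).deriv)
    interval_cases i
    · rw [iteratedDeriv_zero]; exact hV.memLp_two c0 b0
    · rw [f1]; exact hV.memLp_two c1 b1
    · rw [iteratedDeriv_succ_of_hasDerivAt f1 d1]; exact hV.memLp_two c2 b2
  have hc0 : c + 2 * P * ∫ y, logPot (fun y => w y * r y) y ∂μ = 0 := by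
    have hfi : Integrable f μ := (hr ▸ hf2).integrable one_le_two
    have h2 : ∫ x, w x ∂μ = 0 := (hint w).trans hw0
    have hfc : Integrable (fun x => f x + c) μ := hfi.add (integrable_const c)
    rw [integral_congr_ae (.of_forall hweq), integral_add hfc (hLi.const_mul _),
      integral_add hfi (integrable_const c), hf.mean_zero, integral_const, integral_const_mul,
      probReal_univ, one_smul, zero_add] at h2
    exact h2
  refine ⟨u, ⟨?_, eu1 ▸ hsob, eu3 ▸ b2.of_mul_weight, ⟨hu₀2.sub (memLp_const _), ?_, ?_⟩,
    fun x => ?_⟩, eu1 ▸ hconv, eu1 ▸ b0, eu2 ▸ b1, eu3 ▸ b2⟩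
  · exact_mod_cast contDiff_succ_of_hasDerivAt du hφ2
  · rw [eu1, hr]
    exact hS.memLp_of_moderateGrowth b0'.moderateGrowth c0
  · rw [integral_sub (hu₀2.integrable one_le_two) (integrable_const _), integral_const,
      probReal_univ, one_smul, sub_self]
  · rw [operatorL, eu1, heq, hweq x]
    linarith

end SmoothEquilibrium

lemma cltAdmissible_of_decay {V φ : ℝ → ℝ} {μ : Measure ℝ} (hV : PotentialAssumptions V μ)
    (h : MemC2H2 φ) (b0 : BoundedFun fun x => φ x * (1 + |deriv V x|))
    (b1 : BoundedFun (deriv φ)) (b2 : BoundedFun (iteratedDeriv 2 φ)) : CLTAdmissible V φ := by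
  have h2 := boundedFun_mul_of_le_deriv
    (hV.exists_le_deriv hV.continuous_deriv2 hV.second_deriv) b0
  have h3 := boundedFun_mul_of_le_deriv
    (hV.exists_le_deriv hV.continuous_deriv3 hV.third_deriv) b0
  refine ⟨h, b2, ?_, h2.mul b1, ?_, boundedFun_mul_of_le_deriv
    ⟨1, zero_le_one, fun x => by linarith⟩ b0⟩
  · simpa only [sq, mul_assoc] using h3.mul b0.of_mul_weight
  · simpa only [sq, mul_assoc] using h2.mul b0.of_mul_weight

end HighTempBeta

end

open HighTempBeta
theorem theorem7p1 (V : ℝ → ℝ) (P : ℝ) (hP : 0 < P) (μ : Measure ℝ)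
    (hμ : IsEquilibriumMeasure V P μ) (hV : PotentialAssumptions V μ)
    (f : ℝ → ℝ) (hf : MemT μ f) :
    ∃ u : ℝ → ℝ,
      (IsRegularSolution V P μ f u ∧
        ∀ v : ℝ → ℝ, IsRegularSolution V P μ f v → v = u) ∧
      MasterOperatorConverges μ (deriv u) ∧
      (deriv u =O[cocompact ℝ] fun x => (deriv V x)⁻¹) ∧
      (iteratedDeriv 2 u =O[cocompact ℝ] fun x => (deriv V x)⁻¹) ∧
      (iteratedDeriv 3 u =O[cocompact ℝ] fun x => (deriv V x)⁻¹) ∧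
      CLTAdmissible V (deriv u) := by
  have hprob := hμ.isProb
  obtain ⟨r, c, M, hae, hr, hM⟩ := hμ.exists_density_eq_exp hV hP.le
  have hden := isProbDensity_density hμ.finite.ac
  obtain ⟨a, a₁, a₂, hS⟩ := exists_smoothEquilibrium hV hP.le
    (hden.measurable.aestronglyMeasurable.congr hae) hr hM
  have h1 : ∫ x, r x = 1 := (integral_congr_ae hae).symm.trans hden.integral_eq_one
  have hμr : μ = ofDensity r := by
    rw [← ofDensity_density hμ.finite.ac]
    exact withDensity_congr_ae (hae.mono fun x hx => by simp only [hx])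
  obtain ⟨u, hu, hconv, b1, b2, b3⟩ := hS.exists_regularSolution hV hP.le h1 hprob hμr hf
  refine ⟨u, ⟨hu, fun v hv => hS.regularSolution_unique hP.le h1 hprob hμr hu hv⟩, hconv,
    hV.isBigO_inv b1, hV.isBigO_inv b2, hV.isBigO_inv b3,
    cltAdmissible_of_decay hV hu.deriv_sobolev b1 ?_ ?_⟩
  · have := b2.of_mul_weight
    rwa [iteratedDeriv_succ, iteratedDeriv_one] at this
  · have := b3.of_mul_weight
    rwa [iteratedDeriv_succ'] at this
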